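/- **Setting.** The *Gauss diagram* $G$ of an oriented classical link diagram with $m$ components consists of $m$ oriented circles parametrizing the diagram and, for every crossing, an arrow from its overpassing to its underpassing preimage, carrying the sign (local writhe) of the crossing; it is *based* if a base point, different from the end points of the arrows, is chosen on one of the circles. An *arrow diagram* consists of oriented circles and arrows between distinct points of them, without signs. Both are considered up to orientation-preserving diffeomorphisms of the circles. The oriented surface $\Sigma(A)$ of an arrow diagram $A$ is obtained from disks bounded by the circles by gluing an (orientable) ribbon along every arrow. Let $A$ be a based arrow diagram that is connected (as a graph) and such that $\Sigma(A)$ has two boundary components. Go along the boundary component of $\Sigma(A)$ that contains the base point, starting from the base point: follow the arcs of the circles along the orientation and, whenever the end of an arrow is reached, pass along the ribbon to its other end. An arrow whose ribbon is passed exactly once in this way is called *separating*. Then go along the second boundary component, starting near the first separating arrow that was met. The diagram $A$ is *ascending* (respectively *descending*) if in this passage every arrow is approached for the first time at its head (respectively at its tail). For a based Gauss diagram $G$ with $m$ circles and $n\ge 0$ let $$A^2_{n,m}(G)=\sum_{S}\ \prod_{\alpha\in S}\operatorname{sign}(\alpha),$$ where $S$ runs over all sets of $n$ arrows of $G$ such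 that the based arrow diagram formed by the circles of $G$ and the arrows in $S$ is connected, has two boundary components and is ascending. (Equivalently, $A^2_{n,m}(G)=\sum_A\langle A,G\rangle$ over all connected ascending arrow diagrams $A$ with $n$ arrows, $m$ circles and two boundary components, where $\langle A,G\rangle$ is the signed count of homomorphisms $A\to G$.) Define $D^2_{n,m}(G)$ in the same way with "descending", and let $AD_{n,m}(G)=A^2_{n,m}(G)+D^2_{n,m}(G)$. **Theorem.** Let $G$ be a based Gauss diagram of a diagram of a classical oriented $m$-component link. Then, for every $n\ge 0$, $AD_{n,m}(G)$ is independent of the position of the base point (on any of the circles). This holds even though $A^2_{n,m}(G)$ and $D^2_{n,m}(G)$ separately may depend on it: there are a Gauss diagram $G$ of a classical $m$-component link, an $n$, and two positions of the base point for which the two values of $A^2_{n,m}(G)$ differ, and so do the two values of $D^2_{n,m}(G)$. -/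

import Mathlib

/-- The number of cycles of a permutation, fixed points included. -/
noncomputable def numCycles {X : Type*} (σ : Equiv.Perm X) : ℕ :=
  Nat.card (Quotient (Equiv.Perm.SameCycle.setoid σ))

/-- Walking along the orbit `b, σ b, σ² b, …` we meet `x`, and we meet it strictly before `y`
(which may or may not be met afterwards). -/
def MeetsBefore {X : Type*} (σ : Equiv.Perm X) (b x y : X) : Prop :=
  ∃ k : ℕ, (σ ^ k) b = x ∧ ∀ j ≤ k, (σ ^ j) b ≠ y

/-- An arrow diagram with set of arrows `α`, up to orientation preserving diffeomorphisms of its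
circles. The oriented circles are cut into finitely many arcs, which form the set `X`; `next x` is
the arc that follows the arc `x` on its circle, so that the circles are the cycles of `next`. The
terminal point of an arc is either the end point of exactly one arrow or an unmarked point of the
circle: `foot (a, true)` is the arc whose terminal point is the head of the arrow `a`, and
`foot (a, false)` is the arc whose terminal point is its tail. (Unmarked points are harmless
subdivision points. They are needed on circles that carry no arrow.) A base point is an arc. -/
structure ArrowDiagram (α X : Type*) where
  next : Equiv.Perm X
  foot : α × Bool → X
  foot_injective : Function.Injective foot

namespace ArrowDiagram

variable {α X : Type*} [Fintype α] [DecidableEq X]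

/-- The involution of the set of terminal points of arcs that exchanges the head and the tail of
every arrow and fixes the unmarked points. -/
def hop (A : ArrowDiagram α X) : Equiv.Perm X :=
  Equiv.Perm.viaFintypeEmbedding ((Equiv.refl α).prodCongr Equiv.boolNot)
    ⟨A.foot, A.foot_injective⟩

/-- The passage along the boundary of the oriented surface `Σ(A)`, which is made of a disk for
every circle and an (untwisted) ribbon for every arrow: follow an arc to its terminal point; if an
arrow `a` ends there, go along the side of the ribbon of `a` to the other end of `a`, and proceed
on the arc that starts there; if not, proceed on the next arc. The components of the boundary of
`Σ(A)` are the cycles of this permutation. -/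
def trace (A : ArrowDiagram α X) : Equiv.Perm X := A.next * A.hop

/-- The union of the circles and the arrows is connected as a graph. -/
def Connected (A : ArrowDiagram α X) : Prop :=
  MulAction.IsPretransitive (Subgroup.closure ({A.next, A.hop} : Set (Equiv.Perm X))) X

/-- The boundary component of `Σ(A)` through the base point `b` approaches the arrow `a` at the
end `(a, c)`, but does not approach it at the other end: `a` is a separating arrow. -/
def SeparatesAt (A : ArrowDiagram α X) (b : X) (a : α) (c : Bool) : Prop :=
  A.trace.SameCycle b (A.foot (a, c)) ∧ ¬ A.trace.SameCycle b (A.foot (a, !c))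

/-- `y` is the second starting point `•`: it lies on another boundary component than `b`, near the
first separating arrow that is met in the passage from `b`. -/
def IsSecondStart (A : ArrowDiagram α X) (b y : X) : Prop :=
  ∃ a c, A.SeparatesAt b a c ∧ y = A.foot (a, !c) ∧
    ∀ a' c', A.SeparatesAt b a' c' → a' ≠ a →
      MeetsBefore A.trace b (A.foot (a, c)) (A.foot (a', c'))

/-- When we go along the boundary component of `b`, starting from `b`, and then along the one of
`y`, starting from `y`, we approach the arrow `a` for the first time at its end `(a, c)`. -/
def FirstApproachedAt (A : ArrowDiagram α X) (b y : X) (c : Bool) (a : α) : Prop :=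
  MeetsBefore A.trace b (A.foot (a, c)) (A.foot (a, !c)) ∨
    (¬ A.trace.SameCycle b (A.foot (a, c)) ∧ ¬ A.trace.SameCycle b (A.foot (a, !c)) ∧
      MeetsBefore A.trace y (A.foot (a, c)) (A.foot (a, !c)))

/-- `A`, based at `b`, is connected with `n` arrows, `m` circles and two boundary components, and
every arrow is approached for the first time at its head (`c = true`), that is, passed in the
direction opposite to it, respectively at its tail (`c = false`). -/
structure IsMonotoneTwo (A : ArrowDiagram α X) (b : X) (c : Bool) (n m : ℕ) : Prop where
  card_arrows : Fintype.card α = n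
  card_circles : numCycles A.next = m
  connected : A.Connected
  card_boundary : numCycles A.trace = 2
  first_approach : ∃ y, A.IsSecondStart b y ∧ ∀ a, A.FirstApproachedAt b y c a

/-- `A`, based at `b`, is an ascending diagram with `n` arrows, `m` circles and two boundary
components. -/
def IsAscendingTwo (A : ArrowDiagram α X) (b : X) (n m : ℕ) : Prop :=
  A.IsMonotoneTwo b true n m

/-- `A`, based at `b`, is a descending diagram with `n` arrows, `m` circles and two boundary
components. -/
def IsDescendingTwo (A : ArrowDiagram α X) (b : X) (n m : ℕ) : Prop :=
  A.IsMonotoneTwo b false n m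

end ArrowDiagram

/-- A (classical or virtual) Gauss diagram: an arrow diagram with a sign on every arrow. -/
structure GaussDiagram (α X : Type*) extends ArrowDiagram α X where
  sign : α → ℤˣ

namespace GaussDiagram

variable {α X : Type*} [Fintype α] [Fintype X] [DecidableEq α] [DecidableEq X]

/-- The arrow diagram which consists of the circles of `G` and the arrows in `S`. -/
def restrict (G : GaussDiagram α X) (S : Finset α) : ArrowDiagram {a // a ∈ S} X where
  next := G.next
  foot p := G.foot (p.1, p.2)
  foot_injective := by
    rintro ⟨⟨a, ha⟩, c⟩ ⟨⟨a', ha'⟩, c'⟩ h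
    have := G.foot_injective h
    simp_all

open Classical in
/-- `A²_{n,m}(G)` for the base point `b`: the sum over the ascending states, that is, over the
homomorphisms to `G` from the ascending arrow diagrams with `n` arrows, `m` circles and two
boundary components, of the product of the signs. A homomorphism maps circles onto circles, base
point to base point and arrows injectively to arrows, and it is determined, together with the
arrow diagram, by the set `S` of arrows in its image. -/
noncomputable def ascTwo (G : GaussDiagram α X) (b : X) (n m : ℕ) : ℤ :=
  ∑ S : Finset α with (G.restrict S).IsAscendingTwo b n m, ∏ a ∈ S, (G.sign a : ℤ)

open Classical in
/-- `D²_{n,m}(G)` for the base point `b`: the same sum over the descending states. -/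
noncomputable def descTwo (G : GaussDiagram α X) (b : X) (n m : ℕ) : ℤ :=
  ∑ S : Finset α with (G.restrict S).IsDescendingTwo b n m, ∏ a ∈ S, (G.sign a : ℤ)

/-- `AD_{n,m}(G) = A²_{n,m}(G) + D²_{n,m}(G)` for the base point `b`. -/
noncomputable def AD (G : GaussDiagram α X) (b : X) (n m : ℕ) : ℤ :=
  G.ascTwo b n m + G.descTwo b n m

end GaussDiagram

/-- The determinant of a pair of plane vectors. -/
def planeDet (u v : ℝ × ℝ) : ℝ := u.1 * v.2 - u.2 * v.1

/-- A diagram of a classical oriented link: oriented closed polygons in the plane, whose only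
multiple points are transverse double points in the interior of two edges, with over/under
information. `X` is the set of edges; the edge `x` runs from `vertex x` to `vertex (next x)`, and
the components are the cycles of `next`. Edges are subdivided (vertices with a straight angle are
allowed) such that each of them contains at most one crossing. `α` is the set of crossings;
`edge (a, false)` is the overpassing and `edge (a, true)` the underpassing edge at the crossing
`a`. -/
structure LinkDiagram (α X : Type*) where
  next : Equiv.Perm X
  vertex : X → ℝ × ℝ
  edge : α × Bool → X
  edge_injective : Function.Injective edge
  /-- The two edges of a crossing meet in their interiors. -/
  crossing : ∀ a, ∃ s ∈ Set.Ioo (0 : ℝ) 1, ∃ t ∈ Set.Ioo (0 : ℝ) 1,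
    AffineMap.lineMap (vertex (edge (a, false))) (vertex (next (edge (a, false)))) s =
      (AffineMap.lineMap (vertex (edge (a, true))) (vertex (next (edge (a, true)))) t : ℝ × ℝ)
  /-- The two edges of a crossing are not parallel. -/
  transverse : ∀ a,
    planeDet (vertex (next (edge (a, false))) - vertex (edge (a, false)))
      (vertex (next (edge (a, true))) - vertex (edge (a, true))) ≠ 0
  /-- There are no multiple points except for the crossings. -/
  simple : ∀ x y, ∀ s ∈ Set.Ico (0 : ℝ) 1, ∀ t ∈ Set.Ico (0 : ℝ) 1,
    AffineMap.lineMap (vertex x) (vertex (next x)) s =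
      (AffineMap.lineMap (vertex y) (vertex (next y)) t : ℝ × ℝ) →
    (x = y ∧ s = t) ∨
      ∃ a c, x = edge (a, c) ∧ y = edge (a, !c)

namespace LinkDiagram

variable {α X : Type*}

open Classical in
/-- The Gauss diagram of a link diagram: every crossing `a` gives an arrow from its overpassing
to its underpassing preimage, with the sign (local writhe) of the crossing, which is `1` if
the directions of the overpassing and the underpassing edge, in this order, form a positive basis
of the plane. The arc `x` starts at the crossing on the edge before `x` (or at an unmarked point,
if there is none), contains the vertex `x` and ends at the crossing on the edge `x` (or at an
unmarked point). -/
noncomputable def gaussDiagram (D : LinkDiagram α X) : GaussDiagram α X where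
  next := D.next
  foot := D.edge
  foot_injective := D.edge_injective
  sign a :=
    if 0 < planeDet (D.vertex (D.next (D.edge (a, false))) - D.vertex (D.edge (a, false)))
        (D.vertex (D.next (D.edge (a, true))) - D.vertex (D.edge (a, true)))
      then 1 else -1

/-- The number of components of the link. -/
noncomputable def numComponents (D : LinkDiagram α X) : ℕ := numCycles D.next

end LinkDiagram

set_option linter.unusedSectionVars false

/-! ### Walking along the orbits of a permutation -/

section Walk

variable {X : Type*} {σ τ : Equiv.Perm X} {b x y : X}

theorem Equiv.Perm.sameCycle_iff_exists_nat [Finite X] :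
    σ.SameCycle x y ↔ ∃ n : ℕ, (σ ^ n) x = y := by
  constructor
  · intro h
    obtain ⟨n, -, h⟩ := h.exists_pow_eq'
    exact ⟨n, h⟩
  · rintro ⟨n, rfl⟩
    exact ⟨(n : ℤ), by simp⟩

theorem Equiv.Perm.pow_succ_apply' (σ : Equiv.Perm X) (n : ℕ) (x : X) :
    (σ ^ (n + 1)) x = σ ((σ ^ n) x) := by
  rw [pow_succ', Equiv.Perm.mul_apply]

theorem Equiv.Perm.pow_succ_apply (σ : Equiv.Perm X) (n : ℕ) (x : X) :
    (σ ^ (n + 1)) x = (σ ^ n) (σ x) := by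
  rw [pow_succ, Equiv.Perm.mul_apply]

theorem Equiv.Perm.sameCycle_pow_self (σ : Equiv.Perm X) (n : ℕ) (x : X) :
    σ.SameCycle x ((σ ^ n) x) := ⟨n, by simp⟩

theorem Equiv.Perm.pow_mem_of_forall {C : Set X} (h : ∀ x ∈ C, σ x ∈ C) (hb : b ∈ C) (n : ℕ) :
    (σ ^ n) b ∈ C := by
  induction n with
  | zero => simpa
  | succ n ih => rw [pow_succ_apply']; exact h _ ih

theorem Equiv.Perm.SameCycle.mem_of_forall [Finite X] {C : Set X} (hxy : σ.SameCycle x y)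
    (h : ∀ x ∈ C, σ x ∈ C) (hx : x ∈ C) : y ∈ C := by
  obtain ⟨n, rfl⟩ := sameCycle_iff_exists_nat.1 hxy
  exact pow_mem_of_forall h hx n

/-- On a finite set the walk from `σ x` returns to `x`, so forward invariance already gives
invariance. -/
theorem Equiv.Perm.apply_mem_iff_of_forall [Finite X] {C : Set X} (h : ∀ x ∈ C, σ x ∈ C) (x : X) :
    σ x ∈ C ↔ x ∈ C := by
  refine ⟨fun hx => ?_, h x⟩
  have : σ.SameCycle (σ x) x := (sameCycle_apply_left.2 (SameCycle.refl _ _))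
  exact this.mem_of_forall h hx

theorem Equiv.Perm.pow_apply_eq_of_eqOn {C : Set X} (hC : ∀ x ∈ C, σ x ∈ C)
    (h : ∀ x ∈ C, σ x = τ x) (hb : b ∈ C) (n : ℕ) : (σ ^ n) b = (τ ^ n) b := by
  induction n with
  | zero => rfl
  | succ n ih =>
    rw [pow_succ_apply', pow_succ_apply', ← ih]
    exact h _ (pow_mem_of_forall hC hb n)

theorem Equiv.Perm.sameCycle_congr_of_eqOn [Finite X] {C : Set X} (hC : ∀ x ∈ C, σ x ∈ C)
    (h : ∀ x ∈ C, σ x = τ x) (hb : b ∈ C) : σ.SameCycle b x ↔ τ.SameCycle b x := by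
  simp only [sameCycle_iff_exists_nat, pow_apply_eq_of_eqOn hC h hb]

theorem MeetsBefore.congr_of_eqOn {C : Set X} (hC : ∀ x ∈ C, σ x ∈ C)
    (h : ∀ x ∈ C, σ x = τ x) (hb : b ∈ C) : MeetsBefore σ b x y ↔ MeetsBefore τ b x y := by
  simp only [MeetsBefore, Equiv.Perm.pow_apply_eq_of_eqOn hC h hb]

theorem MeetsBefore.sameCycle (h : MeetsBefore σ b x y) : σ.SameCycle b x := by
  obtain ⟨k, rfl, -⟩ := h
  exact σ.sameCycle_pow_self k b

theorem MeetsBefore.asymm (h : MeetsBefore σ b x y) : ¬ MeetsBefore σ b y x := by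
  obtain ⟨k, hk, h⟩ := h
  rintro ⟨l, hl, h'⟩
  rcases le_total k l with hkl | hkl
  · exact h' k hkl hk
  · exact h l hkl hl

theorem MeetsBefore.base_ne (h : MeetsBefore σ b x y) : b ≠ y := by
  obtain ⟨k, -, h⟩ := h
  exact h 0 (Nat.zero_le _)

open Classical in
/-- The first time at which a point is met has only earlier times before it. -/
theorem MeetsBefore.of_sameCycle [Finite X] (h : σ.SameCycle b x) (hxy : x ≠ y) :
    MeetsBefore σ b x y ∨ MeetsBefore σ b y x := by
  have hx : ∃ n : ℕ, (σ ^ n) b = x := Equiv.Perm.sameCycle_iff_exists_nat.1 h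
  by_cases hy : ∃ n ≤ Nat.find hx, (σ ^ n) b = y
  · right
    obtain ⟨n, hn, hny⟩ := hy
    refine ⟨n, hny, fun j hj hjx => ?_⟩
    have : n = Nat.find hx := le_antisymm hn ((Nat.find_min' hx hjx).trans hj)
    exact hxy (by rw [← hny, this, Nat.find_spec hx])
  · left
    push Not at hy
    exact ⟨Nat.find hx, Nat.find_spec hx, hy⟩

/-- This dichotomy is the source of the skein relation: a passage that reaches an arrow picks out
exactly one of its ends. -/
theorem MeetsBefore.iff_not [Finite X] (h : σ.SameCycle b x) (hxy : x ≠ y) :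
    MeetsBefore σ b x y ↔ ¬ MeetsBefore σ b y x :=
  ⟨fun h => h.asymm, fun h' => (MeetsBefore.of_sameCycle h hxy).resolve_right h'⟩

theorem MeetsBefore.of_not_sameCycle [Finite X] (h : σ.SameCycle b x) (hy : ¬ σ.SameCycle b y) :
    MeetsBefore σ b x y := by
  obtain ⟨n, hn⟩ := Equiv.Perm.sameCycle_iff_exists_nat.1 h
  exact ⟨n, hn, fun j _ hj => hy (hj ▸ σ.sameCycle_pow_self j b)⟩

/-- All first times drop by one; only `b`, which is now met at the end of the lap, could change its
place in the order. -/
theorem MeetsBefore.step (hx : x ≠ b) (hy : y ≠ b) :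
    MeetsBefore σ (σ b) x y ↔ MeetsBefore σ b x y := by
  constructor
  · rintro ⟨k, hk, h⟩
    refine ⟨k + 1, by rw [σ.pow_succ_apply, hk], fun j hj => ?_⟩
    rcases j with _ | j
    · exact hy.symm
    · rw [σ.pow_succ_apply]
      exact h j (by omega)
  · rintro ⟨k, hk, h⟩
    rcases k with _ | k
    · exact absurd hk hx.symm
    · refine ⟨k, by rw [← σ.pow_succ_apply, hk], fun j hj => ?_⟩
      rw [← σ.pow_succ_apply]
      exact h (j + 1) (by omega)

/-- If `x` is the last point before the walk closes up, everything on the cycle is met before. -/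
theorem MeetsBefore.not_sameCycle_of_closed [Finite X] (h : MeetsBefore σ b x y)
    (hx : σ x = b) : ¬ σ.SameCycle b y := by
  obtain ⟨k, hk, h⟩ := h
  have hC : ∀ z ∈ {z | ∃ j ≤ k, (σ ^ j) b = z}, σ z ∈ {z | ∃ j ≤ k, (σ ^ j) b = z} := by
    rintro z ⟨j, hj, rfl⟩
    rcases hj.eq_or_lt with rfl | hj
    · exact ⟨0, Nat.zero_le _, by rw [hk, hx]; rfl⟩
    · exact ⟨j + 1, hj, σ.pow_succ_apply' j b⟩
  intro hy
  obtain ⟨j, hj, hjy⟩ := hy.mem_of_forall hC ⟨0, Nat.zero_le _, rfl⟩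
  exact h j hj hjy

/-- A walk along a set on which a height function decreases. -/
theorem exists_pow_of_height [Finite X] {D : Set X} {t : X → ℤ}
    (hD : ∀ x ∈ D, x ≠ b → ∃ x' ∈ D, σ x' = x ∧ t x < t x') {q : X} (hq : q ∈ D) :
    ∃ k : ℕ, (σ ^ k) b = q ∧ ∀ j ≤ k, t q ≤ t ((σ ^ j) b) := by
  -- Going one step back inside `D` strictly decreases the number of points higher than `q`.
  induction hn : {x | t q < t x}.ncard using Nat.strong_induction_on generalizing q with
  | _ n ih =>
    by_cases hqb : q = b
    · subst hqb
      exact ⟨0, rfl, fun j hj => by simp [Nat.le_zero.1 hj]⟩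
    · obtain ⟨x', hx', rfl, hlt⟩ := hD q hq hqb
      have hss : {x | t x' < t x} ⊂ {x | t (σ x') < t x} :=
        ⟨fun x hx => hlt.trans hx, fun h => lt_irrefl (t x') (h hlt)⟩
      obtain ⟨k, hk, h⟩ := ih _ (hn ▸ Set.ncard_lt_ncard hss (Set.toFinite _)) hx' rfl
      refine ⟨k + 1, by rw [σ.pow_succ_apply', hk], fun j hj => ?_⟩
      rcases hj.eq_or_lt with rfl | hj
      · rw [σ.pow_succ_apply', hk]
      · exact hlt.le.trans (h j (by omega))

/-- Everything met up to `q` is at least as high as `q`, so a lower point cannot occur earlier. -/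
theorem MeetsBefore.of_height [Finite X] {D : Set X} {t : X → ℤ}
    (hD : ∀ x ∈ D, x ≠ b → ∃ x' ∈ D, σ x' = x ∧ t x < t x') {p q : X} (hq : q ∈ D)
    (hpq : t p < t q) : MeetsBefore σ b q p := by
  obtain ⟨k, hk, h⟩ := exists_pow_of_height hD hq
  exact ⟨k, hk, fun j hj hjp => absurd (hjp ▸ h j hj) (not_le.2 hpq)⟩

open Classical in
/-- The number of steps that lead to `b` -/
theorem exists_steps [Finite X] (σ : Equiv.Perm X) (b : X) :
    ∃ t : X → ℤ, (∀ x, σ.SameCycle b x → x ≠ b → t (σ x) = t x - 1) ∧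
      ∀ x y, σ.SameCycle b x → σ.SameCycle b y → t x = t y → x = y := by
  have h : ∀ x, σ.SameCycle b x → ∃ n : ℕ, (σ ^ n) x = b := fun x hx =>
    Equiv.Perm.sameCycle_iff_exists_nat.1 hx.symm
  refine ⟨fun x => if hx : σ.SameCycle b x then (Nat.find (h x hx) : ℤ) else 0, ?_, ?_⟩
  · intro x hx hxb
    have hx' : σ.SameCycle b (σ x) := Equiv.Perm.sameCycle_apply_right.2 hx
    simp only [hx, hx', dite_true]
    have : Nat.find (h x hx) = Nat.find (h _ hx') + 1 := by
      rw [Nat.find_eq_iff]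
      refine ⟨by rw [σ.pow_succ_apply]; exact Nat.find_spec (h _ hx'), fun n hn e => ?_⟩
      rcases n with _ | n
      · exact hxb e
      · rw [σ.pow_succ_apply] at e
        exact Nat.find_min (h _ hx') (by omega) e
    rw [this]; push_cast; ring
  · intro x y hx hy hxy
    simp only [hx, hy, dite_true, Nat.cast_inj] at hxy
    have h1 := Nat.find_spec (h x hx)
    rw [hxy] at h1
    exact (σ ^ Nat.find (h y hy)).injective (h1.trans (Nat.find_spec (h y hy)).symm)

end Walk

/-! ### Exchanging the ends of arrows -/

section Hop

variable {α X : Type*}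

open Classical in
/-- The involution that exchanges the feet of every arrow in `S`. -/
noncomputable def hop (f : α × Bool ↪ X) (S : Finset α) : Equiv.Perm X :=
  Function.Involutive.toPerm
    (fun x => if h : ∃ p : α × Bool, f p = x ∧ p.1 ∈ S then f (h.choose.1, !h.choose.2) else x) <| by
    intro x
    by_cases h : ∃ p : α × Bool, f p = x ∧ p.1 ∈ S
    · obtain ⟨h1, h2⟩ := h.choose_spec
      have h' : ∃ p : α × Bool, f p = f (h.choose.1, !h.choose.2) ∧ p.1 ∈ S := ⟨_, rfl, h2⟩
      have e : h'.choose = (h.choose.1, !h.choose.2) := f.injective h'.choose_spec.1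
      simp only [h, dite_true, h']
      rw [e]
      simpa using h1
    · simp [h]

variable (f : α × Bool ↪ X) {S T : Finset α} {a : α} {c : Bool} {x : X}

theorem hop_foot (ha : a ∈ S) (c : Bool) : hop f S (f (a, c)) = f (a, !c) := by
  have h' : ∃ p : α × Bool, f p = f (a, c) ∧ p.1 ∈ S := ⟨_, rfl, ha⟩
  have e : h'.choose = (a, c) := f.injective h'.choose_spec.1
  classical
  change dite _ _ _ = _
  rw [dif_pos h', e]

theorem hop_of_forall_ne (hx : ∀ a ∈ S, ∀ c, f (a, c) ≠ x) : hop f S x = x := by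
  classical
  change dite _ _ _ = _
  rw [dif_neg]
  rintro ⟨⟨a, c⟩, rfl, ha⟩
  exact hx a ha c rfl

theorem hop_foot_of_notMem (ha : a ∉ S) (c : Bool) : hop f S (f (a, c)) = f (a, c) :=
  hop_of_forall_ne f fun b hb d e => ha (by
    have : b = a := congrArg Prod.fst (f.injective e)
    rwa [← this])

theorem exists_foot_or (S : Finset α) (x : X) :
    (∃ a ∈ S, ∃ c, f (a, c) = x) ∨ ∀ a ∈ S, ∀ c, f (a, c) ≠ x := by
  by_cases h : ∃ a ∈ S, ∃ c, f (a, c) = x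
  · exact Or.inl h
  · push Not at h
    exact Or.inr h

@[simp] theorem hop_empty : hop f ∅ = 1 := by
  ext x
  exact hop_of_forall_ne f (by simp)

theorem hop_hop (S : Finset α) (x : X) : hop f S (hop f S x) = x := by
  rcases exists_foot_or f S x with ⟨a, ha, c, rfl⟩ | h
  · rw [hop_foot f ha, hop_foot f ha, Bool.not_not]
  · rw [hop_of_forall_ne f h, hop_of_forall_ne f h]

theorem hop_mem_iff {C : Set X} (hS : ∀ a ∈ S, ∀ c, f (a, c) ∈ C) : hop f S x ∈ C ↔ x ∈ C := by
  rcases exists_foot_or f S x with ⟨a, ha, c, rfl⟩ | h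
  · rw [hop_foot f ha]
    simp [hS a ha]
  · rw [hop_of_forall_ne f h]

variable [DecidableEq α]

/-- The involutions have disjoint supports. Thus crossings can be smoothed one after another. -/
theorem hop_union (h : Disjoint S T) : hop f (S ∪ T) = hop f S * hop f T := by
  ext x
  rw [Equiv.Perm.mul_apply]
  rcases exists_foot_or f T x with ⟨a, ha, c, rfl⟩ | hT
  · rw [hop_foot f ha, hop_foot f (Finset.mem_union_right _ ha), hop_foot_of_notMem]
    exact Finset.disjoint_right.1 h ha
  · rw [hop_of_forall_ne f hT]
    rcases exists_foot_or f S x with ⟨a, ha, c, rfl⟩ | hS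
    · rw [hop_foot f ha, hop_foot f (Finset.mem_union_left _ ha)]
    · rw [hop_of_forall_ne f hS, hop_of_forall_ne f]
      intro a ha
      rcases Finset.mem_union.1 ha with ha | ha
      · exact hS a ha
      · exact hT a ha

theorem hop_insert (h : a ∉ S) : hop f (insert a S) = hop f {a} * hop f S := by
  rw [Finset.insert_eq, hop_union]
  simpa using h

end Hop

/-! ### State sums -/

section StateSum

variable {α X 𝕂 : Type*} [DecidableEq α] [CommRing 𝕂]

/-- The sign of an arrow that has to be approached at its end `o a` -/
def arrowSign (ι : α → ℤ) (o : α → Bool) (a : α) : ℤ := ι a * if o a then 1 else -1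

/-- The weight of an arrow in a state. -/
def arrowWeight (z : 𝕂) (ι : α → ℤ) (o : α → Bool) (a : α) : 𝕂 := z * (arrowSign ι o a : 𝕂)

/-- Change the end at which the arrow `a` has to be approached. -/
def flipEnd (o : α → Bool) (a : α) : α → Bool := Function.update o a (!o a)

theorem flipEnd_self (o : α → Bool) (a : α) : flipEnd o a a = !o a := by simp [flipEnd]

theorem flipEnd_of_ne (o : α → Bool) {a a' : α} (h : a' ≠ a) : flipEnd o a a' = o a' := by
  simp [flipEnd, h]

theorem arrowSign_flipEnd_self (ι : α → ℤ) (o : α → Bool) (a : α) :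
    arrowSign ι (flipEnd o a) a = - arrowSign ι o a := by
  cases h : o a <;> simp [arrowSign, flipEnd, h]

theorem arrowSign_flipEnd_of_ne (ι : α → ℤ) (o : α → Bool) {a a' : α} (h : a' ≠ a) :
    arrowSign ι (flipEnd o a) a' = arrowSign ι o a' := by
  simp [arrowSign, flipEnd_of_ne o h]

theorem arrowWeight_flipEnd_self (z : 𝕂) (ι : α → ℤ) (o : α → Bool) (a : α) :
    arrowWeight z ι (flipEnd o a) a = - arrowWeight z ι o a := by
  simp [arrowWeight, arrowSign_flipEnd_self]

open Classical in
/-- The sum of the weights of the states `S ⊆ R` for which the smoothed diagram satisfies `Q` and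
every arrow of `S` is approached first, in the sense of `F`, at its end `o a`. -/
noncomputable def stateSum (f : α × Bool ↪ X) (z : 𝕂) (ι : α → ℤ) (Q : Equiv.Perm X → Prop)
    (F : Equiv.Perm X → X → X → Prop) (σ : Equiv.Perm X) (R : Finset α) (o : α → Bool) : 𝕂 :=
  ∑ S ∈ R.powerset,
    if Q (σ * hop f S) ∧ ∀ a ∈ S, F (σ * hop f S) (f (a, o a)) (f (a, !o a))
      then ∏ a ∈ S, arrowWeight z ι o a else 0

variable (f : α × Bool ↪ X) (z : 𝕂) (ι : α → ℤ) {Q Q' : Equiv.Perm X → Prop}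
  {F F' : Equiv.Perm X → X → X → Prop} {σ σ' : Equiv.Perm X} {R : Finset α} {o o' : α → Bool}

theorem stateSum_congr (h : ∀ S ⊆ R,
    (Q (σ * hop f S) ∧ ∀ a ∈ S, F (σ * hop f S) (f (a, o a)) (f (a, !o a))) ↔
    (Q' (σ' * hop f S) ∧ ∀ a ∈ S, F' (σ' * hop f S) (f (a, o a)) (f (a, !o a)))) :
    stateSum f z ι Q F σ R o = stateSum f z ι Q' F' σ' R o := by
  classical
  refine Finset.sum_congr rfl fun S hS => ?_
  simp only [h S (Finset.mem_powerset.1 hS)]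

theorem stateSum_congr_ends (h : ∀ a ∈ R, o a = o' a) :
    stateSum f z ι Q F σ R o = stateSum f z ι Q F σ R o' := by
  classical
  refine Finset.sum_congr rfl fun S hS => ?_
  have h' : ∀ a ∈ S, o a = o' a := fun a ha => h a (Finset.mem_powerset.1 hS ha)
  have e1 : (∀ a ∈ S, F (σ * hop f S) (f (a, o a)) (f (a, !o a))) ↔
      ∀ a ∈ S, F (σ * hop f S) (f (a, o' a)) (f (a, !o' a)) :=
    forall₂_congr fun a ha => by rw [h' a ha]
  have e2 : ∏ a ∈ S, arrowWeight z ι o a = ∏ a ∈ S, arrowWeight z ι o' a :=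
    Finset.prod_congr rfl fun a ha => by simp [arrowWeight, arrowSign, h' a ha]
  rw [e2]
  simp only [e1]

theorem mul_hop_insert {y : α} {S : Finset α} (h : y ∉ S) :
    σ * hop f (insert y S) = σ * hop f {y} * hop f S := by
  rw [hop_insert f h, mul_assoc]

/-- The states that contain the arrow `y` are states of the diagram smoothed at `y`. -/
theorem stateSum_split {y : α} (hy : y ∈ R) :
    stateSum f z ι Q F σ R o = stateSum f z ι Q F σ (R.erase y) o + arrowWeight z ι o y *
      stateSum f z ι (fun τ => Q τ ∧ F τ (f (y, o y)) (f (y, !o y))) F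
        (σ * hop f {y}) (R.erase y) o := by
  classical
  conv_lhs => rw [stateSum, ← Finset.insert_erase hy, Finset.sum_powerset_insert (by simp)]
  rw [stateSum, stateSum, Finset.mul_sum]
  congr 1
  refine Finset.sum_congr rfl fun S hS => ?_
  have hyS : y ∉ S := fun h => by simpa using Finset.mem_powerset.1 hS h
  simp only [mul_hop_insert f hyS, Finset.prod_insert hyS, Finset.forall_mem_insert, mul_ite,
    mul_zero, and_assoc]

/-- The Conway skein relation. States without `y` contribute equally to both sums. A state with `y`
is admissible for exactly one of the two ends, and the two weights of `y` are opposite; in the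
difference of the sums, the condition at `y` disappears and all states of the diagram smoothed at
`y` remain. -/
theorem stateSum_skein {y : α} (hy : y ∈ R)
    (hF : ∀ S ⊆ R, y ∈ S → Q (σ * hop f S) → ∀ c,
      (F (σ * hop f S) (f (y, c)) (f (y, !c)) ↔ ¬ F (σ * hop f S) (f (y, !c)) (f (y, c)))) :
    stateSum f z ι Q F σ R o = stateSum f z ι Q F σ R (flipEnd o y) +
      arrowWeight z ι o y * stateSum f z ι Q F (σ * hop f {y}) (R.erase y) o := by
  classical
  rw [stateSum_split f z ι hy, stateSum_split f z ι (o := flipEnd o y) hy]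
  have e : ∀ a ∈ R.erase y, flipEnd o y a = o a := fun a ha =>
    flipEnd_of_ne o (Finset.ne_of_mem_erase ha)
  rw [stateSum_congr_ends f z ι (o := flipEnd o y) (o' := o) e,
    stateSum_congr_ends f z ι (o := flipEnd o y) (o' := o) e, arrowWeight_flipEnd_self,
    flipEnd_self, add_assoc, add_right_inj, neg_mul, ← sub_eq_iff_eq_add', sub_neg_eq_add, ← mul_add]
  congr 1
  simp only [stateSum, ← Finset.sum_add_distrib]
  refine Finset.sum_congr rfl fun S hS => ?_
  have hyS : y ∉ S := fun h => by simpa using Finset.mem_powerset.1 hS h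
  have h := hF (insert y S) (Finset.insert_subset hy
    ((Finset.mem_powerset.1 hS).trans (Finset.erase_subset _ _))) (Finset.mem_insert_self _ _)
  rw [mul_hop_insert f hyS] at h
  by_cases hQ : Q (σ * hop f {y} * hop f S)
  · have h := h hQ (o y)
    rw [Bool.not_not]
    by_cases h1 : F (σ * hop f {y} * hop f S) (f (y, o y)) (f (y, !o y))
    · simp [h1, hQ, h.1 h1]
    · have h2 := not_not.1 (mt h.2 h1)
      simp [h1, hQ, h2]
  · simp [hQ]

/-- A function of the ends that is not changed by flipping arrows of `R` is constant. -/
theorem eq_of_forall_flipEnd {Δ : (α → Bool) → 𝕂} {R : Finset α} (hR : ∀ o o', (∀ a ∈ R, o a = o' a) → Δ o = Δ o')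
    (h : ∀ y ∈ R, ∀ o, Δ o = Δ (flipEnd o y)) (o o' : α → Bool) : Δ o = Δ o' := by
  -- Replace `o` by `o'` on one arrow after the other; an arrow on which they differ is changed by a
  -- flip.
  have key : ∀ B ⊆ R, Δ o = Δ (fun a => if a ∈ B then o' a else o a) := by
    intro B
    induction B using Finset.induction_on with
    | empty => intro _; simp
    | insert y B hy ih =>
      intro hB
      rw [ih ((Finset.subset_insert _ _).trans hB)]
      by_cases e : o y = o' y
      · congr 1
        ext a
        by_cases ha : a = y
        · subst ha; simp [hy, e]
        · simp [ha]
      · rw [h y (hB (Finset.mem_insert_self _ _))]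
        congr 1
        ext a
        by_cases ha : a = y
        · subst ha
          rw [flipEnd_self]
          have : (!o a) = o' a := by
            revert e; cases o a <;> cases o' a <;> simp
          simp [hy, this]
        · rw [flipEnd_of_ne _ ha]; simp [ha]
  rw [key R subset_rfl]
  exact hR _ _ fun a ha => by simp [ha]

end StateSum

/-! ### Planarity: flows and their winding numbers -/

section Planar

variable {α X : Type*} [DecidableEq α] [Fintype X]

/-- A flow on the arcs in `C` of the graph whose vertices are the crossings in `R`. -/
structure IsFlow (f : α × Bool ↪ X) (σ : Equiv.Perm X) (C : Set X) (R : Finset α) (u : X → ℤ) :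
    Prop where
  supp : ∀ x ∉ C, u x = 0
  cross : ∀ a ∈ R, u (f (a, false)) + u (f (a, true)) = u (σ (f (a, false))) + u (σ (f (a, true)))
  pass : ∀ x ∈ C, (∀ a ∈ R, ∀ c, f (a, c) ≠ x) → u (σ x) = u x

/-- The behaviour at crossings of the sum of the winding numbers of the flow `u` around the points
on the left and on the right of an arc. -/
structure IsWinding (f : α × Bool ↪ X) (ι : α → ℤ) (σ : Equiv.Perm X) (C : Set X) (R : Finset α)
    (u W : X → ℤ) : Prop where
  straight : ∀ a ∈ R, W (σ (f (a, false))) =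
    W (f (a, false)) - ι a * (u (σ (f (a, true))) + u (f (a, true)))
  across : ∀ a ∈ R, W (f (a, true)) =
    W (f (a, false)) - ι a * (u (f (a, false)) + u (f (a, true)))
  turn : ∀ a ∈ R, W (σ (f (a, true))) =
    W (f (a, false)) - ι a * (u (σ (f (a, true))) - u (f (a, false)))
  pass : ∀ x ∈ C, (∀ a ∈ R, ∀ c, f (a, c) ≠ x) → W (σ x) = W x

/-- The part `C` of a diagram with crossings `R`, in which every flow has winding numbers. -/
structure IsPlanar (f : α × Bool ↪ X) (ι : α → ℤ) (σ : Equiv.Perm X) (C : Set X) (R : Finset α) :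
    Prop where
  inv : ∀ x, σ x ∈ C ↔ x ∈ C
  feet : ∀ a ∈ R, ∀ c, f (a, c) ∈ C
  winding : ∀ u, IsFlow f σ C R u → ∃ W, IsWinding f ι σ C R u W

variable {f : α × Bool ↪ X} {ι : α → ℤ} {σ : Equiv.Perm X} {C : Set X} {R : Finset α}

theorem foot_ne_of_ne {a b : α} (h : a ≠ b) (c d : Bool) : f (a, c) ≠ f (b, d) :=
  fun e => h (congrArg Prod.fst (f.injective e))

theorem foot_ne_not (a : α) (c : Bool) : f (a, c) ≠ f (a, !c) := fun e => by
  have := congrArg Prod.snd (f.injective e)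
  cases c <;> simp at this

theorem not_foot_iff {S : Finset α} {x : X} {y : α} (hx : ∀ a ∈ S.erase y, ∀ c, f (a, c) ≠ x)
    (hy : ∀ c, f (y, c) ≠ x) : ∀ a ∈ S, ∀ c, f (a, c) ≠ x := by
  intro a ha c
  by_cases h : a = y
  · subst h; exact hy c
  · exact hx a (Finset.mem_erase.2 ⟨h, ha⟩) c

theorem smooth_foot (y : α) (c : Bool) : (σ * hop f {y}) (f (y, c)) = σ (f (y, !c)) := by
  rw [Equiv.Perm.mul_apply, hop_foot f (Finset.mem_singleton_self y)]

theorem smooth_of_ne {y : α} {x : X} (h : ∀ c, f (y, c) ≠ x) : (σ * hop f {y}) x = σ x := by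
  rw [Equiv.Perm.mul_apply, hop_of_forall_ne f]
  intro a ha c
  rw [Finset.mem_singleton.1 ha]
  exact h c

theorem smooth_foot_of_ne {y a : α} (h : a ≠ y) (c : Bool) :
    (σ * hop f {y}) (f (a, c)) = σ (f (a, c)) :=
  smooth_of_ne fun d => foot_ne_of_ne h.symm d c

theorem mul_hop_mem_iff (hinv : ∀ x, σ x ∈ C ↔ x ∈ C) {S : Finset α}
    (hS : ∀ a ∈ S, ∀ c, f (a, c) ∈ C) (x : X) : (σ * hop f S) x ∈ C ↔ x ∈ C := by
  rw [Equiv.Perm.mul_apply, hinv, hop_mem_iff f hS]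

/-- The hypothesis on `u` says that the flow runs through the oriented smoothing. The new strands
then keep the regions on their two sides, so the same `W` serves: the jumps at `y` combine to zero
along each new strand. -/
theorem IsWinding.smooth {u W : X → ℤ} {y : α} (hy : y ∈ R)
    (h : IsWinding f ι σ C R u W) (h1 : u (σ (f (y, true))) = u (f (y, false))) :
    IsWinding f ι (σ * hop f {y}) C (R.erase y) u W := by
  refine ⟨fun a ha => ?_, fun a ha => ?_, fun a ha => ?_, fun x hx hxR => ?_⟩
  · rw [smooth_foot_of_ne (Finset.ne_of_mem_erase ha), smooth_foot_of_ne (Finset.ne_of_mem_erase ha)]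
    exact h.straight a (Finset.mem_of_mem_erase ha)
  · exact h.across a (Finset.mem_of_mem_erase ha)
  · rw [smooth_foot_of_ne (Finset.ne_of_mem_erase ha)]
    exact h.turn a (Finset.mem_of_mem_erase ha)
  · by_cases hxy : ∃ c, f (y, c) = x
    · obtain ⟨c, rfl⟩ := hxy
      rw [smooth_foot]
      have e1 := h.straight y hy
      have e2 := h.across y hy
      have e3 := h.turn y hy
      rw [h1] at e1 e3
      cases c
      · simp only [Bool.not_false]; rw [e3]; ring
      · simp only [Bool.not_true]; rw [e1, e2]
    · push Not at hxy
      rw [smooth_of_ne hxy]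
      exact h.pass x hx (not_foot_iff hxR hxy)

/-- A flow after smoothing is constant along the two new strands. It therefore balances at `y`
before smoothing as well, and its winding numbers can be taken from the original diagram. -/
theorem IsPlanar.smooth (h : IsPlanar f ι σ C R) {y : α} (hy : y ∈ R) :
    IsPlanar f ι (σ * hop f {y}) C (R.erase y) := by
  refine ⟨mul_hop_mem_iff h.inv fun a ha => ?_, fun a ha => h.feet a (Finset.mem_of_mem_erase ha),
    fun u hu => ?_⟩
  · rw [Finset.mem_singleton.1 ha]; exact h.feet y hy
  · have hp : ∀ c, u (σ (f (y, !c))) = u (f (y, c)) := fun c => by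
      rw [← smooth_foot]
      exact hu.pass _ (h.feet y hy c) fun a ha d => foot_ne_of_ne (Finset.ne_of_mem_erase ha) d c
    have hu' : IsFlow f σ C R u := by
      refine ⟨hu.supp, fun a ha => ?_, fun x hx hxR => ?_⟩
      · by_cases hay : a = y
        · subst hay
          have := hp false
          have := hp true
          simp only [Bool.not_false, Bool.not_true] at *
          omega
        · have := hu.cross a (Finset.mem_erase.2 ⟨hay, ha⟩)
          rwa [smooth_foot_of_ne hay, smooth_foot_of_ne hay] at this
      · have := hu.pass x hx fun a ha => hxR a (Finset.mem_of_mem_erase ha)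
        rwa [smooth_of_ne (hxR y hy)] at this
    obtain ⟨W, hW⟩ := h.winding u hu'
    exact ⟨W, hW.smooth hy (hp false)⟩

theorem IsPlanar.smooth_subset (h : IsPlanar f ι σ C R) {T : Finset α} (hT : T ⊆ R) :
    IsPlanar f ι (σ * hop f T) C (R \ T) := by
  induction T using Finset.induction_on with
  | empty => simpa using h
  | insert y T hy ih =>
    have h1 := (ih ((Finset.subset_insert _ _).trans hT)).smooth (y := y)
      (Finset.mem_sdiff.2 ⟨hT (Finset.mem_insert_self _ _), hy⟩)
    rw [mul_assoc, ← hop_union f (by simpa using hy), Finset.union_comm, ← Finset.insert_eq] at h1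
    convert h1 using 1
    ext a
    simp only [Finset.mem_sdiff, Finset.mem_insert, Finset.mem_erase]
    tauto

/-- A flow on `U` extended by zero is a flow on `C`: at a crossing with a strand outside `U` it goes
straight on along the other strand. For the same reason its winding sum does not jump there along
the strand in `U`. -/
theorem IsPlanar.restrict (h : IsPlanar f ι σ C R) {U : Set X} (hU : U ⊆ C)
    (hinv : ∀ x, σ x ∈ U ↔ x ∈ U) {R' : Finset α}
    (hR' : ∀ a, a ∈ R' ↔ a ∈ R ∧ ∀ c, f (a, c) ∈ U) : IsPlanar f ι σ U R' := by
  refine ⟨hinv, fun a ha => ((hR' a).1 ha).2, fun u hu => ?_⟩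
  have hz : ∀ {a c}, f (a, c) ∉ U → u (f (a, c)) = 0 ∧ u (σ (f (a, c))) = 0 := fun {a c} hc =>
    ⟨hu.supp _ hc, hu.supp _ (by rwa [hinv])⟩
  have hnf : ∀ {a c d}, f (a, d) ∉ U → ∀ b ∈ R', ∀ e, f (b, e) ≠ f (a, c) := by
    intro a c d had b hb e hbe
    have : b = a := congrArg Prod.fst (f.injective hbe)
    subst this
    exact had (((hR' _).1 hb).2 d)
  have hp : ∀ {a c}, f (a, !c) ∉ U → u (σ (f (a, c))) = u (f (a, c)) := by
    intro a c hac
    by_cases hc : f (a, c) ∈ U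
    · exact hu.pass _ hc (hnf hac)
    · rw [(hz hc).1, (hz hc).2]
  have hu' : IsFlow f σ C R u := by
    refine ⟨fun x hx => hu.supp x fun hxU => hx (hU hxU), fun a ha => ?_, fun x hx hxR => ?_⟩
    · by_cases haR : a ∈ R'
      · exact hu.cross a haR
      · have : ∃ c, f (a, c) ∉ U := by
          by_contra hcon
          push Not at hcon
          exact haR ((hR' a).2 ⟨ha, hcon⟩)
        obtain ⟨c, hc⟩ := this
        have e1 := hz hc
        have e2 := hp (a := a) (c := !c) (by simpa using hc)
        cases c <;> simp only [Bool.not_false, Bool.not_true] at * <;> omega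
    · by_cases hxU : x ∈ U
      · exact hu.pass x hxU fun a ha => hxR a ((hR' a).1 ha).1
      · rw [hu.supp x hxU, hu.supp (σ x) (by rwa [hinv])]
  obtain ⟨W, hW⟩ := h.winding u hu'
  refine ⟨W, fun a ha => hW.straight a ((hR' a).1 ha).1, fun a ha => hW.across a ((hR' a).1 ha).1,
    fun a ha => hW.turn a ((hR' a).1 ha).1, fun x hx hxR => ?_⟩
  rcases exists_foot_or f R x with ⟨a, ha, c, rfl⟩ | hxR'
  · have hac : f (a, !c) ∉ U := by
      intro hac
      refine hxR a ((hR' a).2 ⟨ha, fun d => ?_⟩) c rfl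
      by_cases hdc : d = c
      · rwa [hdc]
      · rwa [Bool.eq_not.2 hdc]
    have e1 := hW.straight a ha
    have e2 := hW.across a ha
    have e3 := hW.turn a ha
    have e4 := hp hac
    have e5 := hz hac
    cases c
    · simp only [Bool.not_false] at *
      rw [e1, e5.1, e5.2]; ring
    · simp only [Bool.not_true] at *
      rw [e3, e2, e4, e5.1]; ring
  · exact hW.pass x (hU hx) hxR'

/-- Two flows have intersection number zero. -/
theorem IsWinding.sum_eq_zero {u v W : X → ℤ} (hinv : ∀ x, σ x ∈ C ↔ x ∈ C)
    (hW : IsWinding f ι σ C R u W) (hv : IsFlow f σ C R v) :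
    ∑ a ∈ R, ι a * (v (σ (f (a, false))) * (u (σ (f (a, true))) + u (f (a, true))) +
      v (σ (f (a, true))) * (u (σ (f (a, true))) - u (f (a, false))) -
      v (f (a, true)) * (u (f (a, false)) + u (f (a, true)))) = 0 := by
  classical
  -- Summation by parts: `σ` permutes the arcs, and only the feet of arrows of `R` leave a
  -- contribution. There the common value `W (f (a, false))` drops out because `v` is conserved.
  have h0 : ∑ x, (v x * W x - v (σ x) * W (σ x)) = 0 := by
    rw [Finset.sum_sub_distrib, Equiv.sum_comp σ fun x => v x * W x, sub_self]
  rw [← h0, ← Finset.sum_subset (Finset.subset_univ ((R ×ˢ Finset.univ).map f)), Finset.sum_map,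
    Finset.sum_product]
  · refine Finset.sum_congr rfl fun a ha => ?_
    rw [Fintype.sum_bool]
    have e1 := hW.straight a ha
    have e2 := hW.across a ha
    have e3 := hW.turn a ha
    have e4 := hv.cross a ha
    rw [e1, e2, e3]
    linear_combination (-W (f (a, false))) * e4
  · intro x _ hx
    have hx' : ∀ a ∈ R, ∀ c, f (a, c) ≠ x := by
      rintro a ha c rfl
      simp [ha] at hx
    by_cases hxC : x ∈ C
    · rw [hW.pass x hxC hx', hv.pass x hxC hx', sub_self]
    · rw [hv.supp x hxC, hv.supp (σ x) (by rwa [hinv])]; ring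

theorem IsPlanar.sum_eq_zero {u v : X → ℤ} (h : IsPlanar f ι σ C R)
    (hu : IsFlow f σ C R u) (hv : IsFlow f σ C R v) :
    ∑ a ∈ R, ι a * (v (σ (f (a, false))) * (u (σ (f (a, true))) + u (f (a, true))) +
      v (σ (f (a, true))) * (u (σ (f (a, true))) - u (f (a, false))) -
      v (f (a, true)) * (u (f (a, false)) + u (f (a, true)))) = 0 := by
  obtain ⟨W, hW⟩ := h.winding u hu
  exact hW.sum_eq_zero h.inv hv

end Planar

/-! ### States with one boundary component -/

section OneSum

variable {α X 𝕂 : Type*} [DecidableEq α] [Fintype X] [CommRing 𝕂]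

/-- The sum over the states in `C` with one boundary component, for the base point `b`. -/
noncomputable def oneSum (f : α × Bool ↪ X) (z : 𝕂) (ι : α → ℤ) (C : Set X) (b : X)
    (σ : Equiv.Perm X) (R : Finset α) (o : α → Bool) : 𝕂 :=
  stateSum f z ι (fun τ => ∀ x ∈ C, τ.SameCycle b x) (fun τ => MeetsBefore τ b) σ R o

variable (f : α × Bool ↪ X) (z : 𝕂) (ι : α → ℤ) {σ σ' : Equiv.Perm X} {R : Finset α}
  {o o' : α → Bool} {C : Set X} {b : X}

/-- With one boundary component every arrow in `C` is reached, so the dichotomy of its ends is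
available. -/
theorem oneSum_skein {y : α} (hy : y ∈ R) (hC : ∀ c, f (y, c) ∈ C) :
    oneSum f z ι C b σ R o = oneSum f z ι C b σ R (flipEnd o y) +
      arrowWeight z ι o y * oneSum f z ι C b (σ * hop f {y}) (R.erase y) o :=
  stateSum_skein f z ι hy fun _ _ _ hQ c => MeetsBefore.iff_not (hQ _ (hC c)) (foot_ne_not y c)

/-- A passage which approaches first the lower ends does not leave the upper part of a diagram. -/
theorem mem_of_upper {S : Finset α} {U : Set X} (hinv : ∀ x, σ x ∈ U ↔ x ∈ U) (hb : b ∈ U)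
    (hU : ∀ a ∈ S, f (a, o a) ∈ U → f (a, !o a) ∈ U)
    (hS : ∀ a ∈ S, (σ * hop f S).SameCycle b (f (a, !o a)) →
      f (a, o a) ∈ U ∨ MeetsBefore (σ * hop f S) b (f (a, o a)) (f (a, !o a)))
    (j : ℕ) : ((σ * hop f S) ^ j) b ∈ U := by
  induction j using Nat.strong_induction_on with
  | _ j ih =>
    rcases j with _ | j
    · exact hb
    · have hj := ih j (Nat.lt_succ_self j)
      rw [Equiv.Perm.pow_succ_apply']
      rcases exists_foot_or f S (((σ * hop f S) ^ j) b) with ⟨a, ha, c, hx⟩ | hx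
      · rw [← hx, Equiv.Perm.mul_apply, hop_foot f ha, hinv]
        have hsc : (σ * hop f S).SameCycle b (f (a, c)) := by
          rw [hx]; exact Equiv.Perm.sameCycle_pow_self _ _ _
        by_cases hc : c = o a
        · subst hc
          exact hU a ha (by rwa [hx])
        · have hc : c = !o a := Bool.eq_not.2 hc
          rw [hc, Bool.not_not]
          rw [hc] at hsc
          -- At an upper end the passage continues after the lower end. That end was met at an
          -- earlier time, so the induction hypothesis places it in `U`.
          rcases hS a ha hsc with h | ⟨k, hk, hlt⟩
          · exact h
          have hkj : k < j := by
            by_contra hkj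
            exact hlt j (not_lt.1 hkj) (by rw [← hx, hc])
          rw [← hk]
          exact ih k (hkj.trans (Nat.lt_succ_self j))
      · rw [Equiv.Perm.mul_apply, hop_of_forall_ne f hx, hinv]
        exact hj

/-- If on the circle of `b` the upper ends are met first, no arrow of an ascending state ends on
this circle. -/
theorem forall_foot_ne_of_top {S : Finset α}
    (htop : ∀ a ∈ S, σ.SameCycle b (f (a, o a)) → MeetsBefore σ b (f (a, !o a)) (f (a, o a)))
    (hS : ∀ a ∈ S, ∀ c, (σ * hop f S).SameCycle b (f (a, c)) →
      MeetsBefore (σ * hop f S) b (f (a, o a)) (f (a, !o a)))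
    (j : ℕ) : ((σ * hop f S) ^ j) b = (σ ^ j) b ∧ ∀ a ∈ S, ∀ c, f (a, c) ≠ (σ ^ j) b := by
  induction j using Nat.strong_induction_on with
  | _ j ih =>
    have h1 : ((σ * hop f S) ^ j) b = (σ ^ j) b := by
      rcases j with _ | j
      · rfl
      · obtain ⟨e, h⟩ := ih j (Nat.lt_succ_self j)
        rw [Equiv.Perm.pow_succ_apply', e, Equiv.Perm.mul_apply, hop_of_forall_ne f h,
          Equiv.Perm.pow_succ_apply']
    refine ⟨h1, fun a ha c hx => ?_⟩
    have key : ∀ k < j, ∀ d, (σ ^ k) b ≠ f (a, d) := fun k hk d e => (ih k hk).2 a ha d e.symm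
    by_cases hc : c = o a
    · subst hc
      obtain ⟨k, hk, hlt⟩ := htop a ha (by rw [hx]; exact Equiv.Perm.sameCycle_pow_self _ _ _)
      have hkj : k < j := by
        by_contra hkj
        exact hlt j (not_lt.1 hkj) hx.symm
      exact key k hkj _ hk
    · have hc : c = !o a := Bool.eq_not.2 hc
      obtain ⟨k, hk, hlt⟩ := hS a ha c
        (by rw [hx, ← h1]; exact Equiv.Perm.sameCycle_pow_self _ _ _)
      have hkj : k < j := by
        by_contra hkj
        exact hlt j (not_lt.1 hkj) (by rw [h1, ← hx, hc])
      rw [(ih k hkj).1] at hk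
      exact key k hkj _ hk

/-- Split diagrams have value zero: the passage from `b` never descends from the upper part `U`, so
it cannot exhaust `C`. -/
theorem oneSum_eq_zero_of_upper {U : Set X} (hinv : ∀ x, σ x ∈ U ↔ x ∈ U) (hb : b ∈ U)
    (hU : ∀ a ∈ R, f (a, o a) ∈ U → f (a, !o a) ∈ U) (hCU : ¬ C ⊆ U) :
    oneSum f z ι C b σ R o = 0 := by
  refine Finset.sum_eq_zero fun S hS => if_neg ?_
  rintro ⟨hQ, hF⟩
  refine hCU fun x hx => ?_
  obtain ⟨n, rfl⟩ := Equiv.Perm.sameCycle_iff_exists_nat.1 (hQ x hx)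
  exact mem_of_upper f hinv hb (fun a ha => hU a (Finset.mem_powerset.1 hS ha))
    (fun a ha _ => Or.inr (hF a ha)) n

/-- A descending circle is an unknot. Before any arrow of a nonempty state is used the passage
follows the circle, and so it would approach the first such arrow at its forbidden upper end; only
the empty state survives. -/
theorem oneSum_eq_one_of_top (hfeet : ∀ a ∈ R, ∀ c, f (a, c) ∈ C)
    (htop : ∀ a ∈ R, MeetsBefore σ b (f (a, !o a)) (f (a, o a)))
    (hC : ∀ x ∈ C, σ.SameCycle b x) : oneSum f z ι C b σ R o = 1 := by
  rw [oneSum, stateSum, Finset.sum_eq_single ∅]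
  · rw [if_pos]
    · simp
    · simpa using hC
  · intro S hS hne
    refine if_neg ?_
    rintro ⟨hQ, hF⟩
    obtain ⟨a, ha⟩ := Finset.nonempty_of_ne_empty hne
    obtain ⟨n, hn⟩ := Equiv.Perm.sameCycle_iff_exists_nat.1
      (hC _ (hfeet a (Finset.mem_powerset.1 hS ha) true))
    exact (forall_foot_ne_of_top f (fun a ha _ => htop a (Finset.mem_powerset.1 hS ha))
      (fun a ha _ _ => hF a ha) n).2 a ha true hn.symm
  · simp

/-- The sum depends only on the restriction of the diagram to `C`. -/
theorem oneSum_congr_of_eqOn (hinv : ∀ x, σ x ∈ C ↔ x ∈ C) (h : ∀ x ∈ C, σ x = σ' x)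
    (hfeet : ∀ a ∈ R, ∀ c, f (a, c) ∈ C) (hb : b ∈ C) :
    oneSum f z ι C b σ R o = oneSum f z ι C b σ' R o := by
  refine stateSum_congr f z ι fun S hS => ?_
  have hf : ∀ a ∈ S, ∀ c, f (a, c) ∈ C := fun a ha => hfeet a (hS ha)
  have h1 : ∀ x ∈ C, (σ * hop f S) x ∈ C := fun x hx => (mul_hop_mem_iff hinv hf x).2 hx
  have h2 : ∀ x ∈ C, (σ * hop f S) x = (σ' * hop f S) x := fun x hx => by
    rw [Equiv.Perm.mul_apply, Equiv.Perm.mul_apply]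
    exact h _ ((hop_mem_iff f hf).2 hx)
  simp only [Equiv.Perm.sameCycle_congr_of_eqOn h1 h2 hb, MeetsBefore.congr_of_eqOn h1 h2 hb]

end OneSum

/-! ### Diagrams made of two descending arcs -/

section TwoArc

variable {α X 𝕂 : Type*} [DecidableEq α] [Fintype X] [CommRing 𝕂]

/-- The part `C` of the diagram is the union of two arcs `Γ` and `C \ Γ` which start at `p` and `q`,
after the feet `(a, c)` and `(a, !c)` of the arrow `a`, and end at these feet. The height `t`
decreases along the arcs, and with the exception of `a` the arrows are approached first at the
lower end. -/
structure IsTwoArc (f : α × Bool ↪ X) (σ : Equiv.Perm X) (C : Set X) (R : Finset α) (o : α → Bool)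
    (a : α) (c : Bool) (p q : X) (Γ : Set X) (t : X → ℤ) : Prop where
  mem : a ∈ R
  head : o a = c
  start_left : σ (f (a, c)) = p
  start_right : σ (f (a, !c)) = q
  left_mem : p ∈ Γ
  right_notMem : q ∉ Γ
  side : ∀ x ∈ C, x ≠ f (a, c) → x ≠ f (a, !c) → (σ x ∈ Γ ↔ x ∈ Γ)
  desc : ∀ x ∈ C, x ≠ f (a, c) → x ≠ f (a, !c) → t (σ x) = t x - 1
  inj : ∀ x ∈ C, ∀ y ∈ C, (x ∈ Γ ↔ y ∈ Γ) → t x = t y → x = y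
  ends : f (a, c) ∈ Γ ↔ f (a, !c) ∉ Γ
  compat : ∀ y ∈ R, y ≠ a → t (f (y, o y)) ≤ t (f (y, !o y))

open Classical in
/-- The sign of `y` if it is a crossing of `Γ` with its complement, and zero otherwise. -/
noncomputable def crossTerm (f : α × Bool ↪ X) (ι : α → ℤ) (Γ : Set X) (o : α → Bool) (y : α) : ℤ :=
  if (f (y, false) ∈ Γ ↔ f (y, true) ∈ Γ) then 0 else arrowSign ι o y

/-- The sum of the signs of the crossings of `Γ` with its complement. -/
noncomputable def crossSum (f : α × Bool ↪ X) (ι : α → ℤ) (Γ : Set X) (R : Finset α)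
    (o : α → Bool) : ℤ := ∑ y ∈ R, crossTerm f ι Γ o y

theorem crossTerm_of_not {f : α × Bool ↪ X} (ι : α → ℤ) {Γ : Set X} (o : α → Bool) {y : α}
    (d : Bool) (h : f (y, d) ∈ Γ ↔ f (y, !d) ∉ Γ) : crossTerm f ι Γ o y = arrowSign ι o y := by
  refine if_neg ?_
  cases d <;> simp only [Bool.not_false, Bool.not_true] at h <;> tauto

/-- A highest point exists by finiteness, and `s` is the only point that is allowed to have nothing
above it. -/
theorem le_of_forall_exists_lt {D : Set X} {s : X} (hs : s ∈ D) {t : X → ℤ}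
    (h : ∀ x ∈ D, x ≠ s → ∃ x' ∈ D, t x < t x') : ∀ x ∈ D, t x ≤ t s := by
  obtain ⟨m, hm, hmax⟩ := Set.exists_max_image D t (Set.toFinite _) ⟨s, hs⟩
  by_cases hms : m = s
  · exact hms ▸ hmax
  · obtain ⟨x', hx', hlt⟩ := h m hm hms
    exact absurd (hmax x' hx') (not_le.2 hlt)

variable {f : α × Bool ↪ X} {ι : α → ℤ} {σ : Equiv.Perm X} {C : Set X} {R : Finset α}
  {o : α → Bool} {a : α} {c : Bool} {p q : X} {Γ : Set X} {t : X → ℤ}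

namespace IsTwoArc

theorem exists_pred (h : IsTwoArc f σ C R o a c p q Γ t) (hC : ∀ x, σ x ∈ C ↔ x ∈ C) {x : X}
    (hx : x ∈ C) (hp : x ≠ p) (hq : x ≠ q) :
    ∃ x' ∈ C, x' ≠ f (a, c) ∧ x' ≠ f (a, !c) ∧ σ x' = x := by
  refine ⟨σ.symm x, by rwa [← hC, Equiv.apply_symm_apply], ?_, ?_, by simp⟩
  · intro e; rw [← h.start_left, ← e] at hp; simp at hp
  · intro e; rw [← h.start_right, ← e] at hq; simp at hq

theorem le_left (h : IsTwoArc f σ C R o a c p q Γ t) (hC : IsPlanar f ι σ C R) {x : X}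
    (hx : x ∈ C) (hxΓ : x ∈ Γ) : t x ≤ t p := by
  have hpC : p ∈ C := by rw [← h.start_left, hC.inv]; exact hC.feet _ h.mem _
  refine le_of_forall_exists_lt (D := {x | x ∈ C ∧ x ∈ Γ}) ⟨hpC, h.left_mem⟩ ?_ x ⟨hx, hxΓ⟩
  rintro x ⟨hx, hxΓ⟩ hxp
  obtain ⟨x', hx', h1, h2, rfl⟩ := h.exists_pred hC.inv hx hxp
    fun e => h.right_notMem (e ▸ hxΓ)
  exact ⟨x', And.intro hx' ((h.side x' hx' h1 h2).1 hxΓ), by rw [h.desc x' hx' h1 h2]; omega⟩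

theorem le_right (h : IsTwoArc f σ C R o a c p q Γ t) (hC : IsPlanar f ι σ C R) {x : X}
    (hx : x ∈ C) (hxΓ : x ∉ Γ) : t x ≤ t q := by
  have hqC : q ∈ C := by rw [← h.start_right, hC.inv]; exact hC.feet _ h.mem _
  refine le_of_forall_exists_lt (D := {x | x ∈ C ∧ x ∉ Γ}) ⟨hqC, h.right_notMem⟩ ?_ x ⟨hx, hxΓ⟩
  rintro x ⟨hx, hxΓ⟩ hxq
  obtain ⟨x', hx', h1, h2, rfl⟩ := h.exists_pred hC.inv hx (fun e => hxΓ (e ▸ h.left_mem)) hxq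
  exact ⟨x', And.intro hx' fun e => hxΓ ((h.side x' hx' h1 h2).2 e), by rw [h.desc x' hx' h1 h2]; omega⟩

/-- The end point of an arc is its lowest point. -/
theorem end_lt (h : IsTwoArc f σ C R o a c p q Γ t) (hC : IsPlanar f ι σ C R) {x : X}
    (hx : x ∈ C) (h1 : x ≠ f (a, c)) (h2 : x ≠ f (a, !c)) (d : Bool)
    (hd : f (a, d) ∈ Γ ↔ x ∈ Γ) : t (f (a, d)) < t x := by
  have key : ∀ x ∈ {x | x ∈ C ∧ (f (a, d) ∈ Γ ↔ x ∈ Γ)}, -t x ≤ -t (f (a, d)) := by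
    refine le_of_forall_exists_lt (D := {x | x ∈ C ∧ (f (a, d) ∈ Γ ↔ x ∈ Γ)}) (s := f (a, d))
      (t := fun x => -t x) ⟨hC.feet _ h.mem _, Iff.rfl⟩ ?_
    rintro x ⟨hx, hxd⟩ hne
    have h1 : x ≠ f (a, c) ∧ x ≠ f (a, !c) := by
      have := h.ends
      by_cases hdc : d = c
      · subst hdc
        exact ⟨hne, fun e => by rw [e] at hxd; tauto⟩
      · rw [Bool.eq_not.2 hdc] at hxd hne
        exact ⟨fun e => by rw [e] at hxd; tauto, hne⟩
    refine ⟨σ x, ⟨(hC.inv x).2 hx, ?_⟩, ?_⟩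
    · rw [h.side x hx h1.1 h1.2, hxd]
    · rw [h.desc x hx h1.1 h1.2]; omega
  have h3 := key x ⟨hx, hd⟩
  refine lt_of_le_of_ne (by omega) fun e => ?_
  have := h.inj _ (hC.feet _ h.mem d) x hx hd e
  cases c <;> cases d <;> simp_all

/-- Smoothing at a mutual crossing exchanges the parts of the two arcs below it. Because the two
feet have equal height, `t` still drops by one across the new strands. The new first arc is the part
of `Γ` down to the crossing followed by the part of the other arc below it. -/
theorem smooth (h : IsTwoArc f σ C R o a c p q Γ t) (hC : IsPlanar f ι σ C R) {y : α}
    (hy : y ∈ R) (hya : y ≠ a) (h1 : f (y, o y) ∈ Γ) (h2 : f (y, !o y) ∉ Γ)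
    (ht : t (f (y, o y)) = t (f (y, !o y))) :
    IsTwoArc f (σ * hop f {y}) C (R.erase y) o a c p q
      {x | x ∈ Γ ↔ t (f (y, o y)) ≤ t x} t := by
  set s := t (f (y, o y)) with hs
  have hyC : ∀ d, f (y, d) ∈ C := fun d => hC.feet y hy d
  have hne : ∀ d e, f (y, d) ≠ f (a, e) := fun d e => foot_ne_of_ne hya d e
  have hend : ∀ d, t (f (a, d)) < s := by
    intro d
    by_cases hd : f (a, d) ∈ Γ
    · exact h.end_lt hC (hyC _) (hne _ _) (hne _ _) d (by tauto)
    · rw [ht]; exact h.end_lt hC (hyC (!o y)) (hne _ _) (hne _ _) d (by tauto)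
  have hp : s ≤ t p := h.le_left hC (hyC _) h1
  have hq : s ≤ t q := ht ▸ h.le_right hC (hyC (!o y)) h2
  have e1 := h.side _ (hyC (o y)) (hne _ _) (hne _ _)
  have e2 := h.side _ (hyC (!o y)) (hne _ _) (hne _ _)
  have e3 := h.desc _ (hyC (o y)) (hne _ _) (hne _ _)
  have e4 := h.desc _ (hyC (!o y)) (hne _ _) (hne _ _)
  refine ⟨Finset.mem_erase.2 ⟨hya.symm, h.mem⟩, h.head, ?_, ?_, ?_, ?_, ?_, ?_, ?_, ?_, ?_⟩
  · rw [smooth_foot_of_ne hya.symm, h.start_left]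
  · rw [smooth_foot_of_ne hya.symm, h.start_right]
  · simpa [h.left_mem] using hp
  · simpa [h.right_notMem] using hq
  · intro x hx hxa hxa'
    by_cases hxp : x = f (y, o y)
    · subst hxp
      rw [smooth_foot]
      simp only [Set.mem_ofPred_eq]
      rw [e4, ← ht]
      have : ¬ s ≤ s - 1 := by omega
      tauto
    · by_cases hxq : x = f (y, !o y)
      · subst hxq
        rw [smooth_foot, Bool.not_not]
        simp only [Set.mem_ofPred_eq]
        rw [e3, ← ht]
        have : ¬ s ≤ s - 1 := by omega
        have : s ≤ s := le_rfl
        tauto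
      · rw [smooth_of_ne]
        · simp only [Set.mem_ofPred_eq]
          rw [h.side x hx hxa hxa', h.desc x hx hxa hxa']
          have : t x ≠ s := by
            intro e
            by_cases hxΓ : x ∈ Γ
            · exact hxp (h.inj x hx _ (hyC _) (by tauto) e)
            · exact hxq (h.inj x hx _ (hyC _) (by tauto) (e.trans ht))
          have : s ≤ t x - 1 ↔ s ≤ t x := by omega
          rw [this]
        · intro d e
          by_cases hd : d = o y
          · exact hxp (by rw [← e, hd])
          · exact hxq (by rw [← e, Bool.eq_not.2 hd])
  · intro x hx hxa hxa'
    by_cases hxp : x = f (y, o y)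
    · subst hxp
      rw [smooth_foot, e4, ← ht]
    · by_cases hxq : x = f (y, !o y)
      · subst hxq
        rw [smooth_foot, Bool.not_not, e3, ← ht]
      · rw [smooth_of_ne, h.desc x hx hxa hxa']
        intro d e
        by_cases hd : d = o y
        · exact hxp (by rw [← e, hd])
        · exact hxq (by rw [← e, Bool.eq_not.2 hd])
  · intro x hx x' hx' hxx' hxt
    refine h.inj x hx x' hx' ?_ hxt
    simp only [Set.mem_ofPred_eq, hxt] at hxx'
    tauto
  · have := h.ends
    have := not_le.2 (hend c)
    have := not_le.2 (hend (!c))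
    simp only [Set.mem_ofPred_eq]
    tauto
  · exact fun y' hy' => h.compat y' (Finset.mem_of_mem_erase hy')

/-- The two arcs meet in `a` and in `y`, so their parts above `y` form a closed curve and their
parts below `y` another one. Planarity makes the intersection number of these curves zero, which
says that exchanging the lower parts affects the count of mutual crossings only at `y`. -/
theorem crossSum_smooth (h : IsTwoArc f σ C R o a c p q Γ t) (hC : IsPlanar f ι σ C R) {y : α}
    (hy : y ∈ R) (hya : y ≠ a) (h1 : f (y, o y) ∈ Γ) (h2 : f (y, !o y) ∉ Γ)
    (ht : t (f (y, o y)) = t (f (y, !o y))) :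
    crossSum f ι {x | x ∈ Γ ↔ t (f (y, o y)) ≤ t x} (R.erase y) o =
      crossSum f ι Γ R o - arrowSign ι o y := by
  classical
  set s := t (f (y, o y)) with hs
  have hyC : ∀ d, f (y, d) ∈ C := fun d => hC.feet y hy d
  have hne : ∀ d e, f (y, d) ≠ f (a, e) := fun d e => foot_ne_of_ne hya d e
  have hend : ∀ d, t (f (a, d)) < s := by
    intro d
    by_cases hd : f (a, d) ∈ Γ
    · exact h.end_lt hC (hyC _) (hne _ _) (hne _ _) d (by tauto)
    · rw [ht]; exact h.end_lt hC (hyC (!o y)) (hne _ _) (hne _ _) d (by tauto)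
  have hp : s ≤ t p := h.le_left hC (hyC _) h1
  have hq : s ≤ t q := ht ▸ h.le_right hC (hyC (!o y)) h2
  have haC : ∀ d, f (a, d) ∈ C := fun d => hC.feet a h.mem d
  have hpC : p ∈ C := by rw [← h.start_left, hC.inv]; exact haC _
  have hqC : q ∈ C := by rw [← h.start_right, hC.inv]; exact haC _
  have e1 := h.side _ (hyC (o y)) (hne _ _) (hne _ _)
  have e2 := h.side _ (hyC (!o y)) (hne _ _) (hne _ _)
  have e3 := h.desc _ (hyC (o y)) (hne _ _) (hne _ _)
  have e4 := h.desc _ (hyC (!o y)) (hne _ _) (hne _ _)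
  -- The upper closed curve, down `Γ` from `a` to `y` and back along the other arc; `v` is the lower
  -- closed curve, from `y` to `a` and back. Both are flows.
  let u : X → ℤ := fun x => if x ∈ C ∧ s ≤ t x then (if x ∈ Γ then 1 else -1) else 0
  let v : X → ℤ := fun x => if x ∈ C ∧ t x < s then (if x ∈ Γ then 1 else -1) else 0
  have hstr : ∀ x ∈ C, (∀ d, f (a, d) ≠ x) → (∀ d, f (y, d) ≠ x) →
      u (σ x) = u x ∧ v (σ x) = v x := by
    intro x hx hxa hxy
    have hts : t x ≠ s := by
      intro e
      by_cases hxΓ : x ∈ Γ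
      · exact hxy _ (h.inj x hx _ (hyC _) (by tauto) e).symm
      · exact hxy _ (h.inj x hx _ (hyC _) (by tauto) (e.trans ht)).symm
    have g1 := h.side x hx (hxa _).symm (hxa _).symm
    have g2 := h.desc x hx (hxa _).symm (hxa _).symm
    have g3 := hC.inv x
    have g4 : s ≤ t x - 1 ↔ s ≤ t x := by omega
    have g5 : t x - 1 < s ↔ t x < s := by omega
    simp only [u, v, g1, g2, g3, g4, g5, and_self]
  have hu0 : ∀ x, t x < s → u x = 0 := fun x hx => if_neg fun h => absurd h.2 (not_le.2 hx)
  have hv0 : ∀ x, s ≤ t x → v x = 0 := fun x hx => if_neg fun h => absurd h.2 (not_lt.2 hx)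
  have sum2 : ∀ (g : X → ℤ) (b : α) (d : Bool), g (f (b, false)) + g (f (b, true)) =
      g (f (b, d)) + g (f (b, !d)) := by
    intro g b d; cases d <;> simp [add_comm]
  have hua : ∀ d, u (f (a, d)) = 0 := fun d => hu0 _ (hend d)
  have hva : ∀ d, v (σ (f (a, d))) = 0 := by
    intro d
    by_cases hd : d = c
    · rw [hd, h.start_left]; exact hv0 _ hp
    · rw [Bool.eq_not.2 hd, h.start_right]; exact hv0 _ hq
  have huy : u (f (y, o y)) = 1 ∧ u (f (y, !o y)) = -1 :=
    ⟨by simp only [u]; rw [if_pos ⟨hyC _, le_rfl⟩, if_pos h1],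
      by simp only [u]; rw [if_pos ⟨hyC _, ht.le⟩, if_neg h2]⟩
  have huσy : u (σ (f (y, o y))) = 0 ∧ u (σ (f (y, !o y))) = 0 :=
    ⟨hu0 _ (by omega), hu0 _ (by omega)⟩
  have hvy : v (f (y, o y)) = 0 ∧ v (f (y, !o y)) = 0 := ⟨hv0 _ le_rfl, hv0 _ ht.le⟩
  have hvσy : v (σ (f (y, o y))) = 1 ∧ v (σ (f (y, !o y))) = -1 :=
    ⟨by simp only [v]; rw [if_pos ⟨(hC.inv _).2 (hyC _), by omega⟩, if_pos (e1.2 h1)],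
      by simp only [v]; rw [if_pos ⟨(hC.inv _).2 (hyC _), by omega⟩, if_neg (by tauto)]⟩
  have hfu : IsFlow f σ C R u := by
    refine ⟨fun x hx => if_neg fun h => hx h.1, fun b hb => ?_, fun x hx hxR =>
      (hstr x hx (hxR a h.mem) (hxR y hy)).1⟩
    by_cases hba : b = a
    · rw [hba, hua, hua, sum2 (fun x => u (σ x)) a c, h.start_left, h.start_right]
      simp [u, hpC, hqC, hp, hq, h.left_mem, h.right_notMem]
    · by_cases hby : b = y
      · rw [hby, sum2 u y (o y), sum2 (fun x => u (σ x)) y (o y), huy.1, huy.2, huσy.1, huσy.2]; rfl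
      · rw [(hstr _ (hC.feet b hb _) (fun d => foot_ne_of_ne (Ne.symm hba) d _)
          (fun d => foot_ne_of_ne (Ne.symm hby) d _)).1,
          (hstr _ (hC.feet b hb _) (fun d => foot_ne_of_ne (Ne.symm hba) d _)
          (fun d => foot_ne_of_ne (Ne.symm hby) d _)).1]
  have hfv : IsFlow f σ C R v := by
    refine ⟨fun x hx => if_neg fun h => hx h.1, fun b hb => ?_, fun x hx hxR =>
      (hstr x hx (hxR a h.mem) (hxR y hy)).2⟩
    by_cases hba : b = a
    · rw [hba, hva, hva, sum2 v a c]
      have := h.ends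
      by_cases hc : f (a, c) ∈ Γ
      · simp [v, haC, hend, hc, this.1 hc]
      · simp [v, haC, hend, hc, not_not.1 (mt this.2 hc)]
    · by_cases hby : b = y
      · rw [hby, sum2 v y (o y), sum2 (fun x => v (σ x)) y (o y), hvy.1, hvy.2, hvσy.1, hvσy.2]; rfl
      · rw [(hstr _ (hC.feet b hb _) (fun d => foot_ne_of_ne (Ne.symm hba) d _)
          (fun d => foot_ne_of_ne (Ne.symm hby) d _)).2,
          (hstr _ (hC.feet b hb _) (fun d => foot_ne_of_ne (Ne.symm hba) d _)
          (fun d => foot_ne_of_ne (Ne.symm hby) d _)).2]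
  have hsum := hC.sum_eq_zero hfu hfv
  rw [← Finset.add_sum_erase R _ hy] at hsum
  -- The curves touch at `y` without crossing there.
  have hy0 : v (σ (f (y, false))) * (u (σ (f (y, true))) + u (f (y, true))) +
      v (σ (f (y, true))) * (u (σ (f (y, true))) - u (f (y, false))) -
      v (f (y, true)) * (u (f (y, false)) + u (f (y, true))) = 0 := by
    cases hoy : o y <;> rw [hoy] at huy huσy hvy hvσy <;>
      simp only [Bool.not_false, Bool.not_true] at huy huσy hvy hvσy <;>
      simp [huy, huσy, hvy, hvσy]
  simp only [hy0, mul_zero, zero_add] at hsum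
  -- Where arcs of different height cross, `compat` identifies the lower foot with `o b`. This turns
  -- the projection datum `ι b` into the sign of the crossing.
  have hterm : ∀ b ∈ R.erase y, ι b * (v (σ (f (b, false))) * (u (σ (f (b, true))) +
      u (f (b, true))) + v (σ (f (b, true))) * (u (σ (f (b, true))) - u (f (b, false))) -
      v (f (b, true)) * (u (f (b, false)) + u (f (b, true)))) =
      2 * crossTerm f ι Γ o b - 2 * crossTerm f ι {x | x ∈ Γ ↔ s ≤ t x} o b := by
    intro b hb
    obtain ⟨hby, hbR⟩ := Finset.mem_erase.1 hb
    by_cases hba : b = a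
    · rw [hba, hva, hva, hua, hua]
      have g0 := not_le.2 (hend false)
      have g1 := not_le.2 (hend true)
      simp only [crossTerm, Set.mem_ofPred_eq, g0, g1, iff_false, not_iff_not]
      ring
    · have hs1 := fun d => hstr (f (b, d)) (hC.feet b hbR d)
        (fun d => foot_ne_of_ne (Ne.symm hba) d _) (fun d => foot_ne_of_ne (Ne.symm hby) d _)
      rw [(hs1 true).1, (hs1 false).2, (hs1 true).2]
      have hcmp := h.compat b hbR hba
      simp only [crossTerm, u, v, hC.feet b hbR, true_and, Set.mem_ofPred_eq, arrowSign]
      by_cases g1 : f (b, false) ∈ Γ <;> by_cases g2 : f (b, true) ∈ Γ <;>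
      by_cases g3 : s ≤ t (f (b, false)) <;> by_cases g4 : s ≤ t (f (b, true)) <;>
      cases hob : o b <;> rw [hob] at hcmp <;> simp only [Bool.not_false, Bool.not_true] at hcmp <;>
      first
      | (exfalso; omega)
      | (have g3' : (t (f (b, false)) < s) = ¬ s ≤ t (f (b, false)) := by rw [not_le]
         have g4' : (t (f (b, true)) < s) = ¬ s ≤ t (f (b, true)) := by rw [not_le]
         simp only [g1, g2, g3', g4', g3, g4]
         norm_num
         try ring)
  rw [Finset.sum_congr rfl hterm, Finset.sum_sub_distrib, ← Finset.mul_sum, ← Finset.mul_sum] at hsum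
  have hk : crossSum f ι Γ R o = arrowSign ι o y + ∑ b ∈ R.erase y, crossTerm f ι Γ o b := by
    rw [crossSum, ← Finset.add_sum_erase R _ hy, crossTerm_of_not ι o (o y) (by tauto)]
  rw [hk, crossSum]
  linarith

/-- Raise the arc `Γ`. -/
theorem raise (h : IsTwoArc f σ C R o a c p q Γ t) {t' : X → ℤ} {g : ℤ}
    (h1 : ∀ x ∈ Γ, t' x = t x + g) (h2 : ∀ x ∉ Γ, t' x = t x) (hg : 0 ≤ g)
    (hbad : ∀ y ∈ R, y ≠ a → f (y, o y) ∈ Γ → f (y, !o y) ∉ Γ →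
      g ≤ t (f (y, !o y)) - t (f (y, o y))) :
    IsTwoArc f σ C R o a c p q Γ t' := by
  refine ⟨h.mem, h.head, h.start_left, h.start_right, h.left_mem, h.right_notMem, h.side, ?_, ?_,
    h.ends, ?_⟩
  · intro x hx hxa hxa'
    have e1 := h.side x hx hxa hxa'
    have e2 := h.desc x hx hxa hxa'
    by_cases hxΓ : x ∈ Γ
    · rw [h1 _ hxΓ, h1 _ (e1.2 hxΓ)]; omega
    · rw [h2 _ hxΓ, h2 _ (mt e1.1 hxΓ)]; omega
  · intro x hx y hy hxy hxt
    refine h.inj x hx y hy hxy ?_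
    by_cases hxΓ : x ∈ Γ
    · rw [h1 _ hxΓ, h1 _ (hxy.1 hxΓ)] at hxt; omega
    · rw [h2 _ hxΓ, h2 _ (mt hxy.2 hxΓ)] at hxt; omega
  · intro y hy hya
    have e1 := h.compat y hy hya
    have e2 := hbad y hy hya
    by_cases g1 : f (y, o y) ∈ Γ <;> by_cases g2 : f (y, !o y) ∈ Γ
    · rw [h1 _ g1, h1 _ g2]; omega
    · have := e2 g1 g2
      rw [h1 _ g1, h2 _ g2]; omega
    · rw [h2 _ g1, h1 _ g2]; omega
    · rw [h2 _ g1, h2 _ g2]; omega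

/-- At equal heights either foot may count as the lower one, so the crossing change is compatible
with the heights. -/
theorem flip (h : IsTwoArc f σ C R o a c p q Γ t) {y : α} (hya : y ≠ a)
    (ht : t (f (y, o y)) = t (f (y, !o y))) : IsTwoArc f σ C R (flipEnd o y) a c p q Γ t := by
  refine ⟨h.mem, ?_, h.start_left, h.start_right, h.left_mem, h.right_notMem, h.side, h.desc, h.inj,
    h.ends, ?_⟩
  · rw [flipEnd_of_ne o hya.symm]; exact h.head
  · intro y' hy' hy'a
    by_cases e : y' = y
    · subst e
      rw [flipEnd_self, Bool.not_not]; exact ht.ge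
    · rw [flipEnd_of_ne o e]; exact h.compat y' hy' hy'a

end IsTwoArc

theorem crossSum_flipEnd {y : α} (hy : y ∈ R) (d : Bool) (h : f (y, d) ∈ Γ ↔ f (y, !d) ∉ Γ) :
    crossSum f ι Γ R (flipEnd o y) = crossSum f ι Γ R o - 2 * arrowSign ι o y := by
  rw [crossSum, crossSum, ← Finset.add_sum_erase R _ hy, ← Finset.add_sum_erase R _ hy,
    crossTerm_of_not ι _ d h, crossTerm_of_not ι _ d h, arrowSign_flipEnd_self]
  have : ∑ b ∈ R.erase y, crossTerm f ι Γ (flipEnd o y) b =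
      ∑ b ∈ R.erase y, crossTerm f ι Γ o b := by
    refine Finset.sum_congr rfl fun b hb => ?_
    rw [crossTerm, crossTerm, arrowSign_flipEnd_of_ne ι o (Finset.ne_of_mem_erase hb)]
  rw [this]; ring

theorem arrowSign_eq_or (hι : ∀ a, ι a = 1 ∨ ι a = -1) (o : α → Bool) (a : α) :
    arrowSign ι o a = 1 ∨ arrowSign ι o a = -1 := by
  rcases hι a with h | h <;> cases ho : o a <;> simp [arrowSign, h, ho]

/-- A function with the skein relation is determined on pairs of descending arcs by its values
on those with `Γ` above the other arc. -/
theorem IsTwoArc.eq_of_skein {z : 𝕂} {V : Equiv.Perm X → Finset α → (α → Bool) → 𝕂} {g : ℤ → 𝕂}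
    (hg : ∀ k, g (k + 1) = g (k - 1) + z * g k) (hι : ∀ a, ι a = 1 ∨ ι a = -1)
    (hV : ∀ σ R o y, y ∈ R → (∀ d, f (y, d) ∈ C) → V σ R o = V σ R (flipEnd o y) +
      arrowWeight z ι o y * V (σ * hop f {y}) (R.erase y) o)
    (hbase : ∀ σ R o Γ t, IsPlanar f ι σ C R → IsTwoArc f σ C R o a c p q Γ t →
      (∀ y ∈ R, y ≠ a → f (y, o y) ∈ Γ → f (y, !o y) ∈ Γ) → V σ R o = g (crossSum f ι Γ R o))
    (hC : IsPlanar f ι σ C R) (h : IsTwoArc f σ C R o a c p q Γ t) :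
    V σ R o = g (crossSum f ι Γ R o) := by
  classical
  induction hn : R.card using Nat.strong_induction_on generalizing σ R o Γ t with
  | _ n ih =>
    induction hm : (R.filter fun y => y ≠ a ∧ f (y, o y) ∈ Γ ∧ f (y, !o y) ∉ Γ).card
      using Nat.strong_induction_on generalizing o t with
    | _ m ih' =>
      -- The crossings at which `Γ` lies below the other arc. The outer induction is on the number
      -- of all arrows and handles smoothings, the inner one is on `B.card` and handles crossing
      -- changes.
      set B := R.filter fun y => y ≠ a ∧ f (y, o y) ∈ Γ ∧ f (y, !o y) ∉ Γ with hB
      by_cases hBe : B = ∅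
      · refine hbase σ R o Γ t hC h fun y hy hya h1 => ?_
        by_contra h2
        have : y ∈ B := Finset.mem_filter.2 ⟨hy, hya, h1, h2⟩
        simp [hBe] at this
      · obtain ⟨y, hyB, hmin⟩ := Finset.exists_min_image B
          (fun y => t (f (y, !o y)) - t (f (y, o y))) (Finset.nonempty_of_ne_empty hBe)
        obtain ⟨hy, hya, h1, h2⟩ := Finset.mem_filter.1 hyB
        let t' : X → ℤ := fun x => if x ∈ Γ then t x + (t (f (y, !o y)) - t (f (y, o y))) else t x
        have h' : IsTwoArc f σ C R o a c p q Γ t' := by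
          refine h.raise (fun x hx => if_pos hx) (fun x hx => if_neg hx) ?_ ?_
          · have := h.compat y hy hya; omega
          · exact fun b hb hba g1 g2 => hmin b (Finset.mem_filter.2 ⟨hb, hba, g1, g2⟩)
        have ht : t' (f (y, o y)) = t' (f (y, !o y)) := by
          simp only [t', h1, h2, if_true, if_false]; ring
        have hd : f (y, o y) ∈ Γ ↔ f (y, !o y) ∉ Γ := by tauto
        have e1 := ih' _ (by
          rw [← hm]
          refine Finset.card_lt_card ((Finset.ssubset_iff_of_subset fun b hb => ?_).2
            ⟨y, hyB, fun hy => ?_⟩)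
          · obtain ⟨hb, hba, g1, g2⟩ := Finset.mem_filter.1 hb
            by_cases e : b = y
            · subst e; exact hyB
            · rw [flipEnd_of_ne o e] at g1 g2
              exact Finset.mem_filter.2 ⟨hb, hba, g1, g2⟩
          · have := (Finset.mem_filter.1 hy).2.2.1
            rw [flipEnd_self] at this
            exact h2 this) (h'.flip hya ht) rfl
        have e2 := ih (R.erase y).card (by rw [← hn]; exact Finset.card_erase_lt_of_mem hy)
          (hC.smooth hy) (h'.smooth hC hy hya h1 h2 ht) rfl
        rw [hV σ R o y hy (hC.feet y hy), e1, e2, h'.crossSum_smooth hC hy hya h1 h2 ht,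
          crossSum_flipEnd hy _ hd, arrowWeight]
        -- Smoothing lowers `k` by the sign of `y` and the flip lowers it by twice the sign; for
        -- either sign this is the recursion of `g`.
        set k := crossSum f ι Γ R o
        rcases arrowSign_eq_or hι o y with hs | hs <;> rw [hs]
        · have := hg (k - 1)
          rw [sub_add_cancel] at this
          rw [this, show k - 1 - 1 = k - 2 * 1 by ring]; push_cast; ring
        · have := hg (k + 1)
          rw [add_sub_cancel_right] at this
          rw [show k - 2 * -1 = k + 1 + 1 by ring, show k - -1 = k + 1 by ring, this]
          push_cast; ring

end TwoArc

/-! ### The base values of pairs of descending arcs -/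

section Ladder

variable {α X 𝕂 : Type*} [DecidableEq α] [Fintype X] [CommRing 𝕂]

/-- The Conway polynomials of the closures of the braids with two strands. -/
theorem exists_ladder (z : 𝕂) :
    ∃ F : ℤ → 𝕂, F 0 = 0 ∧ F 1 = 1 ∧ ∀ k, F (k + 1) = F (k - 1) + z * F k := by
  -- The recursion is multiplication by an invertible matrix over any commutative ring, so its
  -- integer powers also provide the negative indices.
  let A : Matrix (Fin 2) (Fin 2) 𝕂 := !![z, 1; 1, 0]
  let B : Matrix (Fin 2) (Fin 2) 𝕂 := !![0, 1; 1, -z]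
  have hAB : A * B = 1 := by
    ext i j; fin_cases i <;> fin_cases j <;> simp [A, B, Matrix.mul_apply]
  have hBA : B * A = 1 := by
    ext i j; fin_cases i <;> fin_cases j <;> simp [A, B, Matrix.mul_apply]
  let U : (Matrix (Fin 2) (Fin 2) 𝕂)ˣ := ⟨A, B, hAB, hBA⟩
  have hA : A = B + z • (1 : Matrix (Fin 2) (Fin 2) 𝕂) := by
    ext i j; fin_cases i <;> fin_cases j <;> simp [A, B]
  refine ⟨fun k => ((U ^ k : (Matrix (Fin 2) (Fin 2) 𝕂)ˣ) : Matrix (Fin 2) (Fin 2) 𝕂) 0 1, ?_, ?_, ?_⟩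
  · simp
  · simp [U, A]
  · intro k
    have h1 : ((U ^ (k + 1) : (Matrix (Fin 2) (Fin 2) 𝕂)ˣ) : Matrix (Fin 2) (Fin 2) 𝕂) =
        (U ^ k : (Matrix (Fin 2) (Fin 2) 𝕂)ˣ) * A := by
      rw [zpow_add_one]; rfl
    have h2 : ((U ^ (k - 1) : (Matrix (Fin 2) (Fin 2) 𝕂)ˣ) : Matrix (Fin 2) (Fin 2) 𝕂) =
        (U ^ k : (Matrix (Fin 2) (Fin 2) 𝕂)ˣ) * B := by
      rw [zpow_sub_one]; rfl
    simp only [h1, h2]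
    rw [hA, mul_add]
    simp

end Ladder

section Base

variable {α X 𝕂 : Type*} [DecidableEq α] [Fintype X] [CommRing 𝕂]
  {f : α × Bool ↪ X} {ι : α → ℤ} {σ τ : Equiv.Perm X} {C : Set X} {R : Finset α}
  {o : α → Bool} {a : α} {c : Bool} {p q : X} {Γ : Set X} {t : X → ℤ}

theorem crossSum_compl : crossSum f ι Γᶜ R o = crossSum f ι Γ R o := by
  refine Finset.sum_congr rfl fun y _ => ?_
  have h : (f (y, false) ∈ Γᶜ ↔ f (y, true) ∈ Γᶜ) ↔ (f (y, false) ∈ Γ ↔ f (y, true) ∈ Γ) := not_iff_not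
  unfold crossTerm
  split_ifs with h1 h2 h2
  · rfl
  · exact absurd (h.1 h1) h2
  · exact absurd (h.2 h2) h1
  · rfl

/-- The linking number of two parts of a planar diagram, one of them above the other, is zero. -/
theorem IsPlanar.crossSum_eq_zero (hC : IsPlanar f ι σ C R) (hΓ : ∀ x ∈ C, (σ x ∈ Γ ↔ x ∈ Γ))
    (h : ∀ y ∈ R, f (y, o y) ∈ Γ → f (y, !o y) ∈ Γ) : crossSum f ι Γ R o = 0 := by
  classical
  -- Both parts are unions of circles, so their indicators are flows. As `Γ` is never below, each
  -- mutual crossing enters their intersection number with its sign, up to the common factor `-2`.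
  let u : X → ℤ := fun x => if x ∈ C ∧ x ∈ Γ then 1 else 0
  let v : X → ℤ := fun x => if x ∈ C ∧ x ∉ Γ then 1 else 0
  have hu : ∀ x, u (σ x) = u x := fun x => by
    by_cases hx : x ∈ C
    · simp only [u, hC.inv x, hΓ x hx]
    · simp [u, hC.inv x, hx]
  have hv : ∀ x, v (σ x) = v x := fun x => by
    by_cases hx : x ∈ C
    · simp only [v, hC.inv x, hΓ x hx]
    · simp [v, hC.inv x, hx]
  have hfu : IsFlow f σ C R u := ⟨fun x hx => if_neg fun h => hx h.1, fun b _ => by rw [hu, hu],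
    fun x _ _ => hu x⟩
  have hfv : IsFlow f σ C R v := ⟨fun x hx => if_neg fun h => hx h.1, fun b _ => by rw [hv, hv],
    fun x _ _ => hv x⟩
  have hsum := hC.sum_eq_zero hfu hfv
  have hterm : ∀ b ∈ R, ι b * (v (σ (f (b, false))) * (u (σ (f (b, true))) +
      u (f (b, true))) + v (σ (f (b, true))) * (u (σ (f (b, true))) - u (f (b, false))) -
      v (f (b, true)) * (u (f (b, false)) + u (f (b, true)))) = -2 * crossTerm f ι Γ o b := by
    intro b hb
    rw [hu, hv, hv]
    have hb' := h b hb
    simp only [u, v, crossTerm, arrowSign, hC.feet b hb, true_and]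
    by_cases g1 : f (b, false) ∈ Γ <;> by_cases g2 : f (b, true) ∈ Γ <;>
    cases hob : o b <;> rw [hob] at hb' <;> simp only [Bool.not_false, Bool.not_true] at hb' <;>
    first
    | (exfalso; tauto)
    | (simp only [g1, g2]; norm_num <;> try ring)
  rw [Finset.sum_congr rfl hterm, ← Finset.mul_sum] at hsum
  rw [crossSum]
  linarith

/-- Here `Γ` closes up to a circle, and `a` is the only crossing at which it lies below the other
circle. After the flip of `a` the linking number vanishes, and the flip has changed the count by
twice the sign of `a`. -/
theorem IsTwoArc.crossSum_of_mem (h : IsTwoArc f σ C R o a c p q Γ t) (hC : IsPlanar f ι σ C R)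
    (ha : f (a, c) ∈ Γ) (htop : ∀ y ∈ R, y ≠ a → f (y, o y) ∈ Γ → f (y, !o y) ∈ Γ) :
    crossSum f ι Γ R o = 2 * arrowSign ι o a := by
  have h0 := hC.crossSum_eq_zero (o := flipEnd o a) (Γ := Γ) (fun x hx => ?_) fun y hy hyΓ => ?_
  · rw [crossSum_flipEnd h.mem c h.ends] at h0
    linarith
  · by_cases h1 : x = f (a, c)
    · subst h1
      simp [h.start_left, h.left_mem, ha]
    · by_cases h2 : x = f (a, !c)
      · subst h2
        have := h.ends
        simp only [h.start_right, h.right_notMem]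
        tauto
      · exact h.side x hx h1 h2
  · by_cases e : y = a
    · subst e
      rw [flipEnd_self, h.head] at hyΓ
      exact absurd hyΓ (h.ends.1 ha)
    · rw [flipEnd_of_ne o e] at hyΓ ⊢
      exact htop y hy e hyΓ

/-- Here the two arcs form one circle. Smoothing at `a` closes `Γ` up to a circle above the other
one; these are unlinked, so only the term of `a` itself remains. -/
theorem IsTwoArc.crossSum_of_notMem (h : IsTwoArc f σ C R o a c p q Γ t)
    (hC : IsPlanar f ι σ C R) (ha : f (a, c) ∉ Γ)
    (htop : ∀ y ∈ R, y ≠ a → f (y, o y) ∈ Γ → f (y, !o y) ∈ Γ) :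
    crossSum f ι Γ R o = arrowSign ι o a := by
  have ha' : f (a, !c) ∈ Γ := by have := h.ends; tauto
  have h0 := (hC.smooth h.mem).crossSum_eq_zero (o := o) (Γ := Γ) (fun x hx => ?_)
    fun y hy => htop y (Finset.mem_of_mem_erase hy) (Finset.ne_of_mem_erase hy)
  · rw [crossSum, ← Finset.add_sum_erase R _ h.mem, crossTerm_of_not ι o c h.ends]
    rw [crossSum] at h0
    linarith
  · by_cases h1 : x = f (a, c)
    · subst h1
      simp [smooth_foot, h.start_right, h.right_notMem, ha]
    · by_cases h2 : x = f (a, !c)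
      · subst h2
        simp [smooth_foot, h.start_left, h.left_mem, ha']
      · rw [smooth_of_ne]
        · exact h.side x hx h1 h2
        · intro d e
          by_cases hd : d = c
          · exact h1 (by rw [← e, hd])
          · exact h2 (by rw [← e, Bool.eq_not.2 hd])

/-- If `τ` passes from the end of `Γ` to the start of the other arc, it passes first along `Γ`. -/
theorem IsTwoArc.meetsBefore (h : IsTwoArc f σ C R o a c p q Γ t) (hC : IsPlanar f ι σ C R)
    (hτ : ∀ x, x ≠ f (a, c) → x ≠ f (a, !c) → τ x = σ x) {d : Bool} (hd : f (a, d) ∈ Γ)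
    (hτq : τ (f (a, d)) = q) :
    (∀ x ∈ C, τ.SameCycle p x) ∧ ∀ x ∈ C, ∀ y, (x ∈ Γ ∧ y ∉ Γ ∨ (x ∈ Γ ↔ y ∈ Γ) ∧ t y < t x) →
      MeetsBefore τ p x y := by
  classical
  obtain ⟨N, hN⟩ : ∃ N : ℤ, ∀ x y, t x < t y + N := by
    obtain ⟨M, hM⟩ := (Set.toFinite (Set.range fun x : X × X => t x.1 - t x.2)).bddAbove
    refine ⟨M + 1, fun x y => ?_⟩
    have := hM ⟨(x, y), rfl⟩
    simp only at this
    omega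
  -- Lift `Γ` above everything else, so that a single height decreases along the whole passage,
  -- first along `Γ` and then along the other arc.
  let T : X → ℤ := fun x => if x ∈ Γ then t x + N else t x
  have hT1 : ∀ x, x ∈ Γ → T x = t x + N := fun x hx => if_pos hx
  have hT2 : ∀ x, x ∉ Γ → T x = t x := fun x hx => if_neg hx
  have hD : ∀ x ∈ C, x ≠ p → ∃ x' ∈ C, τ x' = x ∧ T x < T x' := by
    intro x hx hxp
    by_cases hxq : x = q
    · refine ⟨f (a, d), hC.feet a h.mem d, by rw [hτq, hxq], ?_⟩
      rw [hT1 _ hd, hxq, hT2 _ h.right_notMem]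
      exact hN _ _
    · obtain ⟨x', hx', h1, h2, rfl⟩ := h.exists_pred hC.inv hx hxp hxq
      refine ⟨x', hx', hτ x' h1 h2, ?_⟩
      have e1 := h.side x' hx' h1 h2
      have e2 := h.desc x' hx' h1 h2
      by_cases hxΓ : x' ∈ Γ
      · rw [hT1 _ hxΓ, hT1 _ (e1.2 hxΓ)]; omega
      · rw [hT2 _ hxΓ, hT2 _ (mt e1.1 hxΓ)]; omega
  refine ⟨fun x hx => ?_, fun x hx y hxy => MeetsBefore.of_height hD hx ?_⟩
  · obtain ⟨k, rfl, -⟩ := exists_pow_of_height hD hx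
    exact τ.sameCycle_pow_self k p
  · rcases hxy with ⟨h1, h2⟩ | ⟨h1, h2⟩
    · rw [hT1 _ h1, hT2 _ h2]; exact hN _ _
    · by_cases hxΓ : x ∈ Γ
      · rw [hT1 _ hxΓ, hT1 _ (h1.1 hxΓ)]; omega
      · rw [hT2 _ hxΓ, hT2 _ (mt h1.2 hxΓ)]; omega

/-- If `Γ` is passed first and each arc downwards, this is the statement that the upper end of `y`
comes first. -/
theorem IsTwoArc.upper_or (h : IsTwoArc f σ C R o a c p q Γ t) (hC : IsPlanar f ι σ C R)
    (htop : ∀ y ∈ R, y ≠ a → f (y, o y) ∈ Γ → f (y, !o y) ∈ Γ) {y : α} (hy : y ∈ R) (hya : y ≠ a) :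
    f (y, !o y) ∈ Γ ∧ f (y, o y) ∉ Γ ∨
      (f (y, !o y) ∈ Γ ↔ f (y, o y) ∈ Γ) ∧ t (f (y, o y)) < t (f (y, !o y)) := by
  have h1 := htop y hy hya
  by_cases g1 : f (y, o y) ∈ Γ <;> by_cases g2 : f (y, !o y) ∈ Γ
  all_goals try tauto
  all_goals
    refine Or.inr ⟨by tauto, lt_of_le_of_ne (h.compat y hy hya) fun e => ?_⟩
    exact foot_ne_not y (o y) (h.inj _ (hC.feet y hy _) _ (hC.feet y hy _) (by tauto) e)

theorem ends_cases (d c : Bool) : d = c ∨ d = !c := by cases d <;> cases c <;> simp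

/-- In the smoothed diagram the arc `Γ` is followed by the other one. -/
theorem IsTwoArc.top_smooth (h : IsTwoArc f σ C R o a c p q Γ t) (hC : IsPlanar f ι σ C R)
    (ha : f (a, c) ∈ Γ) (htop : ∀ y ∈ R, y ≠ a → f (y, o y) ∈ Γ → f (y, !o y) ∈ Γ) :
    (∀ x ∈ C, (σ * hop f {a}).SameCycle p x) ∧ ∀ y ∈ R.erase a,
      MeetsBefore (σ * hop f {a}) p (f (y, !o y)) (f (y, o y)) := by
  have key := h.meetsBefore (τ := σ * hop f {a}) hC (fun x h1 h2 => smooth_of_ne fun d e => by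
    rcases ends_cases d c with rfl | rfl
    · exact h1 e.symm
    · exact h2 e.symm) ha (by rw [smooth_foot, h.start_right])
  exact ⟨key.1, fun y hy => key.2 _ (hC.feet y (Finset.mem_of_mem_erase hy) _) _
    (h.upper_or hC htop (Finset.mem_of_mem_erase hy) (Finset.ne_of_mem_erase hy))⟩

/-- The end of `Γ` leads to the start of the other arc, so the two arcs form one descending circle
based at `p`. -/
theorem IsTwoArc.top (h : IsTwoArc f σ C R o a c p q Γ t) (hC : IsPlanar f ι σ C R)
    (ha : f (a, c) ∉ Γ) (htop : ∀ y ∈ R, y ≠ a → f (y, o y) ∈ Γ → f (y, !o y) ∈ Γ) :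
    (∀ x ∈ C, σ.SameCycle p x) ∧ ∀ y ∈ R, MeetsBefore σ p (f (y, !o y)) (f (y, o y)) := by
  have ha' : f (a, !c) ∈ Γ := by have := h.ends; tauto
  have key := h.meetsBefore (τ := σ) hC (fun _ _ _ => rfl) ha' h.start_right
  refine ⟨key.1, fun y hy => key.2 _ (hC.feet y hy _) _ ?_⟩
  by_cases e : y = a
  · rw [e, h.head]; exact Or.inl ⟨ha', ha⟩
  · exact h.upper_or hC htop hy e

theorem IsTwoArc.side_of_mem (h : IsTwoArc f σ C R o a c p q Γ t) (ha : f (a, c) ∈ Γ) :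
    ∀ x ∈ C, (σ x ∈ Γ ↔ x ∈ Γ) := by
  intro x hx
  by_cases h1 : x = f (a, c)
  · subst h1; simp [h.start_left, h.left_mem, ha]
  · by_cases h2 : x = f (a, !c)
    · subst h2
      have := h.ends
      simp only [h.start_right, h.right_notMem]
      tauto
    · exact h.side x hx h1 h2

/-- Two circles, one of them descending below the other descending one. -/
theorem exists_isTwoArc (hC : IsPlanar f ι σ C R) (ha : a ∈ R) (c : Bool)
    (h1 : ¬ σ.SameCycle (f (a, c)) (f (a, !c)))
    (h2 : ∀ x ∈ C, σ.SameCycle (f (a, c)) x ∨ σ.SameCycle (f (a, !c)) x) :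
    ∃ o t, IsTwoArc f σ C R o a c (σ (f (a, c))) (σ (f (a, !c))) {x | σ.SameCycle (f (a, c)) x} t ∧
      (∀ y ∈ R, ¬ σ.SameCycle (f (a, c)) (f (y, o y)) →
        ¬ σ.SameCycle (f (a, c)) (f (y, !o y))) ∧
      ∀ y ∈ R, y ≠ a → t (f (y, o y)) < t (f (y, !o y)) := by
  classical
  obtain ⟨t1, ht1, ht1'⟩ := exists_steps σ (f (a, c))
  obtain ⟨t2, ht2, ht2'⟩ := exists_steps σ (f (a, !c))
  obtain ⟨N, hN⟩ : ∃ N : ℤ, ∀ x y, t1 x < t2 y + N := by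
    obtain ⟨M, hM⟩ := (Set.toFinite (Set.range fun x : X × X => t1 x.1 - t2 x.2)).bddAbove
    refine ⟨M + 1, fun x y => ?_⟩
    have := hM ⟨(x, y), rfl⟩
    simp only at this
    omega
  -- The shift by `N` puts the circle of `f (a, c)` completely below the other one.
  let t : X → ℤ := fun x => if σ.SameCycle (f (a, c)) x then t1 x else t2 x + N
  have e1 : ∀ x, σ.SameCycle (f (a, c)) x → t x = t1 x := fun x hx => if_pos hx
  have e2 : ∀ x, ¬ σ.SameCycle (f (a, c)) x → t x = t2 x + N := fun x hx => if_neg hx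
  have hlt : ∀ x y, σ.SameCycle (f (a, c)) x → ¬ σ.SameCycle (f (a, c)) y → t x < t y :=
    fun x y hx hy => by rw [e1 x hx, e2 y hy]; exact hN _ _
  have hinj : ∀ x ∈ C, ∀ y ∈ C, t x = t y → x = y := by
    intro x hx y hy hxy
    by_cases g1 : σ.SameCycle (f (a, c)) x <;> by_cases g2 : σ.SameCycle (f (a, c)) y
    · rw [e1 x g1, e1 y g2] at hxy
      exact ht1' x y g1 g2 hxy
    · exact absurd hxy (hlt x y g1 g2).ne
    · exact absurd hxy (hlt y x g2 g1).ne'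
    · rw [e2 x g1, e2 y g2] at hxy
      exact ht2' x y ((h2 x hx).resolve_left g1) ((h2 y hy).resolve_left g2) (by omega)
  -- The heights decide the lower end except at `a`, where the end is prescribed; it lies on the
  -- lower circle anyway.
  let o : α → Bool := fun y => if y = a then c else decide (t (f (y, true)) < t (f (y, false)))
  have ho : ∀ y ∈ R, y ≠ a → t (f (y, o y)) < t (f (y, !o y)) := by
    intro y hy hya
    simp only [o, hya, if_false]
    by_cases h : t (f (y, true)) < t (f (y, false))
    · simp [h]
    · have : t (f (y, true)) ≠ t (f (y, false)) := fun e =>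
        foot_ne_not y true (hinj _ (hC.feet y hy _) _ (hC.feet y hy _) e)
      have : t (f (y, false)) < t (f (y, true)) := by omega
      simpa [h] using this
  refine ⟨o, t, ⟨ha, by simp [o], rfl, rfl, ?_, ?_, ?_, ?_, ?_, ?_, ?_⟩, ?_, ho⟩
  · exact Equiv.Perm.sameCycle_apply_right.2 (Equiv.Perm.SameCycle.refl _ _)
  · exact fun h => h1 (Equiv.Perm.sameCycle_apply_right.1 h)
  · intro x _ _ _
    exact Equiv.Perm.sameCycle_apply_right
  · intro x hx hx1 hx2
    by_cases g : σ.SameCycle (f (a, c)) x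
    · rw [e1 x g, e1 (σ x) (Equiv.Perm.sameCycle_apply_right.2 g), ht1 x g hx1]
    · rw [e2 x g, e2 (σ x) (mt Equiv.Perm.sameCycle_apply_right.1 g),
        ht2 x ((h2 x hx).resolve_left g) hx2]
      ring
  · exact fun x hx y hy _ => hinj x hx y hy
  · exact ⟨fun _ => h1, fun _ => Equiv.Perm.SameCycle.refl _ _⟩
  · exact fun y hy hya => (ho y hy hya).le
  · intro y hy h3 h4
    by_cases hya : y = a
    · subst hya
      simp only [o, if_true] at h3
      exact h3 (Equiv.Perm.SameCycle.refl _ _)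
    · exact absurd (ho y hy hya) (not_lt.2 (hlt _ _ h4 h3).le)

end Base

/-! ### The sum over the states with one boundary component does not depend on the base point -/

section OneSumBase

variable {α X 𝕂 : Type*} [DecidableEq α] [Fintype X] [CommRing 𝕂]
  {f : α × Bool ↪ X} {z : 𝕂} {ι : α → ℤ} {σ τ : Equiv.Perm X} {C : Set X} {R : Finset α}
  {o : α → Bool} {a : α} {c : Bool} {b b' p q : X} {Γ : Set X} {t : X → ℤ}

/-- By crossing changes any part of a diagram can be put above the rest. -/
theorem exists_upper (f : α × Bool ↪ X) (U : Set X) :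
    ∃ o : α → Bool, ∀ a, f (a, o a) ∈ U → f (a, !o a) ∈ U := by
  classical
  refine ⟨fun a => decide (f (a, false) ∈ U), fun a => ?_⟩
  by_cases h : f (a, false) ∈ U <;> simp [h]

/-- The two ways to pass from the walk of the smoothed diagram to the next point. -/
theorem smooth_apply_of_ne {S : Finset α} {x : X} (h : ∀ a ∈ R, ∀ c, f (a, c) ≠ x) (hS : S ⊆ R) :
    (σ * hop f S) x = σ x := by
  rw [Equiv.Perm.mul_apply, hop_of_forall_ne f fun a ha => h a (hS ha)]

theorem smooth_apply_foot {S : Finset α} (ha : a ∈ S) (c : Bool) :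
    (σ * hop f S) (f (a, c)) = σ (f (a, !c)) := by
  rw [Equiv.Perm.mul_apply, hop_foot f ha]

theorem oneSum_step_of_forall_ne (hb : ∀ a ∈ R, ∀ c, f (a, c) ≠ b) :
    oneSum f z ι C b σ R o = oneSum f z ι C (σ b) σ R o := by
  refine stateSum_congr f z ι fun S hS => ?_
  have e : (σ * hop f S) b = σ b := smooth_apply_of_ne hb hS
  refine and_congr (forall₂_congr fun x _ => ?_) (forall₂_congr fun a ha => ?_)
  · rw [← e, Equiv.Perm.sameCycle_apply_left]
  · rw [← e, MeetsBefore.step (hb a (hS ha) _) (hb a (hS ha) _)]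

/-- States containing `a` contribute to neither side. If the base point is just before the upper
end, this end is approached at once. If it is just after it, the passage closes up on leaving the
lower end, without having met the upper one. -/
theorem oneSum_step_of_tail (ha : a ∈ R) (hC : ∀ c, f (a, c) ∈ C) (hb : f (a, !o a) = b) :
    oneSum f z ι C b σ R o = oneSum f z ι C (σ b) σ R o := by
  rw [oneSum, oneSum, stateSum_split f z ι ha, stateSum_split f z ι ha]
  have h1 := oneSum_step_of_forall_ne (f := f) (z := z) (ι := ι) (σ := σ) (C := C) (R := R.erase a)
    (o := o) (b := b) fun y hy d => hb ▸ foot_ne_of_ne (Finset.ne_of_mem_erase hy) d _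
  rw [oneSum, oneSum] at h1
  rw [h1]
  congr 2
  rw [stateSum, stateSum]
  refine (Finset.sum_eq_zero fun S _ => if_neg ?_).trans
    (Finset.sum_eq_zero fun S hS => if_neg ?_).symm
  · rintro ⟨⟨-, h⟩, -⟩
    exact h.base_ne hb.symm
  · rintro ⟨⟨hQ, h⟩, -⟩
    refine h.not_sameCycle_of_closed ?_ (hQ _ (hC _))
    have haS : a ∉ S := fun h => by simpa using Finset.mem_powerset.1 hS h
    rw [← mul_hop_insert f haS, smooth_apply_foot (Finset.mem_insert_self _ _), hb]

/-- By the skein relation a crossing change alters the difference of the two sums by such a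
difference for a smoothed diagram, which is zero. Hence one choice of ends decides for all. -/
theorem oneSum_eq_of_smooth (hfeet : ∀ a ∈ R, ∀ c, f (a, c) ∈ C)
    (hs : ∀ y ∈ R, ∀ o, oneSum f z ι C b (σ * hop f {y}) (R.erase y) o =
      oneSum f z ι C b' (σ * hop f {y}) (R.erase y) o) {o₀ : α → Bool}
    (h₀ : oneSum f z ι C b σ R o₀ = oneSum f z ι C b' σ R o₀) :
    oneSum f z ι C b σ R o = oneSum f z ι C b' σ R o := by
  have := eq_of_forall_flipEnd (R := R)
    (Δ := fun o => oneSum f z ι C b σ R o - oneSum f z ι C b' σ R o)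
    (fun o o' h => by
      simp only [oneSum]
      rw [stateSum_congr_ends f z ι h, stateSum_congr_ends f z ι h])
    (fun y hy o => by
      rw [oneSum_skein f z ι hy (hfeet y hy), oneSum_skein f z ι (b := b') hy (hfeet y hy),
        hs y hy]
      ring) o o₀
  rwa [h₀, sub_self, sub_eq_zero] at this

section Ladder

variable {F : ℤ → 𝕂} (h0 : F 0 = 0) (h1 : F 1 = 1) (hF : ∀ k, F (k + 1) = F (k - 1) + z * F k)

include h0 h1 hF

theorem ladder_two : F 2 = z ∧ F (-1) = 1 ∧ F (-2) = -z := by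
  have e1 := hF 1
  have e2 := hF 0
  have e3 := hF (-1)
  norm_num at e1 e2 e3
  rw [h0, h1] at e1
  rw [h0, h1] at e2
  rw [h0] at e3
  have e4 : F (-1) = 1 := by rw [e2]; ring
  rw [e4] at e3
  exact ⟨by rw [e1]; ring, e4, by linear_combination -e3⟩

theorem ladder_sign (hι : ∀ a, ι a = 1 ∨ ι a = -1) :
    F (2 * arrowSign ι o a) = arrowWeight z ι o a ∧ F (arrowSign ι o a) = 1 := by
  obtain ⟨e1, e2, e3⟩ := ladder_two h0 h1 hF
  rcases arrowSign_eq_or hι o a with h | h <;> rw [arrowWeight, h] <;> norm_num [e1, e2, e3, h1]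

end Ladder

/-- The value of the sum on two arcs, the first one above the second one. -/
theorem IsTwoArc.oneSum_of_top (h : IsTwoArc f σ C R o a c p q Γ t) (hC : IsPlanar f ι σ C R)
    (htop : ∀ y ∈ R, y ≠ a → f (y, o y) ∈ Γ → f (y, !o y) ∈ Γ) {F : ℤ → 𝕂} (h0 : F 0 = 0)
    (h1 : F 1 = 1) (hF : ∀ k, F (k + 1) = F (k - 1) + z * F k) (hι : ∀ a, ι a = 1 ∨ ι a = -1) :
    oneSum f z ι C p σ R o = F (crossSum f ι Γ R o) := by
  have hqC : q ∈ C := by rw [← h.start_right, hC.inv]; exact hC.feet _ h.mem _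
  have hpC : p ∈ C := by rw [← h.start_left, hC.inv]; exact hC.feet _ h.mem _
  by_cases ha : f (a, c) ∈ Γ
  -- Two circles with `Γ` above except at `a`. In the skein relation at `a` the flipped diagram is
  -- split and gives 0; the smoothed one is a single descending circle and gives 1.
  · rw [h.crossSum_of_mem hC ha htop, (ladder_sign h0 h1 hF hι).1, oneSum_skein f z ι h.mem
      (hC.feet _ h.mem)]
    obtain ⟨g1, g2⟩ := h.top_smooth hC ha htop
    rw [oneSum_eq_one_of_top f z ι (hC.smooth h.mem).feet g2 g1,
      oneSum_eq_zero_of_upper f z ι (U := {x | x ∈ C ∧ x ∈ Γ}), zero_add, mul_one]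
    · intro x
      by_cases hx : x ∈ C
      · exact and_congr (hC.inv x) (h.side_of_mem ha x hx)
      · simp [hC.inv, hx]
    · exact And.intro hpC h.left_mem
    · rintro y hy ⟨-, hyΓ⟩
      refine And.intro (hC.feet y hy _) ?_
      by_cases e : y = a
      · subst e
        rw [flipEnd_self, h.head] at hyΓ
        exact absurd hyΓ (h.ends.1 ha)
      · rw [flipEnd_of_ne o e] at hyΓ ⊢
        exact htop y hy e hyΓ
    · exact fun hCU => h.right_notMem (hCU hqC).2
  · rw [h.crossSum_of_notMem hC ha htop, (ladder_sign h0 h1 hF hι).2]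
    obtain ⟨g1, g2⟩ := h.top hC ha htop
    exact oneSum_eq_one_of_top f z ι hC.feet g2 g1

/-- The base value for `Γ` above the other arc is `F`, and `F` obeys the skein recursion, so it
extends to all pairs of descending arcs. -/
theorem IsTwoArc.oneSum_eq (h : IsTwoArc f σ C R o a c p q Γ t) (hC : IsPlanar f ι σ C R)
    {F : ℤ → 𝕂} (h0 : F 0 = 0) (h1 : F 1 = 1) (hF : ∀ k, F (k + 1) = F (k - 1) + z * F k)
    (hι : ∀ a, ι a = 1 ∨ ι a = -1) :
    oneSum f z ι C p σ R o = F (crossSum f ι Γ R o) :=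
  h.eq_of_skein hF hι (V := fun σ R o => oneSum f z ι C p σ R o)
    (fun _ _ _ _ hy hyC => oneSum_skein f z ι hy hyC)
    (fun _ _ _ _ _ hC h htop => h.oneSum_of_top hC htop h0 h1 hF hι) hC

theorem sameCycle_inv (σ : Equiv.Perm X) (b x : X) :
    σ x ∈ {x | σ.SameCycle b x} ↔ x ∈ {x | σ.SameCycle b x} :=
  Equiv.Perm.sameCycle_apply_right

/-- The lower one of two circles. -/
theorem exists_oneSum_eq_cross (hC : IsPlanar f ι σ C R) (hι : ∀ a, ι a = 1 ∨ ι a = -1) (ha : a ∈ R)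
    (c : Bool) (hc : ¬ σ.SameCycle (f (a, c)) (f (a, !c))) :
    ∃ o, oneSum f z ι C (σ (f (a, c))) σ R o = 0 ∧ oneSum f z ι C (σ (f (a, !c))) σ R o = 0 := by
  by_cases h2 : ∀ x ∈ C, σ.SameCycle (f (a, c)) x ∨ σ.SameCycle (f (a, !c)) x
  · obtain ⟨o, t, h, hU, -⟩ := exists_isTwoArc hC ha c hc h2
    obtain ⟨F, h0, h1, hF⟩ := exists_ladder z
    refine ⟨o, ?_, ?_⟩
    -- The base point on the lower circle is the nontrivial one. Its value is `F` of the number of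
    -- mutual crossings counted with sign, which is zero for circles one above the other, and `F 0 =
    -- 0`.
    · rw [h.oneSum_eq hC h0 h1 hF hι, ← crossSum_compl, hC.crossSum_eq_zero, h0]
      · exact fun x _ => not_congr (sameCycle_inv σ _ x)
      · exact hU
    · exact oneSum_eq_zero_of_upper f z ι (U := {x | σ.SameCycle (f (a, c)) x}ᶜ)
        (fun x => not_congr (sameCycle_inv σ (f (a, c)) x))
        (fun h => hc (Equiv.Perm.sameCycle_apply_right.1 h)) hU
        fun hCU => hCU (hC.feet a ha c) (Equiv.Perm.SameCycle.refl _ _)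
  -- There is a third circle in `C`: put the two circles at `a` above all the rest, which makes both
  -- values zero.
  · obtain ⟨o, ho⟩ := exists_upper f {x | σ.SameCycle (f (a, c)) x ∨ σ.SameCycle (f (a, !c)) x}
    have hinv : ∀ x, σ x ∈ {x | σ.SameCycle (f (a, c)) x ∨ σ.SameCycle (f (a, !c)) x} ↔
        x ∈ {x | σ.SameCycle (f (a, c)) x ∨ σ.SameCycle (f (a, !c)) x} := fun x =>
      or_congr Equiv.Perm.sameCycle_apply_right Equiv.Perm.sameCycle_apply_right
    exact ⟨o, oneSum_eq_zero_of_upper f z ι hinv (Or.inl (Equiv.Perm.sameCycle_apply_right.2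
        (Equiv.Perm.SameCycle.refl _ _))) (fun a _ => ho a) fun h => h2 h,
      oneSum_eq_zero_of_upper f z ι hinv (Or.inr (Equiv.Perm.sameCycle_apply_right.2
        (Equiv.Perm.SameCycle.refl _ _))) (fun a _ => ho a) fun h => h2 h⟩

/-- The sum over the states of a planar diagram with one boundary component does not depend on the
base point. -/
theorem IsPlanar.oneSum_base (hC : IsPlanar f ι σ C R) (hι : ∀ a, ι a = 1 ∨ ι a = -1) (hb : b ∈ C)
    (hb' : b' ∈ C) : oneSum f z ι C b σ R o = oneSum f z ι C b' σ R o := by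
  induction hn : R.card using Nat.strong_induction_on generalizing σ R o b b' with
  | _ n ih =>
    -- By induction the ends may be chosen freely for each comparison of two base points.
    have hsm : ∀ {b b' : X}, b ∈ C → b' ∈ C → ∀ {o o₀ : α → Bool},
        oneSum f z ι C b σ R o₀ = oneSum f z ι C b' σ R o₀ →
        oneSum f z ι C b σ R o = oneSum f z ι C b' σ R o := fun hb hb' _ _ h₀ =>
      oneSum_eq_of_smooth hC.feet (fun y hy o => ih _
        (by rw [← hn]; exact Finset.card_erase_lt_of_mem hy) (hC.smooth hy) hb hb' rfl) h₀
    have hstep : ∀ {b : X}, b ∈ C → ∀ {o : α → Bool},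
        oneSum f z ι C b σ R o = oneSum f z ι C (σ b) σ R o := by
      intro b hb o
      rcases exists_foot_or f R b with ⟨a, ha, c, rfl⟩ | h
      -- This choice makes the foot to be passed an upper end.
      · exact hsm hb ((hC.inv _).2 hb) (o₀ := fun _ => !c)
          (oneSum_step_of_tail ha (hC.feet a ha) (by rw [Bool.not_not]))
      · exact oneSum_step_of_forall_ne h
    have hcyc : ∀ {b b' : X}, b ∈ C → σ.SameCycle b b' → ∀ {o : α → Bool},
        oneSum f z ι C b σ R o = oneSum f z ι C b' σ R o := by
      intro b b' hb h o
      have := h.mem_of_forall (C := {x | x ∈ C ∧ oneSum f z ι C b σ R o = oneSum f z ι C x σ R o})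
        (fun x hx => And.intro ((hC.inv x).2 hx.1) (hx.2.trans (hstep hx.1))) (And.intro hb rfl)
      exact this.2
    have hcross : ∀ a ∈ R, ∀ c, ∀ {o : α → Bool},
        oneSum f z ι C (f (a, c)) σ R o = oneSum f z ι C (f (a, !c)) σ R o := by
      intro a ha c o
      by_cases h : σ.SameCycle (f (a, c)) (f (a, !c))
      · exact hcyc (hC.feet a ha c) h
      · obtain ⟨o₀, e1, e2⟩ := exists_oneSum_eq_cross (z := z) hC hι ha c h
        refine hsm (hC.feet a ha c) (hC.feet a ha _) (o₀ := o₀) ?_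
        rw [hstep (hC.feet a ha c), hstep (hC.feet a ha _), e1, e2]
    -- The points with the same value as `b` form a union of circles closed under passing to the
    -- other foot of an arrow. If it misses `b'`, the diagram is split and both values are zero
    -- after all.
    by_contra hne
    have hinv : ∀ x, σ x ∈ {x | x ∈ C ∧ oneSum f z ι C b σ R o = oneSum f z ι C x σ R o} ↔
        x ∈ {x | x ∈ C ∧ oneSum f z ι C b σ R o = oneSum f z ι C x σ R o} := fun x => by
      by_cases hx : x ∈ C
      · refine and_congr (hC.inv x) ?_
        rw [hstep hx]
      · simp [hC.inv, hx]
    refine hne ?_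
    rw [oneSum_eq_zero_of_upper f z ι hinv (And.intro hb rfl),
      oneSum_eq_zero_of_upper f z ι
        (U := {x | x ∈ C ∧ oneSum f z ι C b σ R o = oneSum f z ι C x σ R o}ᶜ)
        (fun x => not_congr (hinv x)) (b := b') (fun h => hne h.2)]
    · intro a ha h1 h2
      refine h1 (And.intro (hC.feet a ha _) (h2.2.trans ?_))
      rw [hcross a ha, Bool.not_not]
    · exact fun h => h hb (And.intro hb rfl)
    · rintro a ha ⟨-, h⟩
      exact And.intro (hC.feet a ha _) (h.trans (hcross a ha _))
    · exact fun h => hne (h hb').2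

end OneSumBase

/-! ### Ascending and descending states with one boundary component -/

section Reverse

variable {α X 𝕂 : Type*} [DecidableEq α] [Fintype X] [CommRing 𝕂]
  {f : α × Bool ↪ X} {z : 𝕂} {ι : α → ℤ} {σ : Equiv.Perm X} {C : Set X} {R : Finset α}
  {o : α → Bool} {b e : X} {t : X → ℤ}

theorem IsWinding.neg {u W : X → ℤ} (hW : IsWinding f ι σ C R u W) :
    IsWinding f (-ι) σ C R u (-W) := by
  refine ⟨fun a ha => ?_, fun a ha => ?_, fun a ha => ?_, fun x hx h => ?_⟩
  · simp only [Pi.neg_apply, hW.straight a ha]; ring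
  · simp only [Pi.neg_apply, hW.across a ha]; ring
  · simp only [Pi.neg_apply, hW.turn a ha]; ring
  · simp only [Pi.neg_apply, hW.pass x hx h]

theorem IsPlanar.neg (hC : IsPlanar f ι σ C R) : IsPlanar f (-ι) σ C R := by
  refine ⟨hC.inv, hC.feet, fun u hu => ?_⟩
  obtain ⟨W, hW⟩ := hC.winding u hu
  exact ⟨-W, hW.neg⟩

/-- Reversing the projection sign and all prescribed ends leaves the signs of the crossings
unchanged; this is how descending states are treated as ascending ones. -/
theorem arrowWeight_neg_not (a : α) :
    arrowWeight z (-ι) (fun a => !o a) a = arrowWeight z ι o a := by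
  cases h : o a <;> simp [arrowWeight, arrowSign, h]

theorem flipEnd_not (y : α) : flipEnd (fun a => !o a) y = fun a => !flipEnd o y a := by
  ext a
  by_cases h : a = y
  · subst h; simp [flipEnd_self]
  · simp [flipEnd_of_ne _ h]

/-- A descending closed walk whose arrows are approached first at the upper end. -/
theorem IsPlanar.oneSum_eq_one_of_desc (hC : IsPlanar f ι σ C R) (hι : ∀ a, ι a = 1 ∨ ι a = -1)
    (he : e ∈ C) (hone : ∀ x ∈ C, σ.SameCycle e x)
    (ht : ∀ x ∈ C, x ≠ e → t (σ x) = t x - 1) (hinj : ∀ x ∈ C, ∀ y ∈ C, t x = t y → x = y)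
    (ho : ∀ y ∈ R, t (f (y, !o y)) < t (f (y, o y))) :
    oneSum f z ι C (σ e) σ R o = 1 := by
  classical
  have hmin : ∀ x ∈ C, t e ≤ t x := by
    obtain ⟨m, hm, hmin⟩ := Set.exists_min_image C t (Set.toFinite _) ⟨e, he⟩
    by_cases hme : m = e
    · exact hme ▸ hmin
    · have := hmin (σ m) ((hC.inv m).2 hm)
      rw [ht m hm hme] at this
      omega
  -- The arrows are flipped one by one in the order in which the walk meets their first ends; `B`
  -- contains those already flipped. When all are flipped, the upper ends come first and the value
  -- is 1.
  suffices key : ∀ B ⊆ R, (∀ y ∈ B, ∀ y' ∈ R \ B, t (f (y', o y')) < t (f (y, o y))) →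
      oneSum f z ι C (σ e) σ R (fun a => if a ∈ B then !o a else o a) = 1 by
    simpa using key ∅ (Finset.empty_subset _) (by simp)
  intro B hB hlt
  induction hn : (R \ B).card using Nat.strong_induction_on generalizing B with
  | _ n ih =>
    by_cases hne : R \ B = ∅
    · have hBR : ∀ y ∈ R, y ∈ B := fun y hy => by
        by_contra h
        have : y ∈ R \ B := Finset.mem_sdiff.2 ⟨hy, h⟩
        simp [hne] at this
      refine oneSum_eq_one_of_top f z ι hC.feet (fun y hy => ?_) fun x hx =>
        Equiv.Perm.sameCycle_apply_left.2 (hone x hx)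
      simp only [hBR y hy, if_true, Bool.not_not]
      refine MeetsBefore.of_height (D := C) (fun x hx hxe => ?_) (hC.feet y hy _) (ho y hy)
      refine ⟨σ.symm x, by rwa [← hC.inv, Equiv.apply_symm_apply], by simp, ?_⟩
      have h1 : σ.symm x ≠ e := fun h => hxe (by rw [← h, Equiv.apply_symm_apply])
      have := ht (σ.symm x) (by rwa [← hC.inv, Equiv.apply_symm_apply]) h1
      rw [Equiv.apply_symm_apply] at this
      omega
    -- The next arrow to flip is the one with the highest first end. It remains to see that the
    -- smoothing at `x` contributes zero.
    · obtain ⟨x, hxB, hmax⟩ := Finset.exists_max_image (R \ B) (fun y => t (f (y, o y)))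
        (Finset.nonempty_of_ne_empty hne)
      obtain ⟨hx, hxB'⟩ := Finset.mem_sdiff.1 hxB
      have hmax' : ∀ y ∈ R \ B, y ≠ x → t (f (y, o y)) < t (f (x, o x)) := fun y hy hyx =>
        lt_of_le_of_ne (hmax y hy) fun h => foot_ne_of_ne hyx _ _ (hinj _
          (hC.feet y (Finset.mem_sdiff.1 hy).1 _) _ (hC.feet x hx _) h)
      have e1 := ih _ (by
        rw [← hn]
        refine Finset.card_lt_card ((Finset.ssubset_iff_of_subset ?_).2 ⟨x, hxB, ?_⟩)
        · exact Finset.sdiff_subset_sdiff subset_rfl (Finset.subset_insert x B)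
        · simp) (insert x B) (Finset.insert_subset hx hB) (by
          intro y hy y' hy'
          have hy'' : y' ∈ R \ B := Finset.sdiff_subset_sdiff subset_rfl
            (Finset.subset_insert x B) hy'
          rcases Finset.mem_insert.1 hy with rfl | hy
          · exact hmax' y' hy'' fun h => by simp [h] at hy'
          · exact hlt y hy y' hy'') rfl
      have efl : (fun a => if a ∈ insert x B then !o a else o a) =
          flipEnd (fun a => if a ∈ B then !o a else o a) x := by
        ext a
        by_cases h : a = x
        · subst h; simp [flipEnd_self, hxB']
        · simp [flipEnd_of_ne _ h, h]
      rw [oneSum_skein f z ι hx (hC.feet x hx), ← efl, e1, add_eq_left]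
      refine mul_eq_zero_of_right _ ?_
      -- Smoothing at `x` cuts off the loop between its two feet. The order of the flips puts this
      -- loop below the rest, so the smoothed diagram is split.
      let U : Set X := {z | z ∈ C ∧ t (f (x, !o x)) ≤ t z ∧ t z < t (f (x, o x))}
      have hP := hC.smooth hx
      have hU : ∀ w ∈ U, (σ * hop f {x}) w ∈ U := by
        rintro w ⟨hw, h1, h2⟩
        refine And.intro ((hP.inv w).2 hw) ?_
        by_cases hwl : w = f (x, !o x)
        · subst hwl
          have hne : f (x, o x) ≠ e := fun h => by
            have := hmin _ (hC.feet x hx (!o x))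
            have := ho x hx
            rw [h] at this
            omega
          rw [smooth_foot, Bool.not_not, ht _ (hC.feet x hx _) hne]
          have := ho x hx
          omega
        · have hwh : w ≠ f (x, o x) := fun h => by rw [h] at h2; omega
          have hlt : t (f (x, !o x)) < t w := lt_of_le_of_ne h1 fun h =>
            hwl (hinj _ (hC.feet x hx _) _ hw h).symm
          have hwe : w ≠ e := fun h => by
            have := hmin _ (hC.feet x hx (!o x))
            rw [h] at hlt
            omega
          rw [smooth_of_ne, ht w hw hwe]
          · omega
          · intro d h
            rcases ends_cases d (o x) with rfl | rfl
            · exact hwh h.symm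
            · exact hwl h.symm
      rw [hP.oneSum_base hι ((hC.inv e).2 he) (hC.feet x hx (o x))]
      refine oneSum_eq_zero_of_upper f z ι (U := Uᶜ)
        (fun w => not_congr (Equiv.Perm.apply_mem_iff_of_forall hU w)) ?_ ?_ ?_
      · exact fun h => lt_irrefl _ h.2.2
      · intro y hy h1 h2
        obtain ⟨hyx, hy⟩ := Finset.mem_erase.1 hy
        by_cases hyB : y ∈ B
        · simp only [hyB, if_true, Bool.not_not] at h2
          exact lt_asymm h2.2.2 (hlt y hyB x hxB)
        · simp only [hyB, if_false] at h1 h2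
          refine h1 (And.intro (hC.feet y hy _) ⟨?_, ?_⟩)
          · exact h2.2.1.trans (ho y hy).le
          · exact hmax' y (Finset.mem_sdiff.2 ⟨hy, hyB⟩) hyx
      · exact fun h => h (hC.feet x hx (!o x)) (And.intro (hC.feet x hx _) ⟨le_rfl, ho x hx⟩)

/-- The sums over the ascending and over the descending states with one boundary component
coincide. -/
theorem IsPlanar.oneSum_neg_not (hC : IsPlanar f ι σ C R) (hι : ∀ a, ι a = 1 ∨ ι a = -1)
    (hb : b ∈ C) : oneSum f z ι C b σ R o = oneSum f z (-ι) C b σ R (fun a => !o a) := by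
  classical
  have hι' : ∀ a, (-ι) a = 1 ∨ (-ι) a = -1 := fun a => by
    rcases hι a with h | h <;> simp [h]
  induction hn : R.card using Nat.strong_induction_on generalizing σ R o with
  | _ n ih =>
    -- Both sides satisfy the same skein relation, so a single choice of ends suffices.
    suffices h : ∃ o₀, oneSum f z ι C b σ R o₀ = oneSum f z (-ι) C b σ R (fun a => !o₀ a) by
      obtain ⟨o₀, h⟩ := h
      have := eq_of_forall_flipEnd (R := R)
        (Δ := fun o => oneSum f z ι C b σ R o - oneSum f z (-ι) C b σ R (fun a => !o a))
        (fun o o' h => by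
          simp only [oneSum]
          rw [stateSum_congr_ends f z ι h, stateSum_congr_ends f z (-ι) fun a ha => by rw [h a ha]])
        (fun y hy o => by
          rw [oneSum_skein f z ι hy (hC.feet y hy), oneSum_skein f z (-ι) hy (hC.feet y hy),
            ih _ (by rw [← hn]; exact Finset.card_erase_lt_of_mem hy) (hC.smooth hy) rfl,
            arrowWeight_neg_not, flipEnd_not]
          ring) o o₀
      rwa [h, sub_self, sub_eq_zero] at this
    by_cases hone : ∀ x ∈ C, σ.SameCycle b x
    · obtain ⟨t, ht, hinj⟩ := exists_steps σ b
      have hinj' : ∀ x ∈ C, ∀ y ∈ C, t x = t y → x = y := fun x hx y hy =>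
        hinj x y (hone x hx) (hone y hy)
      have ht' : ∀ x ∈ C, x ≠ b → t (σ x) = t x - 1 := fun x hx => ht x (hone x hx)
      -- On one circle choose the ends met first. On the left this is the case of
      -- `IsPlanar.oneSum_eq_one_of_desc`, on the right all upper ends come first, and both values
      -- are 1.
      let o₀ : α → Bool := fun y => decide (t (f (y, false)) < t (f (y, true)))
      have ho : ∀ y ∈ R, t (f (y, !o₀ y)) < t (f (y, o₀ y)) := by
        intro y hy
        by_cases h : t (f (y, false)) < t (f (y, true))
        · simp [o₀, h]
        · have : t (f (y, false)) ≠ t (f (y, true)) := fun e =>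
            foot_ne_not y false (hinj' _ (hC.feet y hy _) _ (hC.feet y hy _) e)
          have : t (f (y, true)) < t (f (y, false)) := by omega
          simpa [o₀, h] using this
      refine ⟨o₀, ?_⟩
      have hσb := (hC.inv b).2 hb
      rw [hC.oneSum_base hι hb hσb, hC.neg.oneSum_base hι' hb hσb,
        hC.oneSum_eq_one_of_desc hι hb hone ht' hinj' ho]
      refine (oneSum_eq_one_of_top f z (-ι) hC.feet (fun y hy => ?_) fun x hx =>
        Equiv.Perm.sameCycle_apply_left.2 (hone x hx)).symm
      rw [Bool.not_not]
      refine MeetsBefore.of_height (D := C) (fun x hx hxe => ?_) (hC.feet y hy _) (ho y hy)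
      have hx' : σ.symm x ∈ C := by rwa [← hC.inv, Equiv.apply_symm_apply]
      refine ⟨σ.symm x, hx', by simp, ?_⟩
      have := ht' (σ.symm x) hx' fun h => hxe (by rw [← h, Equiv.apply_symm_apply])
      rw [Equiv.apply_symm_apply] at this
      omega
    · push Not at hone
      obtain ⟨b', hb', hne⟩ := hone
      -- With the circle of `b` above the rest the left side vanishes. Reversing all ends puts the
      -- rest above, and the right side vanishes after its base point is moved there.
      obtain ⟨o₀, ho⟩ := exists_upper f {x | σ.SameCycle b x}
      refine ⟨o₀, ?_⟩
      rw [oneSum_eq_zero_of_upper f z ι (sameCycle_inv σ b) (Equiv.Perm.SameCycle.refl _ _)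
        (fun a _ => ho a) fun h => hne (h hb'), hC.neg.oneSum_base hι' hb hb',
        oneSum_eq_zero_of_upper f z (-ι) (U := {x | σ.SameCycle b x}ᶜ)
          (fun x => not_congr (sameCycle_inv σ b x)) hne]
      · intro a _ h1 h2
        rw [Bool.not_not] at h2
        exact h1 (ho a h2)
      · exact fun h => h hb (Equiv.Perm.SameCycle.refl _ _)

end Reverse

/-! ### States with two boundary components -/

section PairSum

theorem ite_eq_ite_of_iff {β : Type*} {p q : Prop} {_ : Decidable p} {_ : Decidable q} (h : p ↔ q)
    (x y : β) : ite p x y = ite q x y := if_congr h rfl rfl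

variable {α X 𝕂 : Type*} [DecidableEq α] [Fintype X] [CommRing 𝕂]

/-- The cycles of `b` and `y` are different and there are no other cycles. -/
def IsCyclePair (τ : Equiv.Perm X) (b y : X) : Prop :=
  ¬ τ.SameCycle b y ∧ ∀ x, τ.SameCycle b x ∨ τ.SameCycle y x

/-- Going along the cycle of `b` and then along the cycle of `y` we meet `p` before `q`. -/
def MeetsBeforeTwo (τ : Equiv.Perm X) (b y p q : X) : Prop :=
  MeetsBefore τ b p q ∨ (¬ τ.SameCycle b p ∧ ¬ τ.SameCycle b q ∧ MeetsBefore τ y p q)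

variable {f : α × Bool ↪ X} {z : 𝕂} {ι : α → ℤ} {σ τ : Equiv.Perm X} {b y p q : X}

/-- The two passages together cover everything, so exactly one end of an arrow comes first; this
yields the skein relation for states with two components. -/
theorem IsCyclePair.meetsBeforeTwo_iff (h : IsCyclePair τ b y) (hpq : p ≠ q) :
    MeetsBeforeTwo τ b y p q ↔ ¬ MeetsBeforeTwo τ b y q p := by
  unfold MeetsBeforeTwo
  by_cases h1 : τ.SameCycle b p
  · have := MeetsBefore.iff_not h1 hpq
    tauto
  · have h1' : ¬ MeetsBefore τ b p q := fun h => h1 h.sameCycle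
    by_cases h2 : τ.SameCycle b q
    · have := MeetsBefore.of_not_sameCycle h2 h1
      tauto
    · have h2' : ¬ MeetsBefore τ b q p := fun h => h2 h.sameCycle
      have := MeetsBefore.iff_not ((h.2 p).resolve_left h1) hpq
      tauto

theorem MeetsBeforeTwo.meetsBefore (h : MeetsBeforeTwo τ b y p q)
    (hpq : τ.SameCycle b p ∨ τ.SameCycle b q) : MeetsBefore τ b p q := by
  unfold MeetsBeforeTwo at h
  tauto

variable (f z ι σ b) {R S T : Finset α} {o : α → Bool}

open Classical in
/-- The arrows of the state `S` that are approached in the passage from `b`. -/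
noncomputable def touching (S : Finset α) : Finset α :=
  {a ∈ S | ∃ c, (σ * hop f S).SameCycle b (f (a, c))}

open Classical in
/-- The arrows that are not approached in the passage from `b`. -/
noncomputable def away (R T : Finset α) : Finset α :=
  {a ∈ R | ∀ c, ¬ (σ * hop f T).SameCycle b (f (a, c))}

open Classical in
/-- The sum over the states with two boundary components with given properties of the arrows that
are approached in the passage from `b`; these arrows determine the second starting point. -/
noncomputable def pairSum (P : Finset α → Prop) (y : Finset α → X) (R : Finset α) (o : α → Bool) :
    𝕂 :=
  ∑ S ∈ R.powerset, if P (touching f σ b S) ∧ IsCyclePair (σ * hop f S) b (y (touching f σ b S)) ∧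
      ∀ a ∈ S, MeetsBeforeTwo (σ * hop f S) b (y (touching f σ b S)) (f (a, o a)) (f (a, !o a))
    then ∏ a ∈ S, arrowWeight z ι o a else 0

variable {f z ι σ b}

theorem mem_touching {a : α} :
    a ∈ touching f σ b S ↔ a ∈ S ∧ ∃ c, (σ * hop f S).SameCycle b (f (a, c)) := by
  classical
  simp [touching]

theorem mem_away {a : α} :
    a ∈ away f σ b R T ↔ a ∈ R ∧ ∀ c, ¬ (σ * hop f T).SameCycle b (f (a, c)) := by
  classical
  simp [away]

theorem touching_subset : touching f σ b S ⊆ S := fun _ ha => (mem_touching.1 ha).1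

/-- Arrows that the passage from `b` never reaches have no influence on it, so this passage is
determined by the arrows it touches. -/
theorem mul_hop_eqOn_touching : ∀ x ∈ {x | (σ * hop f S).SameCycle b x},
    (σ * hop f S) x = (σ * hop f (touching f σ b S)) x := by
  intro x hx
  rw [Equiv.Perm.mul_apply, Equiv.Perm.mul_apply]
  rcases exists_foot_or f S x with ⟨a, ha, c, rfl⟩ | h
  · rw [hop_foot f ha, hop_foot f (mem_touching.2 ⟨ha, c, hx⟩)]
  · rw [hop_of_forall_ne f h, hop_of_forall_ne f fun a ha => h a (touching_subset ha)]

theorem sameCycle_touching_iff {x : X} :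
    (σ * hop f (touching f σ b S)).SameCycle b x ↔ (σ * hop f S).SameCycle b x :=
  (Equiv.Perm.sameCycle_congr_of_eqOn (C := {x | (σ * hop f S).SameCycle b x})
    (fun x hx => (sameCycle_inv _ b x).2 hx) mul_hop_eqOn_touching
    (Equiv.Perm.SameCycle.refl _ _)).symm

theorem touching_touching : touching f σ b (touching f σ b S) = touching f σ b S := by
  refine Finset.Subset.antisymm touching_subset fun a ha => ?_
  obtain ⟨-, c, hc⟩ := mem_touching.1 ha
  exact mem_touching.2 ⟨ha, c, sameCycle_touching_iff.2 hc⟩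

theorem disjoint_away (hT : touching f σ b T = T) (hS : S ⊆ away f σ b R T) : Disjoint T S := by
  refine Finset.disjoint_left.2 fun a ha haS => ?_
  rw [← hT] at ha
  obtain ⟨-, c, hc⟩ := mem_touching.1 ha
  exact (mem_away.1 (hS haS)).2 c hc

theorem mul_hop_union_eqOn (hS : S ⊆ away f σ b R T) :
    ∀ x ∈ {x | (σ * hop f T).SameCycle b x}, (σ * hop f T) x = (σ * hop f (T ∪ S)) x := by
  intro x hx
  rw [Equiv.Perm.mul_apply, Equiv.Perm.mul_apply]
  rcases exists_foot_or f T x with ⟨a, ha, c, rfl⟩ | h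
  · rw [hop_foot f ha, hop_foot f (Finset.mem_union_left _ ha)]
  · rw [hop_of_forall_ne f h, hop_of_forall_ne f fun a ha c e => ?_]
    rcases Finset.mem_union.1 ha with ha | ha
    · exact h a ha c e
    · exact (mem_away.1 (hS ha)).2 c (e ▸ hx)

theorem sameCycle_union_iff (hS : S ⊆ away f σ b R T) {x : X} :
    (σ * hop f (T ∪ S)).SameCycle b x ↔ (σ * hop f T).SameCycle b x :=
  (Equiv.Perm.sameCycle_congr_of_eqOn (C := {x | (σ * hop f T).SameCycle b x})
    (fun x hx => (sameCycle_inv _ b x).2 hx) (mul_hop_union_eqOn hS)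
    (Equiv.Perm.SameCycle.refl _ _)).symm

theorem meetsBefore_union_iff (hS : S ⊆ away f σ b R T) :
    MeetsBefore (σ * hop f (T ∪ S)) b p q ↔ MeetsBefore (σ * hop f T) b p q :=
  (MeetsBefore.congr_of_eqOn (C := {x | (σ * hop f T).SameCycle b x})
    (fun x hx => (sameCycle_inv _ b x).2 hx) (mul_hop_union_eqOn hS)
    (Equiv.Perm.SameCycle.refl _ _)).symm

theorem touching_union (hT : touching f σ b T = T) (hS : S ⊆ away f σ b R T) :
    touching f σ b (T ∪ S) = T := by
  ext a
  simp only [mem_touching, sameCycle_union_iff hS, Finset.mem_union]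
  constructor
  · rintro ⟨ha | ha, c, hc⟩
    · exact ha
    · exact absurd hc ((mem_away.1 (hS ha)).2 c)
  · intro ha
    refine ⟨Or.inl ha, ?_⟩
    rw [← hT] at ha
    exact (mem_touching.1 ha).2

variable (f z ι σ b)

open Classical in
/-- The sum over the states, fibered over the sets of arrows approached in the passage from `b`. -/
theorem pairSum_eq_sum (P : Finset α → Prop) (y : Finset α → X) (R : Finset α) (o : α → Bool) :
    pairSum f z ι σ b P y R o = ∑ T ∈ R.powerset,
      if touching f σ b T = T ∧ P T ∧ ¬ (σ * hop f T).SameCycle b (y T) ∧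
        ∀ a ∈ T, MeetsBefore (σ * hop f T) b (f (a, o a)) (f (a, !o a))
      then (∏ a ∈ T, arrowWeight z ι o a) * oneSum f z ι {x | (σ * hop f T).SameCycle b x}ᶜ (y T)
        (σ * hop f T) (away f σ b R T) o else 0 := by
  rw [pairSum, ← Finset.sum_fiberwise_of_maps_to (s := R.powerset) (t := R.powerset)
    (g := touching f σ b) fun S hS => Finset.mem_powerset.2
      (touching_subset.trans (Finset.mem_powerset.1 hS))]
  refine Finset.sum_congr rfl fun T hTR => ?_
  rw [Finset.mem_powerset] at hTR
  by_cases hT : touching f σ b T = T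
  swap
  · rw [if_neg fun h => hT h.1]
    refine Finset.sum_eq_zero fun S hS => absurd ?_ hT
    rw [← (Finset.mem_filter.1 hS).2, touching_touching]
  -- The states touched exactly in `T` are the unions of `T` with arbitrary sets of arrows away from
  -- the cycle of `b`.
  have hbij : ∀ g : Finset α → 𝕂, ∑ S ∈ R.powerset with touching f σ b S = T, g S =
      ∑ S ∈ (away f σ b R T).powerset, g (T ∪ S) := by
    intro g
    symm
    refine Finset.sum_nbij' (fun S => T ∪ S) (fun S => S \ T) ?_ ?_ ?_ ?_ ?_
    · intro S hS
      rw [Finset.mem_powerset] at hS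
      refine Finset.mem_filter.2 ⟨Finset.mem_powerset.2 (Finset.union_subset hTR fun a ha =>
        (mem_away.1 (hS ha)).1), touching_union hT hS⟩
    · intro S hS
      obtain ⟨hSR, hST⟩ := Finset.mem_filter.1 hS
      refine Finset.mem_powerset.2 fun a ha => ?_
      obtain ⟨ha, haT⟩ := Finset.mem_sdiff.1 ha
      refine mem_away.2 ⟨Finset.mem_powerset.1 hSR ha, fun c hc => haT ?_⟩
      rw [← hST] at hc ⊢
      exact mem_touching.2 ⟨ha, c, sameCycle_touching_iff.1 hc⟩
    · intro S hS
      exact Finset.union_sdiff_cancel_left (disjoint_away hT (Finset.mem_powerset.1 hS))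
    · intro S hS
      refine Finset.union_sdiff_of_subset ?_
      rw [← (Finset.mem_filter.1 hS).2]
      exact touching_subset
    · intro S _
      rfl
  rw [hbij]
  by_cases hcond : touching f σ b T = T ∧ P T ∧ ¬ (σ * hop f T).SameCycle b (y T) ∧
        ∀ a ∈ T, MeetsBefore (σ * hop f T) b (f (a, o a)) (f (a, !o a))
  · rw [if_pos hcond, oneSum, stateSum, Finset.mul_sum]
    refine Finset.sum_congr rfl fun S hS => ?_
    rw [Finset.mem_powerset] at hS
    have hdis := disjoint_away hT hS
    rw [touching_union hT hS, mul_ite, mul_zero, ← Finset.prod_union hdis]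
    refine ite_eq_ite_of_iff ?_ _ _
    rw [mul_assoc, ← hop_union f hdis]
    obtain ⟨-, hP, hy, hb⟩ := hcond
    simp only [hP, true_and, IsCyclePair, sameCycle_union_iff hS, hy, not_false_eq_true,
      Set.mem_compl_iff, Set.mem_ofPred_eq]
    refine and_congr (forall_congr' fun x => or_iff_not_imp_left) ⟨fun h a ha => ?_, fun h a ha => ?_⟩
    · have haw := (mem_away.1 (hS ha)).2
      rcases h a (Finset.mem_union_right _ ha) with h | h
      · exact absurd (sameCycle_union_iff hS |>.1 h.sameCycle) (haw _)
      · exact h.2.2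
    · rcases Finset.mem_union.1 ha with ha | ha
      · exact Or.inl ((meetsBefore_union_iff hS).2 (hb a ha))
      · have haw := (mem_away.1 (hS ha)).2
        refine Or.inr ⟨?_, ?_, h a ha⟩ <;> rw [sameCycle_union_iff hS] <;> exact haw _
  · rw [if_neg hcond]
    refine Finset.sum_eq_zero fun S hS => if_neg fun h => hcond ?_
    rw [Finset.mem_powerset] at hS
    rw [touching_union hT hS] at h
    obtain ⟨hP, hpair, hF⟩ := h
    refine ⟨hT, hP, fun h => hpair.1 ((sameCycle_union_iff hS).2 h), fun a ha => ?_⟩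
    rw [← meetsBefore_union_iff hS]
    refine (hF a (Finset.mem_union_left _ ha)).meetsBefore ?_
    have ha' := ha
    rw [← hT] at ha'
    obtain ⟨-, c, hc⟩ := mem_touching.1 ha'
    simp only [sameCycle_union_iff hS]
    rcases ends_cases c (o a) with rfl | rfl
    · exact Or.inl hc
    · exact Or.inr hc

variable {f z ι σ b}

/-- What is left of the diagram, smoothed at `T`, off the cycle of `b` is planar, so base point
independence applies to the inner sums of `pairSum_eq_sum`. -/
theorem IsPlanar.restrict_away (hC : IsPlanar f ι σ Set.univ R) (hT : touching f σ b T = T) (hTR : T ⊆ R) :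
    IsPlanar f ι (σ * hop f T) {x | (σ * hop f T).SameCycle b x}ᶜ (away f σ b R T) := by
  refine (hC.smooth_subset hTR).restrict (Set.subset_univ _)
    (fun x => not_congr (sameCycle_inv _ b x)) fun a => ?_
  rw [mem_away, Finset.mem_sdiff]
  constructor
  · rintro ⟨h1, h2⟩
    refine ⟨⟨h1, fun h => ?_⟩, h2⟩
    rw [← hT] at h
    obtain ⟨-, c, hc⟩ := mem_touching.1 h
    exact h2 c hc
  · rintro ⟨⟨h1, -⟩, h2⟩
    exact ⟨h1, h2⟩

/-- The sum does not depend on the second starting points. -/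
theorem IsPlanar.pairSum_congr (hC : IsPlanar f ι σ Set.univ R) (hι : ∀ a, ι a = 1 ∨ ι a = -1)
    {P : Finset α → Prop} {y y' : Finset α → X}
    (h : ∀ T ⊆ R, touching f σ b T = T → P T → {x | (σ * hop f T).SameCycle b x} ≠ Set.univ →
      ¬ (σ * hop f T).SameCycle b (y T) ∧ ¬ (σ * hop f T).SameCycle b (y' T)) :
    pairSum f z ι σ b P y R o = pairSum f z ι σ b P y' R o := by
  classical
  rw [pairSum_eq_sum, pairSum_eq_sum]
  refine Finset.sum_congr rfl fun T hTR => ?_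
  rw [Finset.mem_powerset] at hTR
  by_cases h1 : touching f σ b T = T ∧ P T ∧ {x | (σ * hop f T).SameCycle b x} ≠ Set.univ
  · obtain ⟨hT, hP, hne⟩ := h1
    obtain ⟨e1, e2⟩ := h T hTR hT hP hne
    simp only [e1, e2]
    -- The second starting point is merely the base point of the inner sum.
    rw [(hC.restrict_away hT hTR).oneSum_base hι e1 e2]
  · have key : ∀ y : Finset α → X, ¬ (touching f σ b T = T ∧ P T ∧
        ¬ (σ * hop f T).SameCycle b (y T) ∧
        ∀ a ∈ T, MeetsBefore (σ * hop f T) b (f (a, o a)) (f (a, !o a))) := by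
      rintro y ⟨g1, g2, g3, -⟩
      refine h1 ⟨g1, g2, fun e => g3 ?_⟩
      change y T ∈ {x | (σ * hop f T).SameCycle b x}
      rw [e]
      trivial
    rw [if_neg (key y), if_neg (key y')]

end PairSum

/-! ### States without separating arrows -/

section Disc

variable {α X 𝕂 : Type*} [DecidableEq α] [Fintype X] [CommRing 𝕂] {f : α × Bool ↪ X} {z : 𝕂}
  {ι : α → ℤ} {σ τ : Equiv.Perm X} {b b' p q : X} {R S T : Finset α} {o : α → Bool} {U : Set X}

/-- No arrow of the state separates. -/
def NoSeparating (f : α × Bool ↪ X) (σ : Equiv.Perm X) (b : X) (T : Finset α) : Prop :=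
  ∀ a ∈ T, ∀ c, (σ * hop f T).SameCycle b (f (a, c))

open Classical in
/-- The arrows with both feet in `U`. -/
noncomputable def arrowsIn (f : α × Bool ↪ X) (R : Finset α) (U : Set X) : Finset α :=
  {a ∈ R | ∀ c, f (a, c) ∈ U}

theorem mem_arrowsIn {a : α} : a ∈ arrowsIn f R U ↔ a ∈ R ∧ ∀ c, f (a, c) ∈ U := by
  classical
  simp [arrowsIn]

theorem IsPlanar.inside (hC : IsPlanar f ι σ Set.univ R) (hU : ∀ x, σ x ∈ U ↔ x ∈ U) :
    IsPlanar f ι σ U (arrowsIn f R U) :=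
  hC.restrict (Set.subset_univ _) hU fun _ => mem_arrowsIn

/-- The arrows with both feet in `T` do not move the points of the complement. -/
theorem mul_hop_eqOn_compl (hT : ∀ a ∈ T, ∀ c, f (a, c) ∈ U) : ∀ x ∈ Uᶜ, (σ * hop f T) x = σ x := by
  intro x hx
  rw [Equiv.Perm.mul_apply, hop_of_forall_ne f]
  rintro a ha c rfl
  exact hx (hT a ha c)

open Classical in
-- Without separating arrows the first component `U` contains both feet of every arrow it touches,
-- hence is a union of circles. The state is an independent pair of one-component states on `U` and
-- on its complement.
theorem IsPlanar.pairSum_noSeparating (hC : IsPlanar f ι σ Set.univ R)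
    (hι : ∀ a, ι a = 1 ∨ ι a = -1) {y : Finset α → X}
    (hy : ∀ T ⊆ R, {x | (σ * hop f T).SameCycle b x} ≠ Set.univ → ¬ (σ * hop f T).SameCycle b (y T))
    {pt : Set X → X} (hpt : ∀ U : Set X, U.Nonempty → pt U ∈ U) :
    pairSum f z ι σ b (NoSeparating f σ b) y R o =
      ∑ U : Set X, if b ∈ U ∧ U ≠ Set.univ ∧ ∀ x, σ x ∈ U ↔ x ∈ U then
        oneSum f z ι U (pt U) σ (arrowsIn f R U) o * oneSum f z ι Uᶜ (pt Uᶜ) σ (arrowsIn f R Uᶜ) o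
        else 0 := by
  rw [pairSum_eq_sum, ← Finset.sum_fiberwise (g := fun T => {x | (σ * hop f T).SameCycle b x})]
  refine Finset.sum_congr rfl fun U _ => ?_
  by_cases hU : b ∈ U ∧ U ≠ Set.univ ∧ ∀ x, σ x ∈ U ↔ x ∈ U
  · rw [if_pos hU]
    obtain ⟨hb, hne, hinv⟩ := hU
    have hne' : Uᶜ.Nonempty := Set.nonempty_compl.2 hne
    have hUc : ∀ x, σ x ∈ Uᶜ ↔ x ∈ Uᶜ := fun x => not_congr (hinv x)
    rw [Finset.sum_filter, ← Finset.sum_subset (s₁ := (arrowsIn f R U).powerset)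
      (Finset.powerset_mono.2 fun a ha => (mem_arrowsIn.1 ha).1),
      (hC.inside hinv).oneSum_base hι (hpt U ⟨b, hb⟩) hb, oneSum, stateSum, Finset.sum_mul]
    · refine Finset.sum_congr rfl fun T hT => ?_
      rw [Finset.mem_powerset] at hT
      have hTU : ∀ a ∈ T, ∀ c, f (a, c) ∈ U := fun a ha => (mem_arrowsIn.1 (hT ha)).2
      have hTR : T ⊆ R := fun a ha => (mem_arrowsIn.1 (hT ha)).1
      have hinvT := mul_hop_mem_iff hinv hTU
      by_cases hcyc : {x | (σ * hop f T).SameCycle b x} = U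
      · have hall : ∀ x ∈ U, (σ * hop f T).SameCycle b x := fun x hx => by rwa [← hcyc] at hx
        rw [if_pos hcyc, ite_mul, zero_mul]
        have hval : oneSum f z ι {x | (σ * hop f T).SameCycle b x}ᶜ (y T) (σ * hop f T)
            (away f σ b R T) o = oneSum f z ι Uᶜ (pt Uᶜ) σ (arrowsIn f R Uᶜ) o := by
          have haw : away f σ b R T = arrowsIn f R Uᶜ := by
            ext a
            rw [mem_away, mem_arrowsIn, ← hcyc]
            rfl
          have hyU : y T ∈ Uᶜ := fun h => hy T hTR (by rwa [hcyc]) (hall _ h)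
          rw [haw, hcyc, oneSum_congr_of_eqOn f z ι (fun x => not_congr (hinvT x))
            (mul_hop_eqOn_compl hTU) (fun a ha => (mem_arrowsIn.1 ha).2) hyU,
            (hC.inside hUc).oneSum_base hι hyU (hpt _ hne')]
        rw [hval]
        refine ite_eq_ite_of_iff ⟨fun h => ⟨hall, h.2.2.2⟩, fun h => ⟨?_, ?_, ?_, h.2⟩⟩ _ _
        · exact Finset.Subset.antisymm touching_subset fun a ha =>
            mem_touching.2 ⟨ha, true, hall _ (hTU a ha _)⟩
        · exact fun a ha c => hall _ (hTU a ha c)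
        · exact hy T hTR (by rwa [hcyc])
      · rw [if_neg hcyc, if_neg, zero_mul]
        rintro ⟨h, -⟩
        refine hcyc (Set.Subset.antisymm (fun x hx => ?_) h)
        exact Equiv.Perm.SameCycle.mem_of_forall hx (fun x hx => (hinvT x).2 hx) hb
    · intro T hTR hT
      by_cases hcyc : {x | (σ * hop f T).SameCycle b x} = U
      · rw [if_pos hcyc, if_neg]
        rintro ⟨-, hP, -⟩
        refine hT (Finset.mem_powerset.2 fun a ha => mem_arrowsIn.2
          ⟨Finset.mem_powerset.1 hTR ha, fun c => ?_⟩)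
        rw [← hcyc]
        exact hP a ha c
      · rw [if_neg hcyc]
  · rw [if_neg hU]
    refine Finset.sum_eq_zero fun T hT => if_neg ?_
    obtain ⟨hTR, rfl⟩ := Finset.mem_filter.1 hT
    rintro ⟨-, hP, hyT, -⟩
    refine hU ⟨Equiv.Perm.SameCycle.refl _ _, fun e => ?_, fun x => ?_⟩
    · have : y T ∈ {x | (σ * hop f T).SameCycle b x} := by rw [e]; trivial
      exact hyT this
    · have h := sameCycle_inv (σ * hop f T) b (hop f T x)
      rw [Equiv.Perm.mul_apply, hop_hop] at h
      exact h.trans (hop_mem_iff f hP)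

/-- The sum over the states without separating arrow does not depend on the base point. -/
theorem IsPlanar.pairSum_noSeparating_base (hC : IsPlanar f ι σ Set.univ R)
    (hι : ∀ a, ι a = 1 ∨ ι a = -1) {y y' : Finset α → X}
    (hy : ∀ T ⊆ R, {x | (σ * hop f T).SameCycle b x} ≠ Set.univ → ¬ (σ * hop f T).SameCycle b (y T))
    (hy' : ∀ T ⊆ R, {x | (σ * hop f T).SameCycle b' x} ≠ Set.univ →
      ¬ (σ * hop f T).SameCycle b' (y' T)) :
    2 * pairSum f z ι σ b (NoSeparating f σ b) y R o =
      2 * pairSum f z ι σ b' (NoSeparating f σ b') y' R o := by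
  classical
  let pt : Set X → X := fun U => if h : U.Nonempty then h.some else b
  have hpt : ∀ U : Set X, U.Nonempty → pt U ∈ U := fun U h => by
    simp only [pt, h, dite_true]
    exact h.some_mem
  -- The contribution of a splitting is symmetric under complement. Of `U` and its complement
  -- exactly one contains the base point, so twice the sum runs over all splittings without
  -- reference to a base point.
  let g : Set X → 𝕂 := fun U => if U ≠ ∅ ∧ U ≠ Set.univ ∧ ∀ x, σ x ∈ U ↔ x ∈ U then
    oneSum f z ι U (pt U) σ (arrowsIn f R U) o * oneSum f z ι Uᶜ (pt Uᶜ) σ (arrowsIn f R Uᶜ) o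
    else 0
  have hg : ∀ U, g Uᶜ = g U := fun U => by
    simp only [g, compl_compl, ne_eq, Set.compl_empty_iff, Set.compl_univ_iff,
      Set.mem_compl_iff, not_iff_not]
    rw [mul_comm]
    exact ite_eq_ite_of_iff (by tauto) _ _
  have key : ∀ (b : X) (y : Finset α → X), (∀ T ⊆ R, {x | (σ * hop f T).SameCycle b x} ≠ Set.univ →
      ¬ (σ * hop f T).SameCycle b (y T)) →
      2 * pairSum f z ι σ b (NoSeparating f σ b) y R o = ∑ U, g U := by
    intro b y hy
    rw [hC.pairSum_noSeparating hι hy hpt]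
    have e1 : ∀ U : Set X, (if b ∈ U ∧ U ≠ Set.univ ∧ ∀ x, σ x ∈ U ↔ x ∈ U then
        oneSum f z ι U (pt U) σ (arrowsIn f R U) o * oneSum f z ι Uᶜ (pt Uᶜ) σ (arrowsIn f R Uᶜ) o
        else 0) = if b ∈ U then g U else 0 := by
      intro U
      simp only [g, ← ite_and]
      refine ite_eq_ite_of_iff ⟨fun h => ⟨h.1, ?_, h.2⟩, fun h => ⟨h.1, h.2.2⟩⟩ _ _
      rintro rfl
      exact h.1
    rw [Finset.sum_congr rfl fun U _ => e1 U, two_mul]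
    nth_rw 2 [← Equiv.sum_comp ((compl_involutive (α := Set X)).toPerm _)]
    rw [← Finset.sum_add_distrib]
    refine Finset.sum_congr rfl fun U _ => ?_
    simp only [Function.Involutive.coe_toPerm, hg]
    by_cases h : b ∈ U <;> simp [h]
  rw [key b y hy, key b' y' hy']

theorem pairSum_add (P : Finset α → Prop) (y : Finset α → X) :
    pairSum f z ι σ b P y R o + pairSum f z ι σ b (fun T => ¬ P T) y R o =
      pairSum f z ι σ b (fun _ => True) y R o := by
  classical
  rw [pairSum, pairSum, pairSum, ← Finset.sum_add_distrib]
  refine Finset.sum_congr rfl fun S _ => ?_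
  by_cases h : P (touching f σ b S) <;> simp [h]

/-- The sum over the states with two boundary components. The second starting point is chosen by
means of the function `Y`, which assigns to every proper subset a point of its complement. -/
noncomputable def twoSum (f : α × Bool ↪ X) (z : 𝕂) (ι : α → ℤ) (Y : Set X → X) (b : X)
    (σ : Equiv.Perm X) (R : Finset α) (o : α → Bool) : 𝕂 :=
  stateSum f z ι (fun τ => IsCyclePair τ b (Y {x | τ.SameCycle b x}))
    (fun τ => MeetsBeforeTwo τ b (Y {x | τ.SameCycle b x})) σ R o

variable {Y Y' : Set X → X}

theorem twoSum_skein {y : α} (hy : y ∈ R) :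
    twoSum f z ι Y b σ R o = twoSum f z ι Y b σ R (flipEnd o y) +
      arrowWeight z ι o y * twoSum f z ι Y b (σ * hop f {y}) (R.erase y) o :=
  stateSum_skein f z ι hy fun _ _ _ hQ c => hQ.meetsBeforeTwo_iff (foot_ne_not y c)

theorem twoSum_eq_pairSum : twoSum f z ι Y b σ R o =
    pairSum f z ι σ b (fun _ => True) (fun T => Y {x | (σ * hop f T).SameCycle b x}) R o := by
  classical
  rw [twoSum, stateSum, pairSum]
  refine Finset.sum_congr rfl fun S _ => ?_
  have e : {x | (σ * hop f (touching f σ b S)).SameCycle b x} = {x | (σ * hop f S).SameCycle b x} :=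
    Set.ext fun x => sameCycle_touching_iff
  simp only [e, true_and]

/-- The sum does not depend on the second starting points. -/
theorem IsPlanar.twoSum_congr (hC : IsPlanar f ι σ Set.univ R) (hι : ∀ a, ι a = 1 ∨ ι a = -1)
    (hY : ∀ U, U ≠ Set.univ → Y U ∉ U) (hY' : ∀ U, U ≠ Set.univ → Y' U ∉ U) :
    twoSum f z ι Y b σ R o = twoSum f z ι Y' b σ R o := by
  rw [twoSum_eq_pairSum, twoSum_eq_pairSum]
  exact hC.pairSum_congr hι fun T _ _ _ h => ⟨hY _ h, hY' _ h⟩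

open Classical in
-- As the second starting points are immaterial, they may be prescribed by any `g` wherever this is
-- admissible.
theorem exists_chooser (b : X) (g : Set X → X) :
    ∃ Y : Set X → X, (∀ U, U ≠ Set.univ → Y U ∉ U) ∧ ∀ U, g U ∉ U → Y U = g U := by
  refine ⟨fun U => if g U ∉ U then g U else if h : Uᶜ.Nonempty then h.some else b,
    fun U hU => ?_, fun U hU => if_pos hU⟩
  by_cases h : g U ∉ U
  · simp [h]
  · have h' : Uᶜ.Nonempty := Set.nonempty_compl.2 hU
    simp only [h, h', if_false, dite_true]
    exact h'.some_mem

/-- In the upper part of a diagram every state has a separating arrow, or the upper part is bounded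
by one component. -/
theorem IsPlanar.twoSum_eq_of_upper (hC : IsPlanar f ι σ Set.univ R) (hι : ∀ a, ι a = 1 ∨ ι a = -1)
    (hY : ∀ U, U ≠ Set.univ → Y U ∉ U) (hinv : ∀ x, σ x ∈ U ↔ x ∈ U) (hb : b ∈ U)
    (hU : ∀ a ∈ R, f (a, o a) ∈ U → f (a, !o a) ∈ U) (hne : U ≠ Set.univ) :
    twoSum f z ι Y b σ R o = pairSum f z ι σ b (NoSeparating f σ b)
      (fun T => Y {x | (σ * hop f T).SameCycle b x}) R o := by
  classical
  rw [twoSum_eq_pairSum, ← pairSum_add (NoSeparating f σ b), add_eq_left]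
  -- If possible, let the second passage also start in `U`; then neither passage could leave `U`,
  -- although together they cover everything. So the first one must fill `U`.
  let g : Set X → X := fun V => if h : (U \ V).Nonempty then h.some else b
  obtain ⟨Y', hY', hg⟩ := exists_chooser b g
  rw [hC.pairSum_congr hι (y' := fun T => Y' {x | (σ * hop f T).SameCycle b x})
    fun T _ _ _ h => ⟨hY _ h, hY' _ h⟩]
  refine Finset.sum_eq_zero fun S hS => if_neg ?_
  rw [Finset.mem_powerset] at hS
  have e : {x | (σ * hop f (touching f σ b S)).SameCycle b x} = {x | (σ * hop f S).SameCycle b x} :=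
    Set.ext fun x => sameCycle_touching_iff
  rintro ⟨hP, hpair, hF⟩
  simp only [e] at hpair hF
  set V := {x | (σ * hop f S).SameCycle b x} with hV
  have hVU : V ⊆ U := by
    rintro x hx
    obtain ⟨n, rfl⟩ := Equiv.Perm.sameCycle_iff_exists_nat.1 hx
    exact mem_of_upper f hinv hb (fun a ha => hU a (hS ha))
      (fun a ha h => Or.inr ((hF a ha).meetsBefore (Or.inr h))) n
  have hUV : U ⊆ V := by
    by_contra hUV
    have hne' : (U \ V).Nonempty := Set.sdiff_nonempty.2 hUV
    have hgV : g V ∈ U \ V := by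
      simp only [g, hne', dite_true]
      exact hne'.some_mem
    have hYV : Y' V ∈ U := by rw [hg V hgV.2]; exact hgV.1
    refine hne (Set.eq_univ_of_forall fun x => ?_)
    rcases hpair.2 x with h | h
    · exact hVU h
    · obtain ⟨n, rfl⟩ := Equiv.Perm.sameCycle_iff_exists_nat.1 h
      refine mem_of_upper f hinv hYV (fun a ha => hU a (hS ha)) (fun a ha _ => ?_) n
      rcases hF a ha with h | h
      · exact Or.inl (hVU h.sameCycle)
      · exact Or.inr h.2.2
  refine hP fun a ha c => ?_
  rw [sameCycle_touching_iff]
  obtain ⟨haS, d, hd⟩ := mem_touching.1 ha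
  have hhead : (σ * hop f S).SameCycle b (f (a, o a)) := by
    rcases ends_cases d (o a) with rfl | rfl
    · exact hd
    · exact ((hF a haS).meetsBefore (Or.inr hd)).sameCycle
  rcases ends_cases c (o a) with rfl | rfl
  · exact hhead
  · exact hUV (hU a (hS haS) (hVU hhead))

end Disc

/-! ### The dependence on the base point of the sum over the states with two boundary components -/

section TwoSumBase

variable {α X 𝕂 : Type*} [DecidableEq α] [Fintype X] [CommRing 𝕂] {f : α × Bool ↪ X} {z : 𝕂}
  {ι : α → ℤ} {σ τ τ₀ : Equiv.Perm X} {b b' d p q : X} {R S T : Finset α} {o : α → Bool} {a : α}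
  {c : Bool} {U Γ : Set X} {Y Y' : Set X → X} {t W : X → ℤ}

theorem twoSum_step_of_forall_ne (hb : ∀ a ∈ R, ∀ c, f (a, c) ≠ b) :
    twoSum f z ι Y b σ R o = twoSum f z ι Y (σ b) σ R o := by
  refine stateSum_congr f z ι fun S hS => ?_
  have e : (σ * hop f S) b = σ b := smooth_apply_of_ne hb hS
  have e1 : ∀ x, (σ * hop f S).SameCycle (σ b) x ↔ (σ * hop f S).SameCycle b x := fun x => by
    rw [← e, Equiv.Perm.sameCycle_apply_left]
  simp only [IsCyclePair, MeetsBeforeTwo, e1]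
  refine and_congr Iff.rfl (forall₂_congr fun a ha => ?_)
  rw [← e, MeetsBefore.step (hb a (hS ha) _) (hb a (hS ha) _)]

/-- Exchanging the images of the last points of two cycles merges them. -/
theorem IsCyclePair.sameCycle_of_splice (hb : τ₀ b = τ d) (hd : τ₀ d = τ b)
    (h : ∀ x, x ≠ b → x ≠ d → τ₀ x = τ x) (hp : IsCyclePair τ (τ d) (τ b)) (x : X) :
    τ₀.SameCycle b x := by
  have hE := sameCycle_inv τ₀ b
  have hbE : b ∈ {x | τ₀.SameCycle b x} := Equiv.Perm.SameCycle.refl _ _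
  have hdE : d ∈ {x | τ₀.SameCycle b x} := by
    by_contra hdE
    have hcl : ∀ x ∈ {x | τ₀.SameCycle b x ∧ τ.SameCycle (τ d) x},
        τ x ∈ {x | τ₀.SameCycle b x ∧ τ.SameCycle (τ d) x} := by
      rintro x ⟨h1, h2⟩
      refine And.intro ?_ (Equiv.Perm.sameCycle_apply_right.2 h2)
      rw [← h x]
      · exact (hE x).2 h1
      · rintro rfl
        exact hp.1 (Equiv.Perm.sameCycle_apply_right.2 h2)
      · rintro rfl
        exact hdE h1
    have : τ.SameCycle (τ d) d := Equiv.Perm.sameCycle_apply_left.2 (Equiv.Perm.SameCycle.refl _ _)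
    exact hdE (this.mem_of_forall hcl (And.intro (hb ▸ (hE b).2 hbE)
      (Equiv.Perm.SameCycle.refl _ _))).1
  have hcl : ∀ x ∈ {x | τ₀.SameCycle b x}, τ x ∈ {x | τ₀.SameCycle b x} := by
    intro x hx
    by_cases h1 : x = b
    · rw [h1, ← hd]; exact (hE d).2 hdE
    by_cases h2 : x = d
    · rw [h2, ← hb]; exact (hE b).2 hbE
    · rw [← h x h1 h2]; exact (hE x).2 hx
  rcases hp.2 x with hx | hx
  · exact hx.mem_of_forall hcl (hb ▸ (hE b).2 hbE)
  · exact hx.mem_of_forall hcl (hd ▸ (hE d).2 hdE)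

/-- The cycle of `τ₀`, walked from `τ₀ b`, runs first to `d` and then on to `b`. The permutation `τ`
closes each of these two stretches separately, so the two passages in succession visit the points in
the same order as before. -/
theorem isCyclePair_of_splice (hbd : b ≠ d) (hb : τ₀ b = τ d) (hd : τ₀ d = τ b)
    (h : ∀ x, x ≠ b → x ≠ d → τ₀ x = τ x) (hone : ∀ x, τ₀.SameCycle b x) :
    IsCyclePair τ (τ d) (τ b) ∧ ∀ p q, p ≠ q → p ≠ b → q ≠ b →
      (MeetsBeforeTwo τ (τ d) (τ b) p q ↔ MeetsBefore τ₀ b p q) := by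
  obtain ⟨t, ht, hinj⟩ := exists_steps τ₀ b
  have ht : ∀ x, x ≠ b → t (τ₀ x) = t x - 1 := fun x => ht x (hone x)
  have hinj : ∀ x y, t x = t y → x = y := fun x y => hinj x y (hone x) (hone y)
  have hpred : ∀ x, x ≠ τ d → ∃ x', x' ≠ b ∧ τ₀ x' = x ∧ t x' = t x + 1 := by
    intro x hx
    have h1 : τ₀.symm x ≠ b := fun e => hx (by rw [← hb, ← e, Equiv.apply_symm_apply])
    have h2 := ht _ h1
    rw [Equiv.apply_symm_apply] at h2
    exact ⟨_, h1, Equiv.apply_symm_apply _ _, by omega⟩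
  have hmax : ∀ x, t x ≤ t (τ d) := fun x =>
    le_of_forall_exists_lt (D := Set.univ) (Set.mem_univ _) (fun x _ hx => by
      obtain ⟨x', -, -, e⟩ := hpred x hx
      exact ⟨x', Set.mem_univ _, by omega⟩) x (Set.mem_univ _)
  have hmin : ∀ x, t b ≤ t x := by
    obtain ⟨m, -, hmin⟩ := Set.exists_min_image Set.univ t (Set.toFinite _) ⟨b, Set.mem_univ _⟩
    by_cases hme : m = b
    · exact fun x => hme ▸ hmin x (Set.mem_univ _)
    · have := hmin (τ₀ m) (Set.mem_univ _)
      rw [ht m hme] at this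
      omega
  have hbd' : t b < t d := lt_of_le_of_ne (hmin d) fun e => hbd (hinj _ _ e)
  -- With `t` the number of steps left until `b`, the first stretch is where `t` is at least `t d`,
  -- and the second one is the rest.
  have hD1 : ∀ x ∈ {x | t d ≤ t x}, x ≠ τ d → ∃ x' ∈ {x | t d ≤ t x}, τ x' = x ∧ t x < t x' := by
    intro x hx hxd
    obtain ⟨x', h1, rfl, h3⟩ := hpred x hxd
    have hx : t d ≤ t (τ₀ x') := hx
    exact ⟨x', show t d ≤ t x' by omega, (h x' h1 fun e => by rw [e] at h3 hx; omega).symm, by omega⟩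
  have hD2 : ∀ x ∈ {x | t x < t d}, x ≠ τ b → ∃ x' ∈ {x | t x < t d}, τ x' = x ∧ t x < t x' := by
    intro x hx hxb
    have hx : t x < t d := hx
    obtain ⟨x', h1, rfl, h3⟩ := hpred x fun e => by have := hmax d; rw [e] at hx; omega
    have h2 : x' ≠ d := fun e => hxb (by rw [e, hd])
    have h4 : t x' ≠ t d := fun e => h2 (hinj _ _ e)
    exact ⟨x', show t x' < t d by omega, (h x' h1 h2).symm, by omega⟩
  have hcl : ∀ x ∈ {x | t d ≤ t x}, τ x ∈ {x | t d ≤ t x} := by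
    intro x hx
    have hx : t d ≤ t x := hx
    by_cases h2 : x = d
    · rw [h2]; exact hmax d
    · have h1 : x ≠ b := fun e => by rw [e] at hx; omega
      have h4 : t x ≠ t d := fun e => h2 (hinj _ _ e)
      rw [← h x h1 h2]
      change t d ≤ t (τ₀ x)
      rw [ht x h1]
      omega
  have hsc1 : ∀ x, t d ≤ t x → τ.SameCycle (τ d) x := fun x hx => by
    obtain ⟨k, rfl, -⟩ := exists_pow_of_height hD1 hx
    exact τ.sameCycle_pow_self _ _
  have hsc2 : ∀ x, t x < t d → ¬ τ.SameCycle (τ d) x := fun x hx hsc =>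
    not_le.2 hx (hsc.mem_of_forall hcl (hmax d))
  have hpair : IsCyclePair τ (τ d) (τ b) := by
    refine ⟨hsc2 _ ?_, fun x => ?_⟩
    · rw [← hd, ht d hbd.symm]; omega
    · by_cases hx : t d ≤ t x
      · exact Or.inl (hsc1 x hx)
      · obtain ⟨k, rfl, -⟩ := exists_pow_of_height hD2 (not_le.1 hx)
        exact Or.inr (τ.sameCycle_pow_self _ _)
  have hA : ∀ p q, t q < t p → MeetsBeforeTwo τ (τ d) (τ b) p q := by
    intro p q hpq
    by_cases hp : t d ≤ t p
    · by_cases hq : t d ≤ t q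
      · exact Or.inl (MeetsBefore.of_height hD1 hp hpq)
      · exact Or.inl (MeetsBefore.of_not_sameCycle (hsc1 p hp) (hsc2 q (not_le.1 hq)))
    · rw [not_le] at hp
      exact Or.inr ⟨hsc2 p hp, hsc2 q (hpq.trans hp), MeetsBefore.of_height hD2 hp hpq⟩
  have hB : ∀ p q, t q < t p → MeetsBefore τ₀ (τ₀ b) p q := fun p q hpq =>
    MeetsBefore.of_height (D := Set.univ) (fun x _ hx => by
      obtain ⟨x', -, h2, h3⟩ := hpred x (by rwa [← hb])
      exact ⟨x', Set.mem_univ _, h2, by omega⟩) (Set.mem_univ _) hpq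
  refine ⟨hpair, fun p q hpq hp hq => ?_⟩
  rw [← MeetsBefore.step hp hq]
  rcases lt_trichotomy (t p) (t q) with hlt | heq | hlt
  · exact iff_of_false (fun h => (hpair.meetsBeforeTwo_iff hpq).1 h (hA q p hlt))
      (hB q p hlt).asymm
  · exact absurd (hinj _ _ heq) hpq
  · exact iff_of_true (hA p q hlt) (hB p q hlt)

/-- The passage starts at the upper end of `a`, so no admissible state contains `a`. -/
theorem oneSum_erase_of_tail (ha : a ∈ R) :
    oneSum f z ι U (f (a, !o a)) σ R o = oneSum f z ι U (f (a, !o a)) σ (R.erase a) o := by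
  rw [oneSum, oneSum, stateSum_split f z ι ha, add_eq_left, stateSum, Finset.sum_eq_zero, mul_zero]
  intro S _
  refine if_neg ?_
  rintro ⟨⟨-, h⟩, -⟩
  exact h.base_ne rfl

/-- Moving the base point over the upper end of an arrow. -/
theorem IsPlanar.twoSum_step_of_tail (hC : IsPlanar f ι σ Set.univ R) (hι : ∀ a, ι a = 1 ∨ ι a = -1)
    (hY : ∀ U, U ≠ Set.univ → Y U ∉ U) (ha : a ∈ R) :
    twoSum f z ι Y (σ (f (a, !o a))) σ R o = twoSum f z ι Y (f (a, !o a)) σ R o +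
      arrowWeight z ι o a * oneSum f z ι Set.univ (f (a, !o a)) σ R o := by
  -- Let the second passage start just after the lower end of `a`, where cutting the cycle makes the
  -- second stretch begin.
  obtain ⟨Y', hY', hg⟩ := exists_chooser (f (a, o a)) fun _ => σ (f (a, o a))
  rw [hC.twoSum_congr hι hY hY', hC.twoSum_congr hι hY hY', oneSum_erase_of_tail ha]
  have h1 := twoSum_step_of_forall_ne (f := f) (z := z) (ι := ι) (σ := σ) (Y := Y')
    (R := R.erase a) (o := o) (b := f (a, !o a)) fun y hy d =>
      foot_ne_of_ne (Finset.ne_of_mem_erase hy) d _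
  rw [twoSum, twoSum] at h1
  rw [twoSum, twoSum, stateSum_split f z ι ha, stateSum_split f z ι ha, h1, add_assoc, add_right_inj,
    ← mul_add]
  congr 1
  -- Before the move, states containing `a` vanish, as `a` is approached at once at its upper end.
  -- After the move they correspond by splicing to the one-component states without `a`; states
  -- without `a` do not notice the move.
  rw [eq_comm]
  refine (congrArg₂ (· + ·) (Finset.sum_eq_zero fun S _ => if_neg ?_) rfl).trans
    ((zero_add _).trans (stateSum_congr f z ι fun S hS => ?_))
  · rintro ⟨⟨-, h⟩, -⟩
    exact (h.meetsBefore (Or.inr (Equiv.Perm.SameCycle.refl _ _))).base_ne rfl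
  have haS : a ∉ S := fun h => by simpa using hS h
  have hbd : f (a, !o a) ≠ f (a, o a) := (foot_ne_not a (o a)).symm
  have eb : (σ * hop f {a} * hop f S) (f (a, !o a)) = σ (f (a, o a)) := by
    rw [Equiv.Perm.mul_apply, hop_foot_of_notMem f haS, smooth_foot, Bool.not_not]
  have ed : (σ * hop f {a} * hop f S) (f (a, o a)) = σ (f (a, !o a)) := by
    rw [Equiv.Perm.mul_apply, hop_foot_of_notMem f haS, smooth_foot]
  have eb0 : (σ * hop f S) (f (a, !o a)) = σ (f (a, !o a)) := by
    rw [Equiv.Perm.mul_apply, hop_foot_of_notMem f haS]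
  have ed0 : (σ * hop f S) (f (a, o a)) = σ (f (a, o a)) := by
    rw [Equiv.Perm.mul_apply, hop_foot_of_notMem f haS]
  have e0 : ∀ x, x ≠ f (a, !o a) → x ≠ f (a, o a) →
      (σ * hop f S) x = (σ * hop f {a} * hop f S) x := by
    intro x h1 h2
    have hS' : ∀ y ∈ S, y ≠ a := fun y hy e => haS (e ▸ hy)
    rw [Equiv.Perm.mul_apply, Equiv.Perm.mul_apply, smooth_of_ne]
    intro c e
    have h3 : hop f S (f (a, c)) = x := by rw [e, hop_hop]
    rw [hop_foot_of_notMem f haS] at h3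
    rcases ends_cases c (o a) with rfl | rfl
    · exact h2 h3.symm
    · exact h1 h3.symm
  have hne : ∀ y ∈ S, ∀ c, f (y, c) ≠ f (a, !o a) := fun y hy c =>
    foot_ne_of_ne (fun e : y = a => haS (e ▸ hy)) _ _
  have hsplit := isCyclePair_of_splice (τ := σ * hop f {a} * hop f S) (τ₀ := σ * hop f S) hbd
    (by rw [eb0, ed]) (by rw [ed0, eb]) e0
  rw [eb, ed] at hsplit
  have hYeq : IsCyclePair (σ * hop f {a} * hop f S) (σ (f (a, !o a))) (σ (f (a, o a))) →
      Y' {x | (σ * hop f {a} * hop f S).SameCycle (σ (f (a, !o a))) x} = σ (f (a, o a)) :=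
    fun h => hg _ h.1
  constructor
  · rintro ⟨hone, hF⟩
    obtain ⟨h1, h2⟩ := hsplit fun x => hone x (Set.mem_univ x)
    rw [hYeq h1]
    refine ⟨⟨h1, Or.inl (MeetsBefore.of_not_sameCycle ?_ ?_)⟩, fun y hy => ?_⟩
    · rw [← ed]
      exact Equiv.Perm.sameCycle_apply_left.2 (Equiv.Perm.SameCycle.refl _ _)
    · rw [← Equiv.Perm.sameCycle_apply_right, eb]
      exact h1.1
    · exact (h2 _ _ (foot_ne_not y (o y)) (hne y hy _) (hne y hy _)).2 (hF y hy)
  · rintro ⟨⟨hp, hd⟩, hF⟩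
    have hsc : (σ * hop f {a} * hop f S).SameCycle (σ (f (a, !o a))) (f (a, o a)) := by
      rw [← ed]
      exact Equiv.Perm.sameCycle_apply_left.2 (Equiv.Perm.SameCycle.refl _ _)
    have hnb := (hd.meetsBefore (Or.inl hsc)).not_sameCycle_of_closed ed
    rw [← Equiv.Perm.sameCycle_apply_right, eb] at hnb
    rw [hg _ hnb] at hp hF
    have hone := IsCyclePair.sameCycle_of_splice (τ := σ * hop f {a} * hop f S) (τ₀ := σ * hop f S)
      (b := f (a, !o a)) (d := f (a, o a)) (by rw [eb0, ed]) (by rw [ed0, eb]) e0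
      (by rwa [eb, ed])
    obtain ⟨h1, h2⟩ := hsplit hone
    exact ⟨fun x _ => hone x, fun y hy =>
      (h2 _ _ (foot_ne_not y (o y)) (hne y hy _) (hne y hy _)).1 (hF y hy)⟩

end TwoSumBase

/-! ### Values of the two-component sum on descending diagrams, and the effect of moving the base
point -/

section TwoSumBase

variable {α X 𝕂 : Type*} [DecidableEq α] [Fintype X] [CommRing 𝕂] {f : α × Bool ↪ X} {z : 𝕂}
  {ι : α → ℤ} {σ τ τ₀ : Equiv.Perm X} {b b' d p q : X} {R S T : Finset α} {o : α → Bool} {a : α}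
  {c : Bool} {U Γ : Set X} {Y Y' : Set X → X} {t W : X → ℤ}

/-- On a descending circle an admissible passage uses no arrow. It runs through the whole circle and
leaves no room for a second component. -/
theorem twoSum_eq_zero_of_top (hone : ∀ x, σ.SameCycle b x)
    (htop : ∀ a ∈ R, MeetsBefore σ b (f (a, !o a)) (f (a, o a))) :
    twoSum f z ι Y b σ R o = 0 := by
  refine Finset.sum_eq_zero fun S hS => if_neg ?_
  rintro ⟨hQ, hF⟩
  have key := forall_foot_ne_of_top f (σ := σ) (b := b) (S := S) (o := o)
    (fun a ha _ => htop a (Finset.mem_powerset.1 hS ha)) fun a ha c hc =>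
      (hF a ha).meetsBefore (by
        rcases ends_cases c (o a) with rfl | rfl
        · exact Or.inl hc
        · exact Or.inr hc)
  refine hQ.1 ?_
  obtain ⟨n, hn⟩ := Equiv.Perm.sameCycle_iff_exists_nat.1
    (hone (Y {x | (σ * hop f S).SameCycle b x}))
  rw [← hn, ← (key n).1]
  exact Equiv.Perm.sameCycle_pow_self _ _ _

/-- Two circles without crossings, up to crossing changes. -/
theorem twoSum_eq_one_of_top (hp : IsCyclePair σ p q)
    (htop : ∀ a ∈ R, σ.SameCycle p (f (a, o a)) → MeetsBefore σ p (f (a, !o a)) (f (a, o a)))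
    (htop' : ∀ a ∈ R, σ.SameCycle q (f (a, o a)) → σ.SameCycle q (f (a, !o a)) →
      MeetsBefore σ q (f (a, !o a)) (f (a, o a)))
    (hY : Y {x | σ.SameCycle p x} = q) : twoSum f z ι Y p σ R o = 1 := by
  rw [twoSum, stateSum, Finset.sum_eq_single ∅]
  · rw [if_pos]
    · simp
    · simpa [hY] using hp
  · intro S hS hne
    refine if_neg ?_
    rintro ⟨-, hF⟩
    have hSR := Finset.mem_powerset.1 hS
    have key := forall_foot_ne_of_top f (σ := σ) (b := p) (S := S) (o := o)
      (fun a ha => htop a (hSR ha)) fun a ha c hc => (hF a ha).meetsBefore (by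
        rcases ends_cases c (o a) with rfl | rfl
        · exact Or.inl hc
        · exact Or.inr hc)
    have hsc : ∀ x, (σ * hop f S).SameCycle p x ↔ σ.SameCycle p x := fun x => by
      simp only [Equiv.Perm.sameCycle_iff_exists_nat, (key _).1]
    have hfeet : ∀ a ∈ S, ∀ c, ¬ σ.SameCycle p (f (a, c)) := fun a ha c h => by
      obtain ⟨n, hn⟩ := Equiv.Perm.sameCycle_iff_exists_nat.1 h
      exact (key n).2 a ha c hn.symm
    have hfeet' : ∀ a ∈ S, ∀ c, σ.SameCycle q (f (a, c)) := fun a ha c =>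
      (hp.2 _).resolve_left (hfeet a ha c)
    have e : {x | (σ * hop f S).SameCycle p x} = {x | σ.SameCycle p x} := Set.ext hsc
    simp only [e, hY] at hF
    obtain ⟨a, ha⟩ := Finset.nonempty_of_ne_empty hne
    obtain ⟨n, hn⟩ := Equiv.Perm.sameCycle_iff_exists_nat.1 (hfeet' a ha true)
    refine (forall_foot_ne_of_top f (σ := σ) (b := q) (S := S) (o := o)
      (fun a ha _ => htop' a (hSR ha) (hfeet' a ha _) (hfeet' a ha _)) (fun a ha c hc => ?_) n).2
        a ha true hn.symm
    rcases hF a ha with h | h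
    · exact absurd ((hsc _).1 h.sameCycle) (hfeet a ha _)
    · exact h.2.2
  · simp

/-- If the two arcs are circles, they are passed with decreasing height. -/
theorem IsTwoArc.meetsBefore_circles (h : IsTwoArc f σ Set.univ R o a c p q Γ t)
    (ha : f (a, c) ∈ Γ) :
    IsCyclePair σ p q ∧ (∀ x, σ.SameCycle p x ↔ x ∈ Γ) ∧
      (∀ x y, x ∈ Γ → t y < t x → MeetsBefore σ p x y) ∧
      ∀ x y, x ∉ Γ → t y < t x → MeetsBefore σ q x y := by
  have hinv : ∀ x, σ x ∈ Γ ↔ x ∈ Γ := fun x => by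
    by_cases h1 : x = f (a, c)
    · subst h1; simp [h.start_left, h.left_mem, ha]
    · by_cases h2 : x = f (a, !c)
      · subst h2
        have := h.ends
        simp only [h.start_right, h.right_notMem]
        tauto
      · exact h.side x (Set.mem_univ x) h1 h2
  have hΓ : ∀ x ∈ Γ, x ≠ p → ∃ x' ∈ Γ, σ x' = x ∧ t x < t x' := by
    intro x hx hxp
    obtain ⟨x', -, h1, h2, rfl⟩ := h.exists_pred (fun _ => by simp) (Set.mem_univ x) hxp
      fun e => h.right_notMem (e ▸ hx)
    exact ⟨x', (hinv x').1 hx, rfl, by rw [h.desc x' (Set.mem_univ _) h1 h2]; omega⟩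
  have hΓc : ∀ x ∈ Γᶜ, x ≠ q → ∃ x' ∈ Γᶜ, σ x' = x ∧ t x < t x' := by
    intro x hx hxq
    obtain ⟨x', -, h1, h2, rfl⟩ := h.exists_pred (fun _ => by simp) (Set.mem_univ x)
      (fun e => hx (e ▸ h.left_mem)) hxq
    exact ⟨x', mt (hinv x').2 hx, rfl, by rw [h.desc x' (Set.mem_univ _) h1 h2]; omega⟩
  have hp : ∀ x, σ.SameCycle p x ↔ x ∈ Γ := fun x => by
    refine ⟨fun hx => hx.mem_of_forall (fun x => (hinv x).2) h.left_mem, fun hx => ?_⟩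
    obtain ⟨k, rfl, -⟩ := exists_pow_of_height hΓ hx
    exact σ.sameCycle_pow_self k p
  refine ⟨⟨mt (hp q).1 h.right_notMem, fun x => ?_⟩, hp, fun x y hx hxy => MeetsBefore.of_height hΓ hx hxy,
    fun x y hx hxy => MeetsBefore.of_height hΓc hx hxy⟩
  by_cases hx : x ∈ Γ
  · exact Or.inl ((hp x).2 hx)
  · obtain ⟨k, rfl, -⟩ := exists_pow_of_height hΓc hx
    exact Or.inr (σ.sameCycle_pow_self k q)

/-- The value of the sum on two arcs, the first one above the second one. -/
theorem IsTwoArc.twoSum_of_top (h : IsTwoArc f σ Set.univ R o a c p q Γ t)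
    (hC : IsPlanar f ι σ Set.univ R) (hY : ∀ U, q ∉ U → Y U = q)
    (htop : ∀ y ∈ R, y ≠ a → f (y, o y) ∈ Γ → f (y, !o y) ∈ Γ) {F : ℤ → 𝕂} (h0 : F 0 = 0)
    (h1 : F 1 = 1) (hF : ∀ k, F (k + 1) = F (k - 1) + z * F k) (hι : ∀ a, ι a = 1 ∨ ι a = -1) :
    twoSum f z ι Y p σ R o = F (crossSum f ι Γ R o - arrowSign ι o a) := by
  by_cases ha : f (a, c) ∈ Γ
  · have ha' := h.ends.1 ha
    obtain ⟨hpair, hp, hm, hm'⟩ := h.meetsBefore_circles ha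
    obtain ⟨g1, g2⟩ := h.top_smooth hC ha htop
    have hq : ∀ x, σ.SameCycle q x → x ∉ Γ := fun x hx hxΓ =>
      hpair.1 (((hp x).2 hxΓ).trans hx.symm)
    -- In the skein relation at `a` the flipped diagram consists of two descending circles, one
    -- above the other, and gives 1; the smoothed diagram is one descending circle and gives 0.
    rw [h.crossSum_of_mem hC ha htop, two_mul, add_sub_cancel_right, (ladder_sign h0 h1 hF hι).2,
      twoSum_skein h.mem, twoSum_eq_zero_of_top (fun x => g1 x (Set.mem_univ x)) g2, mul_zero,
      add_zero]
    have hlt : ∀ y ∈ R, y ≠ a → (f (y, o y) ∈ Γ ∨ f (y, !o y) ∉ Γ) →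
        t (f (y, o y)) < t (f (y, !o y)) := by
      intro y hy hya hyΓ
      rcases h.upper_or hC htop hy hya with h | h <;> tauto
    refine twoSum_eq_one_of_top hpair (fun y hy hyp => ?_) (fun y hy hyq hyq' => ?_) (hY _ hpair.1)
    · rw [hp] at hyp
      have hya : y ≠ a := by
        rintro rfl
        rw [flipEnd_self, h.head] at hyp
        exact ha' hyp
      rw [flipEnd_of_ne o hya] at hyp ⊢
      exact hm _ _ (htop y hy hya hyp) (hlt y hy hya (Or.inl hyp))
    · have hya : y ≠ a := by
        rintro rfl
        rw [flipEnd_self, h.head, Bool.not_not] at hyq'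
        exact hq _ hyq' ha
      rw [flipEnd_of_ne o hya] at hyq hyq' ⊢
      exact hm' _ _ (hq _ hyq') (hlt y hy hya (Or.inr (hq _ hyq')))
  · rw [h.crossSum_of_notMem hC ha htop, sub_self, h0]
    obtain ⟨g1, g2⟩ := h.top hC ha htop
    exact twoSum_eq_zero_of_top (fun x => g1 x (Set.mem_univ x)) g2

/-- The same recursion as for one component with the index shifted by the sign `s` of `a`: the base
counts `2 * s` for two circles and `s` for one circle now give `F s = 1` and `F 0 = 0`. -/
theorem IsTwoArc.twoSum_eq (h : IsTwoArc f σ Set.univ R o a c p q Γ t)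
    (hC : IsPlanar f ι σ Set.univ R) (hY : ∀ U, q ∉ U → Y U = q) {F : ℤ → 𝕂} (h0 : F 0 = 0)
    (h1 : F 1 = 1) (hF : ∀ k, F (k + 1) = F (k - 1) + z * F k) (hι : ∀ a, ι a = 1 ∨ ι a = -1) :
    twoSum f z ι Y p σ R o = F (crossSum f ι Γ R o - arrowSign ι o a) := by
  refine h.eq_of_skein (g := fun k => F (k - arrowSign ι o a)) (fun k => ?_) hι
    (V := fun σ R o => twoSum f z ι Y p σ R o) (fun _ _ _ _ hy _ => twoSum_skein hy)
    (fun σ' R' o' Γ' t' hC' h' htop => ?_) hC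
  · have := hF (k - arrowSign ι o a)
    rw [show k + 1 - arrowSign ι o a = k - arrowSign ι o a + 1 by ring, this,
      show k - 1 - arrowSign ι o a = k - arrowSign ι o a - 1 by ring]
  · have e : arrowSign ι o a = arrowSign ι o' a := by simp [arrowSign, h.head, h'.head]
    simp only [e]
    exact h'.twoSum_of_top hC' hY htop h0 h1 hF hι

/-- The lower one of two circles. -/
theorem exists_twoSum_eq_cross (hC : IsPlanar f ι σ Set.univ R) (hι : ∀ a, ι a = 1 ∨ ι a = -1)
    (hY : ∀ U, U ≠ Set.univ → Y U ∉ U) (ha : a ∈ R) (c : Bool)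
    (hc : ¬ σ.SameCycle (f (a, c)) (f (a, !c))) :
    ∃ o, oneSum f z ι Set.univ (σ (f (a, c))) σ R o = 0 ∧
      2 * twoSum f z ι Y (σ (f (a, c))) σ R o = 2 * twoSum f z ι Y (σ (f (a, !c))) σ R o := by
  by_cases h2 : ∀ x ∈ Set.univ, σ.SameCycle (f (a, c)) x ∨ σ.SameCycle (f (a, !c)) x
  · obtain ⟨o, t, h, hU, ho⟩ := exists_isTwoArc hC ha c hc h2
    obtain ⟨F, h0, h1, hF⟩ := exists_ladder z
    refine ⟨o, ?_, ?_⟩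
    -- From the upper circle the vanishing on split diagrams is immediate.
    · rw [hC.oneSum_base hι (Set.mem_univ _) (Set.mem_univ (σ (f (a, !c))))]
      exact oneSum_eq_zero_of_upper f z ι (U := {x | σ.SameCycle (f (a, c)) x}ᶜ)
        (fun x => not_congr (sameCycle_inv σ (f (a, c)) x))
        (fun h => hc (Equiv.Perm.sameCycle_apply_right.1 h)) hU
        fun hCU => hCU (Set.mem_univ (f (a, c))) (Equiv.Perm.SameCycle.refl _ _)
    · have hmem : f (a, c) ∈ {x | σ.SameCycle (f (a, c)) x} := Equiv.Perm.SameCycle.refl _ _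
      obtain ⟨hpair, hp, hm, hm'⟩ := h.meetsBefore_circles hmem
      obtain ⟨Yp, hYp, hYp'⟩ := exists_chooser (σ (f (a, c))) fun _ => σ (f (a, c))
      obtain ⟨Yq, hYq, hYq'⟩ := exists_chooser (σ (f (a, c))) fun _ => σ (f (a, !c))
      have hpair' : IsCyclePair σ (σ (f (a, !c))) (σ (f (a, c))) :=
        ⟨fun h => hpair.1 h.symm, fun x => (hpair.2 x).symm⟩
      have hq : ∀ x, σ.SameCycle (σ (f (a, !c))) x → x ∉ {x | σ.SameCycle (f (a, c)) x} :=
        fun x hx hxΓ => hpair.1 (((hp x).2 hxΓ).trans hx.symm)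
      have hcr : crossSum f ι {x | σ.SameCycle (f (a, c)) x} R o = 0 := by
        rw [← crossSum_compl]
        exact hC.crossSum_eq_zero (fun x _ => not_congr (sameCycle_inv σ _ x)) hU
      -- Seen from the lower circle, the arc formula with linking number zero gives `F (-s) = 1` for
      -- `s` the sign of `a`. Seen from the upper circle the value 1 is direct, each time with the
      -- second starting point on the other circle.
      rw [hC.twoSum_congr hι hY hYq, hC.twoSum_congr (b := σ (f (a, !c))) hι hY hYp,
        h.twoSum_eq hC hYq' h0 h1 hF hι, hcr, zero_sub,
        twoSum_eq_one_of_top hpair' (fun y hy hyq => ?_) (fun y hy hyp hyp' => ?_)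
          (hYp' _ hpair'.1)]
      · rw [show F (-arrowSign ι o a) = 1 by
          obtain ⟨-, e2, -⟩ := ladder_two h0 h1 hF
          rcases arrowSign_eq_or hι o a with h | h <;> rw [h]
          · exact e2
          · rw [neg_neg, h1]]
      · have hyΓ := hq _ hyq
        have hya : y ≠ a := by
          rintro rfl
          rw [h.head] at hyΓ
          exact hyΓ hmem
        exact hm' _ _ (hU y hy hyΓ) (ho y hy hya)
      · have hya : y ≠ a := by
          rintro rfl
          rw [hp, h.head] at hyp'
          exact hc hyp'
        exact hm _ _ ((hp _).1 hyp') (ho y hy hya)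
  · set U := {x | σ.SameCycle (f (a, c)) x ∨ σ.SameCycle (f (a, !c)) x} with hU
    obtain ⟨o, ho⟩ := exists_upper f U
    have hinv : ∀ x, σ x ∈ U ↔ x ∈ U := fun x =>
      or_congr Equiv.Perm.sameCycle_apply_right Equiv.Perm.sameCycle_apply_right
    have hne : U ≠ Set.univ := fun e => h2 fun x _ => by
      have : x ∈ U := e ▸ Set.mem_univ x
      exact this
    have hp : σ (f (a, c)) ∈ U := Or.inl (Equiv.Perm.sameCycle_apply_right.2
        (Equiv.Perm.SameCycle.refl _ _))
    have hq : σ (f (a, !c)) ∈ U := Or.inr (Equiv.Perm.sameCycle_apply_right.2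
        (Equiv.Perm.SameCycle.refl _ _))
    refine ⟨o, oneSum_eq_zero_of_upper f z ι hinv hp (fun a _ => ho a) fun h => h2 h, ?_⟩
    -- With a third circle below, only states without separating arrows count from either base
    -- point. Their independence is known up to the factor 2.
    rw [hC.twoSum_eq_of_upper hι hY hinv hp (fun a _ => ho a) hne,
      hC.twoSum_eq_of_upper hι hY hinv hq (fun a _ => ho a) hne]
    exact hC.pairSum_noSeparating_base hι (fun T _ h => hY _ h) fun T _ h => hY _ h

/-- The dependence on the base point of the sum over the states with two boundary components. -/
theorem IsPlanar.twoSum_base (hC : IsPlanar f ι σ Set.univ R) (hι : ∀ a, ι a = 1 ∨ ι a = -1)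
    (hY : ∀ U, U ≠ Set.univ → Y U ∉ U) (hW : IsWinding f ι σ Set.univ R (fun _ => 1) W) :
    2 * (twoSum f z ι Y b σ R o - twoSum f z ι Y b' σ R o) +
      z * ((W b - W b' : ℤ) : 𝕂) * oneSum f z ι Set.univ b σ R o = 0 := by
  induction hn : R.card using Nat.strong_induction_on generalizing σ R o b b' with
  | _ n ih =>
    have hone : ∀ {b b' : X} {o : α → Bool},
        oneSum f z ι Set.univ b σ R o = oneSum f z ι Set.univ b' σ R o :=
      hC.oneSum_base hι (Set.mem_univ _) (Set.mem_univ _)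
    let Δ : X → X → (α → Bool) → 𝕂 := fun b b' o =>
      2 * (twoSum f z ι Y b σ R o - twoSum f z ι Y b' σ R o) +
        z * ((W b - W b' : ℤ) : 𝕂) * oneSum f z ι Set.univ b σ R o
    have hΔ : ∀ b b' o, Δ b b' o = 2 * (twoSum f z ι Y b σ R o - twoSum f z ι Y b' σ R o) +
        z * ((W b - W b' : ℤ) : 𝕂) * oneSum f z ι Set.univ b σ R o := fun _ _ _ => rfl
    have hsm : ∀ {b b' : X} {o o₀ : α → Bool}, Δ b b' o₀ = 0 → Δ b b' o = 0 := by
      intro b b' o o₀ h₀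
      rw [← h₀]
      refine eq_of_forall_flipEnd (R := R) (fun o o' h => ?_) (fun y hy o => ?_) o o₀
      · simp only [hΔ, twoSum, oneSum]
        rw [stateSum_congr_ends f z ι h, stateSum_congr_ends f z ι h,
          stateSum_congr_ends f z ι h]
      -- The unit flow passes through every smoothing, so the same `W` is valid for the smoothed
      -- diagram.
      · have := ih _ (by rw [← hn]; exact Finset.card_erase_lt_of_mem hy) (hC.smooth hy)
          (hW.smooth hy rfl) (b := b) (b' := b') (o := o) rfl
        rw [hΔ, hΔ, twoSum_skein hy, twoSum_skein (b := b') hy,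
          oneSum_skein f z ι hy (hC.feet y hy)]
        linear_combination arrowWeight z ι o y * this
    have htrans : ∀ {b b' b'' : X} {o : α → Bool}, Δ b b' o = 0 → Δ b' b'' o = 0 →
        Δ b b'' o = 0 := by
      intro b b' b'' o h1 h2
      rw [hΔ] at h1 h2 ⊢
      rw [hone (b := b') (b' := b)] at h2
      push_cast at *
      linear_combination h1 + h2
    have hsymm : ∀ {b b' : X} {o : α → Bool}, Δ b b' o = 0 → Δ b' b o = 0 := by
      intro b b' o h1
      rw [hΔ] at h1 ⊢
      rw [hone (b := b') (b' := b)]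
      push_cast at *
      linear_combination -h1
    have hrefl : ∀ {b : X} {o : α → Bool}, Δ b b o = 0 := by
      intro b o
      rw [hΔ]
      simp
    have hstep : ∀ {b : X} {o : α → Bool}, Δ b (σ b) o = 0 := by
      intro b o
      rcases exists_foot_or f R b with ⟨a, ha, c, rfl⟩ | h
      -- Make the foot that is passed an upper end. For the unit flow `W` then drops by twice the
      -- sign, which balances the weight times `oneSum` gained by `twoSum`.
      · refine hsm (o₀ := fun _ => !c) ?_
        have e := hC.twoSum_step_of_tail (z := z) (o := fun _ => !c) hι hY ha
        simp only [Bool.not_not] at e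
        have e2 : W (f (a, c)) - W (σ (f (a, c))) = 2 * arrowSign ι (fun _ => !c) a := by
          cases c
          · rw [hW.straight a ha]
            simp [arrowSign]; ring
          · rw [hW.turn a ha, hW.across a ha]
            simp [arrowSign]; ring
        rw [hΔ, e, e2, arrowWeight]
        push_cast
        ring
      · rw [hΔ, ← twoSum_step_of_forall_ne h, hW.pass b (Set.mem_univ b) h]
        simp
    have hcyc : ∀ {b b' : X}, σ.SameCycle b b' → ∀ {o : α → Bool}, Δ b b' o = 0 := by
      intro b b' h o
      exact h.mem_of_forall (C := {x | Δ b x o = 0}) (fun x hx => htrans hx hstep) hrefl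
    have hcross : ∀ a ∈ R, ∀ c, ∀ {o : α → Bool}, Δ (f (a, c)) (f (a, !c)) o = 0 := by
      intro a ha c o
      by_cases h : σ.SameCycle (f (a, c)) (f (a, !c))
      · exact hcyc h
      · obtain ⟨o₀, e1, e2⟩ := exists_twoSum_eq_cross (z := z) hC hι hY ha c h
        -- For this choice of ends `oneSum` vanishes, so the difference of the winding sums plays no
        -- role.
        refine hsm (o₀ := o₀) (htrans hstep (htrans ?_ (hsymm hstep)))
        rw [hΔ, e1]
        linear_combination e2
    by_contra hne
    -- Otherwise the diagram splits along `E`. Then `oneSum` is zero, only states without separating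
    -- arrows contribute to `twoSum`, and these do not distinguish the base points.
    set E : Set X := {x | Δ b x o = 0} with hE
    have hinv : ∀ x, σ x ∈ E ↔ x ∈ E := fun x =>
      ⟨fun h => htrans h (hsymm hstep), fun h => htrans h hstep⟩
    have hbE : b ∈ E := hrefl
    have hb'E : b' ∉ E := hne
    have hfeet : ∀ a ∈ R, ∀ c, f (a, c) ∈ E → f (a, !c) ∈ E := fun a ha c h =>
      htrans h (hcross a ha c)
    have hU : E ≠ Set.univ := fun e => hb'E (e ▸ Set.mem_univ b')
    have hU' : Eᶜ ≠ Set.univ := fun e => (e ▸ Set.mem_univ b : b ∈ Eᶜ) hbE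
    refine hne ?_
    rw [oneSum_eq_zero_of_upper f z ι hinv hbE (fun a ha => hfeet a ha (o a))
      (fun h => hb'E (h (Set.mem_univ b'))), mul_zero, add_zero, mul_sub, sub_eq_zero,
      hC.twoSum_eq_of_upper hι hY hinv hbE (fun a ha => hfeet a ha (o a)) hU,
      hC.twoSum_eq_of_upper (U := Eᶜ) hι hY (fun x => not_congr (hinv x)) hb'E (fun a ha h h' => h ?_) hU']
    · exact hC.pairSum_noSeparating_base hι (fun T _ h => hY _ h) fun T _ h => hY _ h
    · have := hfeet a ha _ h'
      rwa [Bool.not_not] at this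

end TwoSumBase

/-! ### The second starting point -/

section SecondStart

variable {α X : Type*} [DecidableEq α] [Fintype X] {f : α × Bool ↪ X} {σ τ : Equiv.Perm X}
  {b y y' : X} {S T : Finset α}

/-- `y` is the other foot of the first separating arrow of the state `S`. -/
def IsSecondStartOf (f : α × Bool ↪ X) (τ : Equiv.Perm X) (S : Finset α) (b y : X) : Prop :=
  ∃ a ∈ S, ∃ c, (τ.SameCycle b (f (a, c)) ∧ ¬ τ.SameCycle b (f (a, !c))) ∧ y = f (a, !c) ∧
    ∀ a' ∈ S, ∀ c', τ.SameCycle b (f (a', c')) ∧ ¬ τ.SameCycle b (f (a', !c')) → a' ≠ a →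
      MeetsBefore τ b (f (a, c)) (f (a', c'))

theorem IsSecondStartOf.not_sameCycle (h : IsSecondStartOf f τ S b y) : ¬ τ.SameCycle b y := by
  obtain ⟨a, -, c, h, rfl, -⟩ := h
  exact h.2

/-- Two different first separating arrows would each be met before the other, and a separating arrow
separates at only one of its ends. -/
theorem IsSecondStartOf.unique (h : IsSecondStartOf f τ S b y) (h' : IsSecondStartOf f τ S b y') :
    y = y' := by
  obtain ⟨a, ha, c, h1, rfl, h2⟩ := h
  obtain ⟨a', ha', c', h1', rfl, h2'⟩ := h'
  have e : a' = a := by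
    by_contra hne
    exact (h2 a' ha' c' h1' hne).asymm (h2' a ha c h1 (Ne.symm hne))
  subst e
  rcases ends_cases c' c with rfl | rfl
  · rfl
  · exact absurd h1'.1 h1.2

open Classical in
theorem exists_isSecondStartOf {a : α} (ha : a ∈ S) {c : Bool}
    (hc : τ.SameCycle b (f (a, c)) ∧ ¬ τ.SameCycle b (f (a, !c))) :
    ∃ y, IsSecondStartOf f τ S b y := by
  have h : ∀ x, τ.SameCycle b x → ∃ n : ℕ, (τ ^ n) b = x := fun x hx =>
    Equiv.Perm.sameCycle_iff_exists_nat.1 hx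
  let t : X → ℕ := fun x => if hx : τ.SameCycle b x then Nat.find (h x hx) else 0
  have ht : ∀ x (hx : τ.SameCycle b x), t x = Nat.find (h x hx) := fun x hx => dif_pos hx
  obtain ⟨⟨a₀, c₀⟩, hm, hmin⟩ := Finset.exists_min_image
    ((S ×ˢ Finset.univ).filter fun p : α × Bool =>
      τ.SameCycle b (f p) ∧ ¬ τ.SameCycle b (f (p.1, !p.2))) (fun p => t (f p))
    ⟨(a, c), by simp [ha, hc]⟩
  simp only [Finset.mem_filter, Finset.mem_product, Finset.mem_univ, and_true] at hm hmin
  refine ⟨_, a₀, hm.1, c₀, hm.2, rfl, fun a' ha' c' hc' hne => ?_⟩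
  refine (MeetsBefore.of_sameCycle hm.2.1 (foot_ne_of_ne hne.symm _ _)).resolve_right ?_
  rintro ⟨k, hk, hlt⟩
  have h1 := hmin (a', c') ⟨ha', hc'⟩
  rw [ht _ hm.2.1, ht _ hc'.1] at h1
  exact hlt _ (h1.trans (Nat.find_min' _ hk)) (Nat.find_spec (h _ hm.2.1))

/-- Separating arrows are touched by the first passage. Hence the second starting point is a
function of the touched arrows, as `pairSum` requires. -/
theorem isSecondStartOf_touching :
    IsSecondStartOf f (σ * hop f (touching f σ b S)) (touching f σ b S) b y ↔
      IsSecondStartOf f (σ * hop f S) S b y := by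
  have hmb : ∀ p q, MeetsBefore (σ * hop f (touching f σ b S)) b p q ↔
      MeetsBefore (σ * hop f S) b p q := fun p q =>
    (MeetsBefore.congr_of_eqOn (C := {x | (σ * hop f S).SameCycle b x})
      (fun x hx => (sameCycle_inv _ b x).2 hx) mul_hop_eqOn_touching
      (Equiv.Perm.SameCycle.refl _ _)).symm
  simp only [IsSecondStartOf, sameCycle_touching_iff, hmb]
  constructor
  · rintro ⟨a, ha, c, h1, h2, h3⟩
    exact ⟨a, touching_subset ha, c, h1, h2, fun a' ha' c' h => h3 a'
      (mem_touching.2 ⟨ha', c', h.1⟩) c' h⟩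
  · rintro ⟨a, ha, c, h1, h2, h3⟩
    exact ⟨a, mem_touching.2 ⟨ha, c, h1.1⟩, c, h1, h2, fun a' ha' => h3 a' (touching_subset ha')⟩

theorem exists_isSecondStartOf_of_not (hT : touching f σ b T = T) (h : ¬ NoSeparating f σ b T) :
    ∃ y, IsSecondStartOf f (σ * hop f T) T b y := by
  unfold NoSeparating at h
  push Not at h
  obtain ⟨a, ha, c, hc⟩ := h
  have ha' := ha
  rw [← hT] at ha'
  obtain ⟨-, d, hd⟩ := mem_touching.1 ha'
  have e : c = !d := by
    rcases ends_cases c d with rfl | rfl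
    · exact absurd hd hc
    · rfl
  subst e
  exact exists_isSecondStartOf ha ⟨hd, hc⟩

theorem IsSecondStartOf.not_noSeparating (h : IsSecondStartOf f (σ * hop f T) T b y) :
    ¬ NoSeparating f σ b T := by
  obtain ⟨a, ha, c, h1, -⟩ := h
  exact fun hN => h1.2 (hN a ha _)

end SecondStart

/-! ### State sums of Gauss diagrams -/

namespace GaussDiagram

variable {α X : Type*} [Fintype α] [Fintype X] [DecidableEq α] [DecidableEq X]
  (G : GaussDiagram α X) {b y : X} {S : Finset α} {c : Bool} {n m : ℕ}

/-- The feet of the arrows -/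
def feet : α × Bool ↪ X := ⟨G.foot, G.foot_injective⟩

theorem trace_restrict (S : Finset α) : (G.restrict S).trace = G.next * _root_.hop G.feet S := by
  have : (G.restrict S).hop = _root_.hop G.feet S := by
    ext x
    rcases exists_foot_or G.feet S x with ⟨a, ha, c, rfl⟩ | h
    · rw [hop_foot _ ha]
      exact Equiv.Perm.viaFintypeEmbedding_apply_image _
        ⟨(G.restrict S).foot, (G.restrict S).foot_injective⟩ ((⟨a, ha⟩ : {a // a ∈ S}), c)
    · rw [hop_of_forall_ne _ h]
      refine Equiv.Perm.viaFintypeEmbedding_apply_notMem_range _ _ ?_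
      rintro ⟨⟨⟨a, ha⟩, c⟩, rfl⟩
      exact h a ha c rfl
  rw [ArrowDiagram.trace, this]
  rfl

theorem isSecondStart_restrict : (G.restrict S).IsSecondStart b y ↔
    IsSecondStartOf G.feet (G.next * _root_.hop G.feet S) S b y := by
  simp only [ArrowDiagram.IsSecondStart, ArrowDiagram.SeparatesAt, trace_restrict, IsSecondStartOf]
  constructor
  · rintro ⟨⟨a, ha⟩, c, h1, h2, h3⟩
    exact ⟨a, ha, c, h1, h2, fun a' ha' c' h hne => h3 ⟨a', ha'⟩ c' h fun e => hne
      (congrArg Subtype.val e)⟩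
  · rintro ⟨a, ha, c, h1, h2, h3⟩
    exact ⟨⟨a, ha⟩, c, h1, h2, fun a' c' h hne => h3 a'.1 a'.2 c' h fun e => hne (Subtype.ext e)⟩

theorem firstApproachedAt_restrict : (∀ a, (G.restrict S).FirstApproachedAt b y c a) ↔
    ∀ a ∈ S, MeetsBeforeTwo (G.next * _root_.hop G.feet S) b y (G.feet (a, c)) (G.feet (a, !c)) := by
  simp only [ArrowDiagram.FirstApproachedAt, trace_restrict, Subtype.forall]
  rfl

theorem numCycles_eq_two_iff {τ : Equiv.Perm X} (h : ¬ τ.SameCycle b y) :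
    numCycles τ = 2 ↔ IsCyclePair τ b y := by
  have hne : (Quotient.mk (Equiv.Perm.SameCycle.setoid τ) b) ≠ Quotient.mk _ y := fun e =>
    h (Quotient.exact e)
  rw [numCycles, Nat.card_eq_two_iff' (Quotient.mk _ b)]
  constructor
  · rintro ⟨q, -, hq⟩
    refine ⟨h, fun x => ?_⟩
    by_contra hx
    push Not at hx
    have h1 := hq (Quotient.mk _ x) fun e => hx.1 (Quotient.exact e).symm
    have h2 := hq (Quotient.mk _ y) hne.symm
    exact hx.2 (Quotient.exact (h2.trans h1.symm))
  · intro hp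
    refine ⟨Quotient.mk _ y, hne.symm, fun q => Quotient.inductionOn q fun x hx => ?_⟩
    refine Quotient.sound ((hp.2 x).resolve_left fun h => hx (Quotient.sound h.symm)).symm

/-- Connectedness is automatic: each boundary component stays in one connected part, and the
separating arrow joins the two components. -/
theorem connected_restrict
    (h : IsSecondStartOf G.feet (G.next * _root_.hop G.feet S) S b y)
    (hp : IsCyclePair (G.next * _root_.hop G.feet S) b y) : (G.restrict S).Connected := by
  set H := Subgroup.closure ({(G.restrict S).next, (G.restrict S).hop} : Set (Equiv.Perm X))
  have h1 : (G.restrict S).next ∈ H := Subgroup.subset_closure (by simp)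
  have h2 : (G.restrict S).hop ∈ H := Subgroup.subset_closure (by simp)
  have h3 : G.next * _root_.hop G.feet S ∈ H := by
    rw [← trace_restrict]
    exact H.mul_mem h1 h2
  have h4 : _root_.hop G.feet S ∈ H := by
    have := H.mul_mem (H.inv_mem h1) h3
    rwa [show (G.restrict S).next = G.next from rfl, inv_mul_cancel_left] at this
  have hsc : ∀ x x', (G.next * _root_.hop G.feet S).SameCycle x x' → ∃ g ∈ H, g x = x' := by
    rintro x x' ⟨i, rfl⟩
    exact ⟨_, H.zpow_mem h3 i, rfl⟩
  have hb : ∀ x, ∃ g ∈ H, g b = x := by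
    obtain ⟨a, ha, c, hsep, rfl, -⟩ := h
    intro x
    rcases hp.2 x with hx | hx
    · exact hsc b x hx
    · obtain ⟨g, hg, e⟩ := hsc _ _ hsep.1
      obtain ⟨g', hg', rfl⟩ := hsc _ _ hx
      refine ⟨g' * _root_.hop G.feet S * g, H.mul_mem (H.mul_mem hg' h4) hg, ?_⟩
      rw [Equiv.Perm.mul_apply, Equiv.Perm.mul_apply, e, hop_foot _ ha]
  refine ⟨fun x x' => ?_⟩
  obtain ⟨g, hg, rfl⟩ := hb x
  obtain ⟨g', hg', rfl⟩ := hb x'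
  refine ⟨⟨g' * g⁻¹, H.mul_mem hg' (H.inv_mem hg)⟩, ?_⟩
  change (g' * g⁻¹) (g b) = g' b
  simp

theorem isMonotoneTwo_restrict (hm : numCycles G.next = m) :
    (G.restrict S).IsMonotoneTwo b c n m ↔ S.card = n ∧
      ∃ y, IsSecondStartOf G.feet (G.next * _root_.hop G.feet S) S b y ∧
        IsCyclePair (G.next * _root_.hop G.feet S) b y ∧
        ∀ a ∈ S, MeetsBeforeTwo (G.next * _root_.hop G.feet S) b y (G.feet (a, c))
          (G.feet (a, !c)) := by
  constructor
  · rintro ⟨h1, -, -, h4, y, h5, h6⟩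
    rw [isSecondStart_restrict] at h5
    rw [firstApproachedAt_restrict] at h6
    rw [trace_restrict, numCycles_eq_two_iff h5.not_sameCycle] at h4
    exact ⟨by simpa using h1, y, h5, h4, h6⟩
  · rintro ⟨h1, y, h5, h4, h6⟩
    refine ⟨by simpa using h1, hm, G.connected_restrict h5 h4, ?_, y, G.isSecondStart_restrict.2 h5,
      G.firstApproachedAt_restrict.2 h6⟩
    rw [trace_restrict, numCycles_eq_two_iff h5.not_sameCycle]
    exact h4

open Polynomial

open Classical in
-- The polynomial variable counts arrows, so the states with `n` arrows are read off from the
-- coefficient. The existence of a second starting point in the definition corresponds to excluding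
-- states without separating arrows.
theorem exists_pairSum_eq (hm : numCycles G.next = m) (b : X) (c : Bool) (ι : α → ℤ)
    (hι : ∀ a, arrowSign ι (fun _ => c) a = G.sign a) :
    ∃ y : Finset α → X, (∀ T, touching G.feet G.next b T = T → ¬ NoSeparating G.feet G.next b T →
      ¬ (G.next * _root_.hop G.feet T).SameCycle b (y T)) ∧
      ∀ n, ∑ S : Finset α with (G.restrict S).IsMonotoneTwo b c n m, ∏ a ∈ S, (G.sign a : ℤ) =
        (pairSum G.feet (Polynomial.X : ℤ[X]) ι G.next b
          (fun T => ¬ NoSeparating G.feet G.next b T) y Finset.univ fun _ => c).coeff n := by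
  -- The default `b` is harmless: a touched set with a separating arrow has a genuine second
  -- starting point, and the others are excluded.
  let y : Finset α → X := fun T =>
    if h : ∃ y, IsSecondStartOf G.feet (G.next * _root_.hop G.feet T) T b y then h.choose else b
  have hy : ∀ T, (∃ y, IsSecondStartOf G.feet (G.next * _root_.hop G.feet T) T b y) →
      IsSecondStartOf G.feet (G.next * _root_.hop G.feet T) T b (y T) := fun T h => by
    simp only [y, h, dite_true]
    exact h.choose_spec
  refine ⟨y, fun T hT hN => (hy T (exists_isSecondStartOf_of_not hT hN)).not_sameCycle,
    fun n => ?_⟩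
  rw [pairSum, Polynomial.finsetSum_coeff, Finset.sum_filter, Finset.powerset_univ]
  refine Finset.sum_congr rfl fun S _ => ?_
  have hw : ∏ a ∈ S, arrowWeight (Polynomial.X : ℤ[X]) ι (fun _ => c) a =
      C (∏ a ∈ S, (G.sign a : ℤ)) * Polynomial.X ^ S.card := by
    simp only [arrowWeight, hι, Finset.prod_mul_distrib, Finset.prod_const, map_prod, eq_intCast]
    rw [mul_comm]
  rw [apply_ite (fun p : ℤ[X] => p.coeff n), hw, coeff_C_mul_X_pow, coeff_zero, ← ite_and]
  refine ite_eq_ite_of_iff ?_ _ _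
  rw [G.isMonotoneTwo_restrict hm]
  set T := touching G.feet G.next b S
  have hT : touching G.feet G.next b T = T := touching_touching
  constructor
  · rintro ⟨h1, y', h2, h3, h4⟩
    have h5 := isSecondStartOf_touching.2 h2
    have e : y T = y' := (hy T ⟨y', h5⟩).unique h5
    exact ⟨⟨h5.not_noSeparating, by rwa [e], by rwa [e]⟩, h1.symm⟩
  · rintro ⟨⟨h1, h2, h3⟩, h4⟩
    exact ⟨h4.symm, y T, isSecondStartOf_touching.1 (hy T (exists_isSecondStartOf_of_not hT h1)),
      h2, h3⟩

theorem coe_units_eq_or (s : ℤˣ) : (s : ℤ) = 1 ∨ (s : ℤ) = -1 := by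
  rcases Int.units_eq_one_or s with h | h <;> simp [h]

/-- If the Gauss diagram is planar, then the sum of the two invariants does not depend on the base
point. -/
theorem AD_eq (hC : IsPlanar G.feet (fun a => (G.sign a : ℤ)) G.next Set.univ Finset.univ)
    (hm : numCycles G.next = m) (b b' : X) : G.AD b n m = G.AD b' n m := by
  set ι : α → ℤ := fun a => (G.sign a : ℤ) with hιdef
  have hι : ∀ a, ι a = 1 ∨ ι a = -1 := fun a => coe_units_eq_or _
  have hι' : ∀ a, (-ι) a = 1 ∨ (-ι) a = -1 := fun a => by
    rcases hι a with h | h <;> simp [h]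
  -- Ascending states use `ι` with the heads, descending ones `-ι` with the tails; in both cases the
  -- arrow sign is the sign in the Gauss diagram.
  have hs : ∀ a, arrowSign ι (fun _ => true) a = G.sign a := fun a => by simp [arrowSign, ι]
  have hs' : ∀ a, arrowSign (-ι) (fun _ => false) a = G.sign a := fun a => by simp [arrowSign, ι]
  -- The unit flow is the link diagram itself.
  obtain ⟨W, hW⟩ := hC.winding (fun _ => 1)
    ⟨fun x hx => absurd (Set.mem_univ x) hx, fun _ _ => rfl, fun _ _ _ => rfl⟩
  have hW' : IsWinding G.feet (-ι) G.next Set.univ Finset.univ (fun _ => 1) (-W) := hW.neg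
  obtain ⟨Y, hY, -⟩ := exists_chooser b fun _ => b
  have key : ∀ (ι : α → ℤ) (c : Bool) (W : X → ℤ), IsPlanar G.feet ι G.next Set.univ Finset.univ →
      (∀ a, ι a = 1 ∨ ι a = -1) →
      IsWinding G.feet ι G.next Set.univ Finset.univ (fun _ => 1) W → ∀ y y' : Finset α → X,
      (∀ T, touching G.feet G.next b T = T → ¬ NoSeparating G.feet G.next b T →
        ¬ (G.next * _root_.hop G.feet T).SameCycle b (y T)) →
      (∀ T, touching G.feet G.next b' T = T → ¬ NoSeparating G.feet G.next b' T →
        ¬ (G.next * _root_.hop G.feet T).SameCycle b' (y' T)) →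
      2 * (pairSum G.feet (Polynomial.X : ℤ[X]) ι G.next b
          (fun T => ¬ NoSeparating G.feet G.next b T) y Finset.univ (fun _ => c) -
        pairSum G.feet (Polynomial.X : ℤ[X]) ι G.next b'
          (fun T => ¬ NoSeparating G.feet G.next b' T) y' Finset.univ fun _ => c) +
        Polynomial.X * ((W b - W b' : ℤ) : ℤ[X]) *
          oneSum G.feet (Polynomial.X : ℤ[X]) ι Set.univ b G.next Finset.univ (fun _ => c) = 0 := by
    intro ι c W hC hι hW y y' hy hy'
    have h1 := hC.twoSum_base (z := (Polynomial.X : ℤ[X])) (b := b) (b' := b') (o := fun _ => c)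
      hι hY hW
    rw [twoSum_eq_pairSum, twoSum_eq_pairSum, ← pairSum_add (NoSeparating G.feet G.next b),
      ← pairSum_add (NoSeparating G.feet G.next b')] at h1
    have h2 := hC.pairSum_noSeparating_base (z := (Polynomial.X : ℤ[X])) (b := b) (b' := b')
      (o := fun _ => c) hι (fun T _ h => hY _ h) fun T _ h => hY _ h
    rw [hC.pairSum_congr hι (y := y) (y' := fun T => Y {x | (G.next * _root_.hop G.feet T).SameCycle b x})
      fun T _ h3 h4 h5 => ⟨hy T h3 h4, hY _ h5⟩,
      hC.pairSum_congr hι (y := y') (y' := fun T => Y {x | (G.next * _root_.hop G.feet T).SameCycle b' x})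
      fun T _ h3 h4 h5 => ⟨hy' T h3 h4, hY _ h5⟩]
    linear_combination h1 - h2
  obtain ⟨y₁, hy₁, e₁⟩ := G.exists_pairSum_eq hm b true ι hs
  obtain ⟨y₂, hy₂, e₂⟩ := G.exists_pairSum_eq hm b' true ι hs
  obtain ⟨y₃, hy₃, e₃⟩ := G.exists_pairSum_eq hm b false (-ι) hs'
  obtain ⟨y₄, hy₄, e₄⟩ := G.exists_pairSum_eq hm b' false (-ι) hs'
  have k₁ := key ι true W hC hι hW y₁ y₂ hy₁ hy₂
  have k₂ := key (-ι) false (-W) hC.neg hι' hW' y₃ y₄ hy₃ hy₄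
  -- Now both relations contain the same `oneSum`, with opposite winding coefficients, and adding
  -- them eliminates it.
  rw [hC.oneSum_neg_not hι (Set.mem_univ b)] at k₁
  simp only [Bool.not_true, Pi.neg_apply] at k₁ k₂
  have k₃ : ∀ p₁ p₂ p₃ p₄ w : ℤ[X],
      2 * (p₁ - p₂) + Polynomial.X * ((W b - W b' : ℤ) : ℤ[X]) * w = 0 →
      2 * (p₃ - p₄) + Polynomial.X * ((-W b - -W b' : ℤ) : ℤ[X]) * w = 0 → p₁ + p₃ = p₂ + p₄ := by
    intro p₁ p₂ p₃ p₄ w h₁ h₂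
    refine mul_left_cancel₀ (two_ne_zero (α := ℤ[X])) ?_
    push_cast at h₁ h₂
    linear_combination h₁ + h₂
  have h := congrArg (fun p : ℤ[X] => p.coeff n) (k₃ _ _ _ _ _ k₁ k₂)
  simp only [Polynomial.coeff_add, ← e₁, ← e₂, ← e₃, ← e₄] at h
  exact h

end GaussDiagram

/-! ### Winding numbers of flows on plane straight line graphs -/

section Plane

open Complex Filter Topology

/-- The limit of the angle of view of the segment from `P` to `Q` from a point that approaches `N`
from the direction of `w`. -/
noncomputable def angleAt (P Q N w : ℂ) : ℝ :=
  open Classical in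
  if P = N then arg ((Q - N) / (-w)) else if Q = N then arg (-w / (P - N))
  else arg ((Q - N) / (P - N))

/-- A quotient off the slit plane is a nonpositive real number, which means that `r` lies between
`P` and `Q`. Off the segment the angle of view is thus continuous. -/
theorem div_mem_slitPlane {P Q r : ℂ} (h : r ∉ segment ℝ P Q) : (Q - r) / (P - r) ∈ slitPlane := by
  by_contra hs
  rw [mem_slitPlane_iff, not_or, not_lt, not_not] at hs
  have hP : P - r ≠ 0 := fun e => h (by rw [← sub_eq_zero.1 e]; exact left_mem_segment ℝ _ _)
  set k : ℝ := -((Q - r) / (P - r)).re with hk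
  have hk0 : 0 ≤ k := by linarith [hs.1]
  have e : (Q - r) / (P - r) = ((-k : ℝ) : ℂ) := by
    apply Complex.ext
    · simp [hk]
    · simp [hs.2]
  rw [div_eq_iff hP] at e
  refine h ⟨k / (1 + k), 1 / (1 + k), by positivity, by positivity, by field_simp; ring, ?_⟩
  have hk1 : ((1 + k : ℝ) : ℂ) ≠ 0 := by
    rw [Ne, Complex.ofReal_eq_zero]; positivity
  rw [real_smul, real_smul]
  push_cast at hk1 e ⊢
  field_simp
  linear_combination e

/-- If the quotient is off the slit plane, the ray from `N` in direction `w` runs along the segment.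
-/
theorem segment_ray_mem {Q N w : ℂ} (hw : w ≠ 0) (hQ : Q ≠ N)
    (h : (Q - N) / (-w) ∉ slitPlane) : ∃ ε ∈ Set.Ioo (0 : ℝ) 1, N + ε * w ∈ segment ℝ N Q := by
  rw [mem_slitPlane_iff, not_or, not_lt, not_not] at h
  set k : ℝ := -((Q - N) / (-w)).re with hk
  have e : (Q - N) / (-w) = ((-k : ℝ) : ℂ) := by
    apply Complex.ext
    · simp [hk]
    · simp [h.2]
  rw [div_eq_iff (neg_ne_zero.2 hw)] at e
  have hk0 : 0 < k := by
    refine lt_of_le_of_ne (by linarith [h.1]) fun e0 => hQ ?_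
    rw [← e0] at e
    simpa [sub_eq_zero] using e
  refine ⟨min (1 / 2) k, ⟨by positivity, (min_le_left _ _).trans_lt (by norm_num)⟩, ?_⟩
  set ε := min (1 / 2) k
  have hε : ε ≤ k := min_le_right _ _
  have hε0 : 0 < ε := by positivity
  refine ⟨1 - ε / k, ε / k, by rw [sub_nonneg, div_le_one hk0]; exact hε, by positivity, by ring, ?_⟩
  have hk1 : (k : ℂ) ≠ 0 := by exact_mod_cast hk0.ne'
  rw [real_smul, real_smul]
  push_cast at e ⊢
  field_simp
  linear_combination ε * e

/-- For a segment with an end at `N`, one of the two vectors is a positive multiple of `-w`; the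
factor does not affect the argument and disappears in the limit. The hypotheses keep the limiting
quotient in the slit plane, where `arg` is continuous. -/
theorem tendsto_angle {P Q N w : ℂ} (hw : w ≠ 0) (hPQ : P ≠ Q)
    (h1 : ∀ ε ∈ Set.Ioo (0 : ℝ) 1, N + ε * w ∉ segment ℝ P Q)
    (h2 : P ≠ N → Q ≠ N → N ∉ segment ℝ P Q) :
    Tendsto (fun ε : ℝ => arg ((Q - (N + ε * w)) / (P - (N + ε * w)))) (𝓝[>] 0)
      (𝓝 (angleAt P Q N w)) := by
  have hpos : ∀ᶠ ε : ℝ in 𝓝[>] 0, 0 < ε := self_mem_nhdsWithin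
  unfold angleAt
  split_ifs with hP hQ
  · subst hP
    have hs : (Q - P) / (-w) ∈ slitPlane := by
      by_contra hs
      obtain ⟨ε, hε, hm⟩ := segment_ray_mem hw hPQ.symm hs
      exact h1 ε hε hm
    have hc : Tendsto (fun ε : ℝ => arg ((Q - (P + ε * w)) / (-w))) (𝓝[>] 0)
        (𝓝 (arg ((Q - P) / (-w)))) := by
      refine (Complex.continuousAt_arg hs).tendsto.comp ?_
      refine tendsto_nhdsWithin_of_tendsto_nhds ?_
      have : Continuous fun ε : ℝ => (Q - (P + ε * w)) / (-w) := by fun_prop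
      have := this.tendsto 0
      simpa using this
    refine hc.congr' ?_
    filter_upwards [hpos] with ε hε
    have hε' : (ε : ℂ) ≠ 0 := by exact_mod_cast hε.ne'
    rw [← arg_real_mul _ (inv_pos.2 hε)]
    congr 1
    push_cast
    rw [sub_add_cancel_left]
    field_simp
  · subst hQ
    have hs : -w / (P - Q) ∈ slitPlane := by
      by_contra hs
      have hs' : (P - Q) / (-w) ∉ slitPlane := by
        rw [← inv_div]
        rw [mem_slitPlane_iff, not_or, not_lt, not_not] at hs ⊢
        rw [inv_re, inv_im]
        refine ⟨div_nonpos_of_nonpos_of_nonneg hs.1 (normSq_nonneg _), ?_⟩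
        rw [hs.2]; simp
      obtain ⟨ε, hε, hm⟩ := segment_ray_mem hw hP hs'
      rw [segment_symm] at hm
      exact h1 ε hε hm
    have hc : Tendsto (fun ε : ℝ => arg (-w / (P - (Q + ε * w)))) (𝓝[>] 0)
        (𝓝 (arg (-w / (P - Q)))) := by
      refine (Complex.continuousAt_arg hs).tendsto.comp ?_
      refine tendsto_nhdsWithin_of_tendsto_nhds ?_
      have : ContinuousAt (fun ε : ℝ => -w / (P - (Q + ε * w))) 0 := by
        refine ContinuousAt.div (by fun_prop) (by fun_prop) ?_
        simpa [sub_eq_zero] using hP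
      have := this.tendsto
      simpa using this
    refine hc.congr' ?_
    filter_upwards [hpos] with ε hε
    rw [← arg_real_mul _ hε]
    congr 1
    rw [sub_add_cancel_left]
    ring
  · have hs := div_mem_slitPlane (h2 hP hQ)
    refine (Complex.continuousAt_arg hs).tendsto.comp ?_
    refine tendsto_nhdsWithin_of_tendsto_nhds ?_
    have : ContinuousAt (fun ε : ℝ => (Q - (N + ε * w)) / (P - (N + ε * w))) 0 := by
      refine ContinuousAt.div (by fun_prop) (by fun_prop) ?_
      simpa [sub_eq_zero] using hP
    have := this.tendsto
    simpa using this

/-- A flow on a plane straight line graph has winding numbers around the points of an edge. -/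
theorem exists_winding {S : Type*} [Fintype S] [DecidableEq S] {P Q : S → ℂ} (hPQ : ∀ s, P s ≠ Q s)
    (h1 : ∀ h s, s ≠ h → ∀ t ∈ Set.Ioo (0 : ℝ) 1, P h + t * (Q h - P h) ∉ segment ℝ (P s) (Q s))
    (h2 : ∀ h s, P s ≠ P h → Q s ≠ P h → P h ∉ segment ℝ (P s) (Q s))
    (h3 : ∀ h s, P s ≠ Q h → Q s ≠ Q h → Q h ∉ segment ℝ (P s) (Q s)) {u : S → ℤ}
    (hu : ∀ A : ℂ → Real.Angle, ∑ s, u s • (A (Q s) - A (P s)) = 0) (h : S) :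
    ∃ k : ℤ, (k * Real.pi = ∑ s with s ≠ h, u s * angleAt (P s) (Q s) (P h) (Q h - P h)) ∧
      k * Real.pi = ∑ s with s ≠ h, u s * angleAt (P s) (Q s) (Q h) (P h - Q h) := by
  -- The total angle under which the flow on the other edges is seen from a point of `h`. Divided by
  -- `π` it is the sum of the winding numbers on the two sides of `h`, since `h` itself would add or
  -- subtract `π` times its flow.
  let g : ℝ → ℝ := fun t => ∑ s with s ≠ h,
    u s * arg ((Q s - (P h + t * (Q h - P h))) / (P s - (P h + t * (Q h - P h))))
  have hcont : ContinuousOn g (Set.Ioo 0 1) := by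
    refine continuousOn_finsetSum _ fun s hs => ?_
    intro t ht
    have hseg := h1 h s (by simpa using hs) t ht
    refine ContinuousAt.continuousWithinAt (ContinuousAt.mul continuousAt_const ?_)
    refine ContinuousAt.comp (g := arg)
      (f := fun t : ℝ => (Q s - (P h + t * (Q h - P h))) / (P s - (P h + t * (Q h - P h))))
      (Complex.continuousAt_arg (div_mem_slitPlane hseg)) ?_
    refine ContinuousAt.div (by fun_prop) (by fun_prop) ?_
    intro e
    refine hseg ?_
    rw [← sub_eq_zero.1 e]
    exact left_mem_segment ℝ _ _
  -- Modulo full turns all edges together contribute zero by conservation of the flow, and `h`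
  -- contributes `u h` half turns.
  have hint : ∀ t ∈ Set.Ioo (0 : ℝ) 1, g t ∈ (AddSubgroup.zmultiples Real.pi : Set ℝ) := by
    intro t ht
    set r : ℂ := P h + t * (Q h - P h) with hr
    let A : ℂ → Real.Angle := fun w => ((arg (w - r) : ℝ) : Real.Angle)
    have hA : ∀ s, s ≠ h → ((arg ((Q s - r) / (P s - r)) : ℝ) : Real.Angle) = A (Q s) - A (P s) := by
      intro s hs
      have hseg := h1 h s hs t ht
      rw [arg_div_coe_angle]
      · exact fun e => hseg (by rw [← hr, ← sub_eq_zero.1 e]; exact right_mem_segment ℝ _ _)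
      · exact fun e => hseg (by rw [← hr, ← sub_eq_zero.1 e]; exact left_mem_segment ℝ _ _)
    have hd : Q h - P h ≠ 0 := sub_ne_zero.2 (hPQ h).symm
    have hh : A (Q h) - A (P h) = (Real.pi : Real.Angle) := by
      have ht1 : (1 - t : ℝ) ≠ 0 := by linarith [ht.2]
      have e1 : Q h - r = ((1 - t : ℝ) : ℂ) * (Q h - P h) := by rw [hr]; push_cast; ring
      have e2 : P h - r = ((-t : ℝ) : ℂ) * (Q h - P h) := by rw [hr]; push_cast; ring
      have n1 : Q h - r ≠ 0 := by
        rw [e1]; exact mul_ne_zero (by exact_mod_cast ht1) hd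
      have n2 : P h - r ≠ 0 := by
        rw [e2]; exact mul_ne_zero (by exact_mod_cast (neg_ne_zero.2 ht.1.ne')) hd
      simp only [A]
      rw [← arg_div_coe_angle n1 n2, e1, e2, mul_div_mul_right _ _ hd, ← ofReal_div,
        arg_ofReal_of_neg]
      exact div_neg_of_pos_of_neg (by linarith [ht.2]) (by linarith [ht.1])
    have hsum := hu A
    rw [← Finset.sum_filter_add_sum_filter_not Finset.univ (fun s => s ≠ h)] at hsum
    simp only [ne_eq, not_not, Finset.filter_eq', Finset.mem_univ, if_true,
      Finset.sum_singleton, hh] at hsum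
    have hg : ((g t : ℝ) : Real.Angle) = ∑ s with s ≠ h, u s • (A (Q s) - A (P s)) := by
      change Real.Angle.coeHom (g t) = _
      simp only [g, map_sum]
      refine Finset.sum_congr rfl fun s hs => ?_
      rw [← hA s (by simpa using hs)]
      exact Real.Angle.intCast_mul_eq_zsmul _ _
    have h2g : ((2 * g t : ℝ) : Real.Angle) = 0 := by
      have e : ((g t : ℝ) : Real.Angle) = -(u h • (Real.pi : Real.Angle)) := by
        rw [hg]; exact eq_neg_of_add_eq_zero_left hsum
      rw [two_mul, Real.Angle.coe_add, e, ← neg_add, ← smul_add, ← Real.Angle.coe_add, ← two_mul,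
        Real.Angle.coe_two_pi, smul_zero, neg_zero]
    obtain ⟨n, hn⟩ := Real.Angle.coe_eq_zero_iff.1 h2g
    refine AddSubgroup.mem_zmultiples_iff.2 ⟨n, ?_⟩
    simp only [zsmul_eq_mul] at hn ⊢
    linarith
  -- A continuous function on an interval with values in a discrete group is constant, so the limits
  -- at both ends of `h` give the same integer.
  have hdisc : IsDiscrete (AddSubgroup.zmultiples Real.pi : Set ℝ) :=
    ⟨NormedSpace.discreteTopology_zmultiples Real.pi⟩
  have hconst : ∀ t ∈ Set.Ioo (0 : ℝ) 1, g t = g (1 / 2) := fun t ht =>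
    isPreconnected_Ioo.constant_of_mapsTo hdisc hcont hint ht ⟨by norm_num, by norm_num⟩
  obtain ⟨k, hk⟩ := AddSubgroup.mem_zmultiples_iff.1 (hint (1 / 2) ⟨by norm_num, by norm_num⟩)
  have hIoo : ∀ᶠ ε : ℝ in 𝓝[>] 0, ε ∈ Set.Ioo (0 : ℝ) 1 := Ioo_mem_nhdsGT one_pos
  have hk' : k * Real.pi = g (1 / 2) := by rw [← hk]; simp
  refine ⟨k, ?_, ?_⟩
  · have hlim : Tendsto g (𝓝[>] 0)
        (𝓝 (∑ s with s ≠ h, u s * angleAt (P s) (Q s) (P h) (Q h - P h))) := by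
      refine tendsto_finsetSum _ fun s hs => Tendsto.const_mul _ ?_
      exact tendsto_angle (sub_ne_zero.2 (hPQ h).symm) (hPQ s) (h1 h s (by simpa using hs)) (h2 h s)
    refine tendsto_nhds_unique (tendsto_const_nhds.congr' ?_) hlim
    filter_upwards [hIoo] with t ht
    rw [hconst t ht, hk']
  · have hlim : Tendsto (fun ε => g (1 - ε)) (𝓝[>] 0)
        (𝓝 (∑ s with s ≠ h, u s * angleAt (P s) (Q s) (Q h) (P h - Q h))) := by
      have e : ∀ ε : ℝ, P h + ((1 - ε : ℝ) : ℂ) * (Q h - P h) = Q h + ε * (P h - Q h) := fun ε => by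
        push_cast; ring
      simp only [g, e]
      refine tendsto_finsetSum _ fun s hs => Tendsto.const_mul _ ?_
      refine tendsto_angle (sub_ne_zero.2 (hPQ h)) (hPQ s) (fun ε hε => ?_) (h3 h s)
      rw [← e]
      exact h1 h s (by simpa using hs) _ ⟨by linarith [hε.2], by linarith [hε.1]⟩
    refine tendsto_nhds_unique (tendsto_const_nhds.congr' ?_) hlim
    filter_upwards [hIoo] with t ht
    rw [hconst (1 - t) ⟨by linarith [ht.2], by linarith [ht.1]⟩, hk']

end Plane

/-! ### The Gauss diagram of a link diagram is planar -/

namespace LinkDiagram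

open Complex

variable {α X : Type*} (D : LinkDiagram α X)

/-- A vertex as a complex number. -/
def pt (x : X) : ℂ := ⟨(D.vertex x).1, (D.vertex x).2⟩

/-- The direction of an edge. -/
def dir (x : X) : ℂ := D.pt (D.next x) - D.pt x

/-- A point on an edge. -/
def point (x : X) (s : ℝ) : ℂ := D.pt x + s * D.dir x

theorem lineMap_eq_iff (x y : X) (s t : ℝ) :
    AffineMap.lineMap (D.vertex x) (D.vertex (D.next x)) s =
      (AffineMap.lineMap (D.vertex y) (D.vertex (D.next y)) t : ℝ × ℝ) ↔
      D.point x s = D.point y t := by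
  simp only [AffineMap.lineMap_apply, vsub_eq_sub, vadd_eq_add, Prod.ext_iff, Prod.fst_add,
    Prod.snd_add, Prod.smul_fst, Prod.smul_snd, Prod.fst_sub, Prod.snd_sub, smul_eq_mul, point, dir,
    pt, Complex.ext_iff, add_re, add_im, re_ofReal_mul, im_ofReal_mul, sub_re, sub_im]
  constructor <;> rintro ⟨h1, h2⟩ <;> constructor <;> linarith

theorem point_one (x : X) : D.point x 1 = D.pt (D.next x) := by simp [point, dir]

theorem point_zero (x : X) : D.point x 0 = D.pt x := by simp [point]

theorem edge_ne (a : α) (c : Bool) : D.edge (a, c) ≠ D.edge (a, !c) := fun e => by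
  have := congrArg Prod.snd (D.edge_injective e)
  cases c <;> simp at this

theorem dir_ne_zero (x : X) : D.dir x ≠ 0 := by
  intro h
  have e : D.point x 0 = D.point x (1 / 2) := by simp [point, h]
  rcases D.simple x x 0 ⟨le_rfl, one_pos⟩ (1 / 2) ⟨by norm_num, by norm_num⟩
    ((D.lineMap_eq_iff x x _ _).2 e) with ⟨-, h⟩ | ⟨a, c, h1, h2⟩
  · norm_num at h
  · exact D.edge_ne a c (h1.symm.trans h2)

theorem planeDet_eq (x y : X) :
    planeDet (D.vertex (D.next x) - D.vertex x) (D.vertex (D.next y) - D.vertex y) =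
      (D.dir y / D.dir x).im * normSq (D.dir x) := by
  have h : normSq (D.dir x) ≠ 0 := by simpa using D.dir_ne_zero x
  rw [div_im, ← sub_div, div_mul_cancel₀ _ h]
  simp only [planeDet, dir, pt, sub_re, sub_im, Prod.fst_sub, Prod.snd_sub]
  ring

theorem im_div_dir_ne_zero (a : α) :
    (D.dir (D.edge (a, true)) / D.dir (D.edge (a, false))).im ≠ 0 := by
  have h := D.transverse a
  rw [planeDet_eq] at h
  exact left_ne_zero_of_mul h

theorem sign_eq (a : α) : ((D.gaussDiagram.sign a : ℤˣ) : ℤ) =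
    if 0 < (D.dir (D.edge (a, true)) / D.dir (D.edge (a, false))).im then 1 else -1 := by
  classical
  have h : 0 < normSq (D.dir (D.edge (a, false))) := normSq_pos.2 (D.dir_ne_zero _)
  simp only [gaussDiagram, planeDet_eq, mul_pos_iff_of_pos_right h]
  split_ifs <;> rfl

/-- Parameters of the crossings on the edges, and of some points on the other edges -/
structure IsParam (τ : X → ℝ) : Prop where
  mem : ∀ x, τ x ∈ Set.Ioo (0 : ℝ) 1
  eq : ∀ a, D.point (D.edge (a, false)) (τ (D.edge (a, false))) =
    D.point (D.edge (a, true)) (τ (D.edge (a, true)))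

theorem exists_isParam : ∃ τ, D.IsParam τ := by
  choose s hs t ht h using D.crossing
  refine ⟨Function.extend D.edge (fun p => if p.2 then t p.1 else s p.1) fun _ => 1 / 2,
    fun x => ?_, fun a => ?_⟩
  · by_cases hx : ∃ p, D.edge p = x
    · obtain ⟨⟨a, c⟩, rfl⟩ := hx
      rw [D.edge_injective.extend_apply]
      cases c
      · simpa using hs a
      · simpa using ht a
    · rw [Function.extend_apply' _ _ _ hx]
      norm_num
  · rw [D.edge_injective.extend_apply, D.edge_injective.extend_apply, ← lineMap_eq_iff]
    simpa using h a

variable {D} {τ : X → ℝ}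

theorem IsParam.eq_not (hτ : D.IsParam τ) (a : α) (c : Bool) :
    D.point (D.edge (a, c)) (τ (D.edge (a, c))) =
      D.point (D.edge (a, !c)) (τ (D.edge (a, !c))) := by
  cases c
  · exact hτ.eq a
  · exact (hτ.eq a).symm

/-- Lines that are not parallel meet in only one point. -/
theorem eq_of_point_eq {a : α} {c : Bool} {s s' t t' : ℝ}
    (h : D.point (D.edge (a, c)) s = D.point (D.edge (a, !c)) t)
    (h' : D.point (D.edge (a, c)) s' = D.point (D.edge (a, !c)) t') : s = s' ∧ t = t' := by
  have key : ∀ s t : ℝ, s * D.dir (D.edge (a, false)) = t * D.dir (D.edge (a, true)) →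
      s = 0 ∧ t = 0 := by
    intro s t h
    have h0 := D.dir_ne_zero (D.edge (a, false))
    have e : (s : ℂ) = t * (D.dir (D.edge (a, true)) / D.dir (D.edge (a, false))) := by
      field_simp
      exact h
    have him := congrArg Complex.im e
    rw [ofReal_im, im_ofReal_mul, eq_comm, mul_eq_zero, or_iff_left (D.im_div_dir_ne_zero a)] at him
    rw [him] at e
    exact ⟨by simpa using e, him⟩
  simp only [point] at h h'
  cases c
  · obtain ⟨e1, e2⟩ := key (s - s') (t - t') (by
      push_cast; simp only [Bool.not_false] at h h'; linear_combination h - h')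
    exact ⟨sub_eq_zero.1 e1, sub_eq_zero.1 e2⟩
  · obtain ⟨e1, e2⟩ := key (t - t') (s - s') (by
      push_cast; simp only [Bool.not_true] at h h'; linear_combination h' - h)
    exact ⟨sub_eq_zero.1 e2, sub_eq_zero.1 e1⟩

/-- Crossing edges are not parallel, so they can meet only at the chosen parameters. -/
theorem IsParam.simple (hτ : D.IsParam τ) {x y : X} {s t : ℝ} (hs : s ∈ Set.Ico (0 : ℝ) 1)
    (ht : t ∈ Set.Ico (0 : ℝ) 1) (h : D.point x s = D.point y t) :
    (x = y ∧ s = t) ∨ ∃ a c, x = D.edge (a, c) ∧ y = D.edge (a, !c) ∧ s = τ x ∧ t = τ y := by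
  rcases D.simple x y s hs t ht ((D.lineMap_eq_iff x y _ _).2 h) with h1 | ⟨a, c, rfl, rfl⟩
  · exact Or.inl h1
  · obtain ⟨e1, e2⟩ := eq_of_point_eq h (hτ.eq_not a c)
    exact Or.inr ⟨a, c, rfl, rfl, e1, e2⟩

variable (D τ)

/-- The first point of a half-edge -/
def start (s : X × Bool) : ℂ := if s.2 then D.point s.1 (τ s.1) else D.pt s.1

/-- The last point of a half-edge -/
def finish (s : X × Bool) : ℂ := if s.2 then D.pt (D.next s.1) else D.point s.1 (τ s.1)

variable {D τ}

theorem IsParam.exists_of_mem_segment (hτ : D.IsParam τ) {s : X × Bool} {r : ℂ}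
    (hr : r ∈ segment ℝ (D.start τ s) (D.finish τ s)) :
    ∃ t : ℝ, r = D.point s.1 t ∧ 0 ≤ t ∧ t ≤ 1 ∧ (s.2 = false → t ≤ τ s.1) ∧
      (s.2 = true → τ s.1 ≤ t) := by
  obtain ⟨p, q, hp, hq, hpq, rfl⟩ := hr
  obtain ⟨x, c⟩ := s
  obtain ⟨h0, h1⟩ := hτ.mem x
  obtain rfl : p = 1 - q := by linarith
  cases c
  · refine ⟨q * τ x, ?_, by positivity, by nlinarith, fun _ => by nlinarith, by simp⟩
    simp only [start, finish, point, real_smul, Bool.false_eq_true, if_false]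
    push_cast
    ring
  · refine ⟨(1 - q) * τ x + q, ?_, by positivity, by nlinarith, by simp, fun _ => by nlinarith⟩
    simp only [start, finish, ← point_one, point, real_smul, if_true]
    push_cast
    ring

theorem IsParam.exists_of_mem_Ioo (hτ : D.IsParam τ) (h : X × Bool) {t : ℝ}
    (ht : t ∈ Set.Ioo (0 : ℝ) 1) : ∃ t', D.start τ h + t * (D.finish τ h - D.start τ h) =
      D.point h.1 t' ∧ 0 < t' ∧ t' < 1 ∧ (h.2 = false → t' < τ h.1) ∧ (h.2 = true → τ h.1 < t') := by
  obtain ⟨x, c⟩ := h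
  obtain ⟨h0, h1⟩ := hτ.mem x
  obtain ⟨ht0, ht1⟩ := ht
  cases c
  · refine ⟨t * τ x, ?_, by positivity, by nlinarith, fun _ => by nlinarith, by simp⟩
    simp only [start, finish, point, Bool.false_eq_true, if_false]
    push_cast
    ring
  · refine ⟨τ x + t * (1 - τ x), ?_, by nlinarith, by nlinarith, by simp, fun _ => by nlinarith⟩
    simp only [start, finish, ← point_one, point, if_true]
    push_cast
    ring

/-- Edges are cut at their parameter points, so an interior point of a half-edge is neither a
crossing nor a vertex. -/
theorem IsParam.notMem_segment (hτ : D.IsParam τ) {h s : X × Bool} (hs : s ≠ h) {t : ℝ}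
    (ht : t ∈ Set.Ioo (0 : ℝ) 1) : D.start τ h + t * (D.finish τ h - D.start τ h) ∉
      segment ℝ (D.start τ s) (D.finish τ s) := by
  intro hm
  obtain ⟨t₁, e₁, h1, h2, h3, h4⟩ := hτ.exists_of_mem_Ioo h ht
  obtain ⟨t₂, e₂, g1, g2, g3, g4⟩ := hτ.exists_of_mem_segment hm
  rw [e₁] at e₂
  have hne : t₁ ≠ τ h.1 := by
    cases hb : h.2
    · exact (h3 hb).ne
    · exact (h4 hb).ne'
  rcases g2.eq_or_lt with rfl | g2
  · rw [point_one, ← point_zero] at e₂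
    rcases hτ.simple ⟨h1.le, h2⟩ ⟨le_rfl, one_pos⟩ e₂ with ⟨-, h⟩ | ⟨_, _, -, -, h, -⟩
    · exact h1.ne' h
    · exact hne h
  · rcases hτ.simple ⟨h1.le, h2⟩ ⟨g1, g2⟩ e₂ with ⟨hx, rfl⟩ | ⟨_, _, -, -, h, -⟩
    · obtain ⟨x, b⟩ := h
      obtain ⟨y, c⟩ := s
      simp only at hx h3 h4 g3 g4
      subst hx
      cases b <;> cases c
      · exact hs rfl
      · exact absurd (h3 rfl) (not_lt.2 (g4 rfl))
      · exact absurd (h4 rfl) (not_lt.2 (g3 rfl))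
      · exact hs rfl
    · exact hne h

/-- A half-edge contains vertices and parameter points of edges only as its ends. -/
theorem IsParam.notMem_segment_of_node (hτ : D.IsParam τ) {x : X} {t : ℝ} (ht : t = 0 ∨ t = τ x)
    {s : X × Bool} (h1 : D.start τ s ≠ D.point x t) (h2 : D.finish τ s ≠ D.point x t) :
    D.point x t ∉ segment ℝ (D.start τ s) (D.finish τ s) := by
  intro hm
  obtain ⟨t₂, e₂, g1, g2, g3, g4⟩ := hτ.exists_of_mem_segment hm
  obtain ⟨y, c⟩ := s
  have ht' : t ∈ Set.Ico (0 : ℝ) 1 := by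
    rcases ht with rfl | rfl
    · exact ⟨le_rfl, one_pos⟩
    · exact Set.Ioo_subset_Ico_self (hτ.mem x)
  have hmid : t₂ ≠ τ y := by
    rintro rfl
    cases c
    · exact h2 (by simpa [finish] using e₂.symm)
    · exact h1 (by simpa [start] using e₂.symm)
  rcases g2.eq_or_lt with rfl | g2
  · cases c
    · exact absurd (g3 rfl) (not_le.2 (hτ.mem y).2)
    · exact h2 (by rw [e₂, point_one]; simp [finish])
  · rcases hτ.simple ht' ⟨g1, g2⟩ e₂ with ⟨rfl, rfl⟩ | ⟨_, _, -, -, -, h⟩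
    · rcases ht with rfl | h
      · cases c
        · exact h1 (by rw [point_zero]; simp [start])
        · exact absurd (g4 rfl) (not_le.2 (hτ.mem x).1)
      · exact hmid h
    · exact hmid h

theorem start_eq (s : X × Bool) :
    ∃ t, (t = 0 ∨ t = τ s.1) ∧ D.start τ s = D.point s.1 t := by
  obtain ⟨x, c⟩ := s
  cases c
  · exact ⟨0, Or.inl rfl, by simp [start, point_zero]⟩
  · exact ⟨τ x, Or.inr rfl, by simp [start]⟩

theorem finish_eq (s : X × Bool) :
    ∃ x t, (t = 0 ∨ t = τ x) ∧ D.finish τ s = D.point x t := by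
  obtain ⟨x, c⟩ := s
  cases c
  · exact ⟨x, τ x, Or.inr rfl, by simp [finish]⟩
  · exact ⟨D.next x, 0, Or.inl rfl, by simp [finish, point_zero]⟩

theorem IsParam.start_ne_finish (hτ : D.IsParam τ) (s : X × Bool) : D.start τ s ≠ D.finish τ s := by
  obtain ⟨x, c⟩ := s
  obtain ⟨h0, h1⟩ := hτ.mem x
  have hd := D.dir_ne_zero x
  cases c
  · simp only [start, finish, point, Bool.false_eq_true, if_false, ne_eq, left_eq_add, mul_eq_zero,
      ofReal_eq_zero, not_or]
    exact ⟨h0.ne', hd⟩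
  · simp only [start, finish, ← point_one, point, if_true, ne_eq, add_right_inj]
    exact fun e => h1.ne (by exact_mod_cast mul_right_cancel₀ hd e)

theorem IsParam.pt_injective (hτ : D.IsParam τ) {x y : X} (h : D.pt x = D.pt y) : x = y := by
  rw [← point_zero, ← point_zero] at h
  rcases hτ.simple ⟨le_rfl, one_pos⟩ ⟨le_rfl, one_pos⟩ h with h | ⟨_, _, -, -, h, -⟩
  · exact h.1
  · exact absurd h (hτ.mem x).1.ne

theorem IsParam.pt_ne_point (hτ : D.IsParam τ) {x y : X} : D.pt x ≠ D.point y (τ y) := by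
  intro h
  rw [← point_zero] at h
  rcases hτ.simple ⟨le_rfl, one_pos⟩ (Set.Ioo_subset_Ico_self (hτ.mem y)) h with
    ⟨-, h⟩ | ⟨_, _, -, -, h, -⟩
  · exact (hτ.mem y).1.ne h
  · exact (hτ.mem x).1.ne h

theorem IsParam.point_eq_iff (hτ : D.IsParam τ) {x y : X} (h : D.point x (τ x) = D.point y (τ y)) :
    x = y ∨ ∃ a c, x = D.edge (a, c) ∧ y = D.edge (a, !c) := by
  rcases hτ.simple (Set.Ioo_subset_Ico_self (hτ.mem x)) (Set.Ioo_subset_Ico_self (hτ.mem y)) h with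
    h | ⟨a, c, h1, h2, -⟩
  · exact Or.inl h.1
  · exact Or.inr ⟨a, c, h1, h2⟩

end LinkDiagram

/-! ### Angles of view at a common node -/

section Angles

open Complex

theorem angleAt_start (N Q w : ℂ) : angleAt N Q N w = arg ((Q - N) / (-w)) := by simp [angleAt]

theorem angleAt_finish {P N : ℂ} (h : P ≠ N) (w : ℂ) : angleAt P N N w = arg (-w / (P - N)) := by
  simp [angleAt, h]

theorem angleAt_of_ne {P Q N : ℂ} (hP : P ≠ N) (hQ : Q ≠ N) (w : ℂ) :
    angleAt P Q N w = arg ((Q - N) / (P - N)) := by simp [angleAt, hP, hQ]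

/-- Edges not incident to `N` contribute the same amount for every approach to `N`. A comparison of
the edges at one node then involves only the incident ones. -/
theorem sum_angleAt {S : Type*} [Fintype S] [DecidableEq S] {P Q : S → ℂ} {N : ℂ} {I : Finset S}
    (hI : ∀ s ∉ I, P s ≠ N ∧ Q s ≠ N) (u : S → ℤ) (h : S) (w : ℂ) :
    ∑ s with s ≠ h, u s * angleAt (P s) (Q s) N w =
      ∑ s ∈ Finset.univ \ I, u s * arg ((Q s - N) / (P s - N)) +
        (∑ s ∈ I, u s * angleAt (P s) (Q s) N w - u h * angleAt (P h) (Q h) N w) := by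
  have e : ∑ s ∈ Finset.univ \ I, u s * arg ((Q s - N) / (P s - N)) =
      ∑ s ∈ Finset.univ \ I, u s * angleAt (P s) (Q s) N w :=
    Finset.sum_congr rfl fun s hs => by
      obtain ⟨h1, h2⟩ := hI s (by simpa using hs)
      rw [angleAt_of_ne h1 h2]
  rw [e, ← add_sub_assoc, Finset.sum_sdiff (Finset.subset_univ I), Finset.filter_ne',
    Finset.sum_erase_eq_sub (Finset.mem_univ h)]

theorem arg_real_mul_div_real_mul {a b : ℝ} (ha : 0 < a) (hb : 0 < b) (z w : ℂ) :
    arg ((a * z) / (b * w)) = arg (z / w) := by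
  rw [mul_div_mul_comm, ← ofReal_div, arg_real_mul _ (div_pos ha hb)]

/-- The angles between two directions. -/
theorem arg_crossing {d d' : ℂ} (h : (d' / d).im ≠ 0) {ι : ℤ}
    (hι : ι = if 0 < (d' / d).im then 1 else -1) :
    arg (-d' / d) = arg (d' / d) - ι * Real.pi ∧ arg (d / d') = -arg (d' / d) ∧
      arg (-d / d') = ι * Real.pi - arg (d' / d) := by
  have h1 : arg (-d' / d) = arg (d' / d) - ι * Real.pi := by
    rw [neg_div]
    rcases lt_or_gt_of_ne h with hlt | hlt
    · rw [arg_neg_eq_arg_add_pi_of_im_neg hlt, hι, if_neg hlt.not_gt]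
      push_cast; ring
    · rw [arg_neg_eq_arg_sub_pi_of_im_pos hlt, hι, if_pos hlt]
      push_cast; ring
  have hinv : ∀ ζ : ℂ, ζ.im ≠ 0 → arg ζ⁻¹ = -arg ζ := fun ζ hζ => by
    rw [arg_inv, if_neg fun e => hζ (arg_eq_pi_iff.1 e).2]
  refine ⟨h1, ?_, ?_⟩
  · rw [← hinv _ h, inv_div]
  · have e : -d / d' = (-d' / d)⁻¹ := by rw [inv_div, neg_div, div_neg]
    rw [e, hinv, h1]
    · ring
    · rw [neg_div, neg_im]
      exact neg_ne_zero.2 h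

end Angles

/-! ### Winding numbers of flows on a link diagram -/

namespace LinkDiagram

open Complex

variable {α X : Type*} [Fintype α] [Fintype X] [DecidableEq α] [DecidableEq X]
  {D : LinkDiagram α X} {τ : X → ℝ} {u : X → ℤ}

/-- The flow on the half-edges that is given by a flow on the arcs. -/
def halfFlow (D : LinkDiagram α X) (u : X → ℤ) (s : X × Bool) : ℤ :=
  if s.2 then u (D.next s.1) else u s.1

/-- Collect the terms by nodes: at vertices they telescope along `D.next`, at crossings they cancel
by conservation, and at the auxiliary points the flow does not change. -/
theorem IsParam.sum_halfFlow (hτ : D.IsParam τ)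
    (hcross : ∀ a, u (D.edge (a, false)) + u (D.edge (a, true)) =
      u (D.next (D.edge (a, false))) + u (D.next (D.edge (a, true))))
    (hpass : ∀ x, (∀ a c, D.edge (a, c) ≠ x) → u (D.next x) = u x) (A : ℂ → Real.Angle) :
    ∑ s, D.halfFlow u s • (A (D.finish τ s) - A (D.start τ s)) = 0 := by
  rw [Fintype.sum_prod_type]
  have h1 : ∑ x, (u (D.next x) • A (D.pt (D.next x)) - u x • A (D.pt x)) = 0 := by
    rw [Finset.sum_sub_distrib, Equiv.sum_comp D.next fun x => u x • A (D.pt x), sub_self]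
  have h2 : ∑ x, (u x - u (D.next x)) • A (D.point x (τ x)) = 0 := by
    rw [← Finset.sum_subset (Finset.subset_univ (Finset.univ.map ⟨D.edge, D.edge_injective⟩)),
      Finset.sum_map, Fintype.sum_prod_type]
    · refine Finset.sum_eq_zero fun a _ => ?_
      rw [Fintype.sum_bool]
      simp only [Function.Embedding.coeFn_mk]
      rw [hτ.eq a, ← add_smul]
      have e : u (D.edge (a, true)) - u (D.next (D.edge (a, true))) +
          (u (D.edge (a, false)) - u (D.next (D.edge (a, false)))) = 0 := by
        linarith [hcross a]
      rw [e, zero_smul]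
    · intro x _ hx
      rw [hpass x, sub_self, zero_smul]
      rintro a c rfl
      simp at hx
  have e : ∀ x, ∑ c, D.halfFlow u (x, c) • (A (D.finish τ (x, c)) - A (D.start τ (x, c))) =
      (u (D.next x) • A (D.pt (D.next x)) - u x • A (D.pt x)) +
        (u x - u (D.next x)) • A (D.point x (τ x)) := fun x => by
    rw [Fintype.sum_bool]
    simp only [halfFlow, start, finish, if_true, Bool.false_eq_true, if_false, smul_sub, sub_smul]
    abel
  rw [Finset.sum_congr rfl fun x _ => e x, Finset.sum_add_distrib, h1, h2, add_zero]

/-- The winding numbers around the points of the half-edges -/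
theorem IsParam.exists_winding (hτ : D.IsParam τ)
    (hcross : ∀ a, u (D.edge (a, false)) + u (D.edge (a, true)) =
      u (D.next (D.edge (a, false))) + u (D.next (D.edge (a, true))))
    (hpass : ∀ x, (∀ a c, D.edge (a, c) ≠ x) → u (D.next x) = u x) :
    ∃ k : X × Bool → ℤ, ∀ h,
      (k h * Real.pi = ∑ s with s ≠ h, D.halfFlow u s *
        angleAt (D.start τ s) (D.finish τ s) (D.start τ h) (D.finish τ h - D.start τ h)) ∧
      k h * Real.pi = ∑ s with s ≠ h, D.halfFlow u s *
        angleAt (D.start τ s) (D.finish τ s) (D.finish τ h) (D.start τ h - D.finish τ h) := by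
  choose k hk using _root_.exists_winding (P := D.start τ) (Q := D.finish τ) hτ.start_ne_finish
    (fun h s hs t ht => hτ.notMem_segment hs ht)
    (fun h s => by
      obtain ⟨t, ht, e⟩ := start_eq (D := D) (τ := τ) h
      rw [e]
      exact hτ.notMem_segment_of_node ht)
    (fun h s => by
      obtain ⟨x, t, ht, e⟩ := finish_eq (D := D) (τ := τ) h
      rw [e]
      exact hτ.notMem_segment_of_node ht) (hτ.sum_halfFlow hcross hpass)
  exact ⟨k, hk⟩

variable {k : X × Bool → ℤ}

/-- Only two half-edges end at the vertex. They carry the same flow, and the angle of either one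
seen along the other is the argument of the same quotient. -/
theorem IsParam.winding_vertex (hτ : D.IsParam τ)
    (hk : ∀ h, (k h * Real.pi = ∑ s with s ≠ h, D.halfFlow u s *
        angleAt (D.start τ s) (D.finish τ s) (D.start τ h) (D.finish τ h - D.start τ h)) ∧
      k h * Real.pi = ∑ s with s ≠ h, D.halfFlow u s *
        angleAt (D.start τ s) (D.finish τ s) (D.finish τ h) (D.start τ h - D.finish τ h)) (x : X) :
    k (D.next x, false) = k (x, true) := by
  have h1 := (hk (D.next x, false)).1
  have h2 := (hk (x, true)).2
  have eN : D.finish τ (x, true) = D.start τ (D.next x, false) := by simp [start, finish]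
  have hI : ∀ s ∉ ({(x, true), (D.next x, false)} : Finset (X × Bool)),
      D.start τ s ≠ D.start τ (D.next x, false) ∧ D.finish τ s ≠ D.start τ (D.next x, false) := by
    rintro ⟨y, c⟩ hs
    simp only [Finset.mem_insert, Finset.mem_singleton, not_or] at hs
    cases c <;> simp only [start, finish, Bool.false_eq_true, if_false, if_true]
    · exact ⟨fun e => hs.2 (by rw [hτ.pt_injective e]), fun e => hτ.pt_ne_point e.symm⟩
    · exact ⟨fun e => hτ.pt_ne_point e.symm,
        fun e => hs.1 (by rw [D.next.injective (hτ.pt_injective e)])⟩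
  rw [sum_angleAt hI] at h1
  rw [eN, sum_angleAt hI] at h2
  rw [Finset.sum_pair (by simp)] at h1 h2
  have hne : D.start τ (x, true) ≠ D.start τ (D.next x, false) := by
    rw [← eN]; exact hτ.start_ne_finish _
  rw [eN, angleAt_finish hne] at h1
  rw [angleAt_start] at h2
  have e : (D.finish τ (D.next x, false) - D.start τ (D.next x, false)) /
      -(D.start τ (x, true) - D.start τ (D.next x, false)) =
      -(D.finish τ (D.next x, false) - D.start τ (D.next x, false)) /
      (D.start τ (x, true) - D.start τ (D.next x, false)) := by rw [div_neg, neg_div]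
  rw [e] at h2
  have e' : D.halfFlow u (D.next x, false) = D.halfFlow u (x, true) := by simp [halfFlow]
  rw [e'] at h2 h1
  have := mul_right_cancel₀ Real.pi_ne_zero (h1.trans (Eq.trans (by ring) h2.symm))
  exact_mod_cast this

/-- The same comparison as at a vertex, now at an auxiliary point of an edge without crossing. -/
theorem IsParam.winding_pass (hτ : D.IsParam τ)
    (hk : ∀ h, (k h * Real.pi = ∑ s with s ≠ h, D.halfFlow u s *
        angleAt (D.start τ s) (D.finish τ s) (D.start τ h) (D.finish τ h - D.start τ h)) ∧
      k h * Real.pi = ∑ s with s ≠ h, D.halfFlow u s *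
        angleAt (D.start τ s) (D.finish τ s) (D.finish τ h) (D.start τ h - D.finish τ h)) {x : X}
    (hx : ∀ a c, D.edge (a, c) ≠ x) (hu : u (D.next x) = u x) : k (x, true) = k (x, false) := by
  have h1 := (hk (x, true)).1
  have h2 := (hk (x, false)).2
  have eN : D.finish τ (x, false) = D.start τ (x, true) := by simp [start, finish]
  have hI : ∀ s ∉ ({(x, false), (x, true)} : Finset (X × Bool)),
      D.start τ s ≠ D.start τ (x, true) ∧ D.finish τ s ≠ D.start τ (x, true) := by
    rintro ⟨y, c⟩ hs
    simp only [Finset.mem_insert, Finset.mem_singleton, not_or] at hs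
    have hyx : D.point y (τ y) = D.point x (τ x) → y = x := fun e => by
      rcases hτ.point_eq_iff e with h | ⟨a, c, -, h⟩
      · exact h
      · exact absurd h.symm (hx a _)
    cases c <;> simp only [start, finish, Bool.false_eq_true, if_false, if_true]
    · exact ⟨hτ.pt_ne_point, fun e => hs.1 (by rw [hyx e])⟩
    · exact ⟨fun e => hs.2 (by rw [hyx e]), hτ.pt_ne_point⟩
  rw [sum_angleAt hI] at h1
  rw [eN, sum_angleAt hI] at h2
  rw [Finset.sum_pair (by simp)] at h1 h2
  have hne : D.start τ (x, false) ≠ D.start τ (x, true) := by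
    rw [← eN]; exact hτ.start_ne_finish _
  rw [eN, angleAt_finish hne] at h1
  rw [angleAt_start] at h2
  have e : (D.finish τ (x, true) - D.start τ (x, true)) /
      -(D.start τ (x, false) - D.start τ (x, true)) =
      -(D.finish τ (x, true) - D.start τ (x, true)) /
      (D.start τ (x, false) - D.start τ (x, true)) := by rw [div_neg, neg_div]
  rw [e] at h2
  have e' : D.halfFlow u (x, true) = D.halfFlow u (x, false) := by simp [halfFlow, hu]
  rw [e'] at h2 h1
  have := mul_right_cancel₀ Real.pi_ne_zero (h1.trans (Eq.trans (by ring) h2.symm))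
  exact_mod_cast this

/-- Four half-edges meet here, and all their mutual angles are expressed by the angle between the
two directions and by `ι * π`. The unincident edges drop out of the differences. -/
theorem IsParam.winding_crossing (hτ : D.IsParam τ)
    (hk : ∀ h, (k h * Real.pi = ∑ s with s ≠ h, D.halfFlow u s *
        angleAt (D.start τ s) (D.finish τ s) (D.start τ h) (D.finish τ h - D.start τ h)) ∧
      k h * Real.pi = ∑ s with s ≠ h, D.halfFlow u s *
        angleAt (D.start τ s) (D.finish τ s) (D.finish τ h) (D.start τ h - D.finish τ h)) (a : α)
    {x y : X} (hx : D.edge (a, false) = x) (hy : D.edge (a, true) = y)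
    (hu : u x + u y = u (D.next x) + u (D.next y)) {ι : ℤ}
    (hι : ι = if 0 < (D.dir y / D.dir x).im then 1 else -1) :
    k (x, true) = k (x, false) - ι * (u (D.next y) + u y) ∧
      k (y, false) = k (x, false) - ι * (u x + u y) ∧
      k (y, true) = k (x, false) - ι * (u (D.next y) - u x) := by
  have hxy : x ≠ y := by
    rw [← hx, ← hy]; exact D.edge_ne a false
  have him : (D.dir y / D.dir x).im ≠ 0 := by rw [← hx, ← hy]; exact D.im_div_dir_ne_zero a
  set N := D.point x (τ x) with hN
  have hN' : D.point y (τ y) = N := by rw [hN, ← hx, ← hy]; exact (hτ.eq a).symm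
  let I : Finset (X × Bool) := {(x, false), (x, true), (y, false), (y, true)}
  have hI : ∀ s ∉ I, D.start τ s ≠ N ∧ D.finish τ s ≠ N := by
    rintro ⟨w, c⟩ hs
    simp only [I, Finset.mem_insert, Finset.mem_singleton, not_or] at hs
    have hw : D.point w (τ w) = N → w = x ∨ w = y := fun e => by
      rcases hτ.point_eq_iff e with h | ⟨b, c, h, h'⟩
      · exact Or.inl h
      · right
        rw [← hx] at h'
        have h1 := D.edge_injective h'
        obtain ⟨rfl, e⟩ := Prod.ext_iff.1 h1
        rw [h, ← hy]
        congr 2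
        revert e
        cases c <;> simp
    cases c <;> simp only [start, finish, Bool.false_eq_true, if_false, if_true]
    · refine ⟨hτ.pt_ne_point, fun e => ?_⟩
      rcases hw e with rfl | rfl
      · exact hs.1 rfl
      · exact hs.2.2.1 rfl
    · refine ⟨fun e => ?_, hτ.pt_ne_point⟩
      rcases hw e with rfl | rfl
      · exact hs.2.1 rfl
      · exact hs.2.2.2 rfl
  have hsum : ∀ F : X × Bool → ℝ, ∑ s ∈ I, F s =
      F (x, false) + (F (x, true) + (F (y, false) + F (y, true))) := by
    intro F
    simp only [I]
    rw [Finset.sum_insert (by simp [hxy]), Finset.sum_insert (by simp [hxy]),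
      Finset.sum_pair (by simp)]
  have e1 := (hk (x, false)).2
  have e2 := (hk (x, true)).1
  have e3 := (hk (y, false)).2
  have e4 := (hk (y, true)).1
  have s1 : D.start τ (x, false) = D.pt x := rfl
  have s2 : D.finish τ (x, false) = N := rfl
  have s3 : D.start τ (x, true) = N := rfl
  have s4 : D.finish τ (x, true) = D.pt (D.next x) := rfl
  have s5 : D.start τ (y, false) = D.pt y := rfl
  have s6 : D.finish τ (y, false) = N := hN'
  have s7 : D.start τ (y, true) = N := hN'
  have s8 : D.finish τ (y, true) = D.pt (D.next y) := rfl
  have n1 : D.pt x ≠ N := hτ.pt_ne_point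
  have n2 : D.pt y ≠ N := hτ.pt_ne_point
  obtain ⟨a1, a2⟩ := hτ.mem x
  obtain ⟨b1, b2⟩ := hτ.mem y
  have a3 : 0 < 1 - τ x := by linarith
  have b3 : 0 < 1 - τ y := by linarith
  have d1 : D.pt x - N = (τ x : ℂ) * (-D.dir x) := by rw [hN, point]; ring
  have d2 : D.pt (D.next x) - N = ((1 - τ x : ℝ) : ℂ) * D.dir x := by
    rw [hN, ← point_one, point, point]; push_cast; ring
  have d3 : D.pt y - N = (τ y : ℂ) * (-D.dir y) := by rw [← hN', point]; ring
  have d4 : D.pt (D.next y) - N = ((1 - τ y : ℝ) : ℂ) * D.dir y := by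
    rw [← hN', ← point_one, point, point]; push_cast; ring
  rw [s2, sum_angleAt hI, hsum] at e1
  rw [s3, sum_angleAt hI, hsum] at e2
  rw [s6, sum_angleAt hI, hsum] at e3
  rw [s7, sum_angleAt hI, hsum] at e4
  obtain ⟨t1, t2, t3⟩ := arg_crossing him hι
  have hdx := D.dir_ne_zero x
  have hdy := D.dir_ne_zero y
  simp only [s1, s2, s3, s4, s5, s6, s7, s8, angleAt_start, angleAt_finish n1, angleAt_finish n2,
    d1, d2, d3, d4, ← mul_neg, neg_neg, arg_real_mul_div_real_mul a1 a1,
    arg_real_mul_div_real_mul a3 a1,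
    arg_real_mul_div_real_mul a3 a3, arg_real_mul_div_real_mul b1 b1,
    arg_real_mul_div_real_mul b3 b1,
    arg_real_mul_div_real_mul b3 b3, arg_real_mul_div_real_mul a1 b1,
    arg_real_mul_div_real_mul a3 b1,
    arg_real_mul_div_real_mul a3 b3, arg_real_mul_div_real_mul b1 a1,
    arg_real_mul_div_real_mul b3 a1,
    arg_real_mul_div_real_mul b3 a3, div_self hdx, div_self hdy, arg_one,
    div_neg, ← neg_div, t1, t2, t3] at e1 e2 e3 e4
  have f1 : D.halfFlow u (x, false) = u x := rfl
  have f2 : D.halfFlow u (x, true) = u (D.next x) := rfl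
  have f3 : D.halfFlow u (y, false) = u y := rfl
  have f4 : D.halfFlow u (y, true) = u (D.next y) := rfl
  rw [f1, f2, f3, f4] at e1 e2 e3 e4
  have hu' : (u x : ℝ) + u y = u (D.next x) + u (D.next y) := by exact_mod_cast hu
  have key : ∀ m n : ℤ, (m : ℝ) * Real.pi = n * Real.pi → m = n := fun m n h => by
    exact_mod_cast mul_right_cancel₀ Real.pi_ne_zero h
  -- Conservation of the flow eliminates the angle between the branches; only integer multiples of
  -- `π` survive.
  refine ⟨key _ _ ?_, key _ _ ?_, key _ _ ?_⟩
  · push_cast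
    linear_combination e2 - e1
  · push_cast
    linear_combination e3 - e1 + arg (D.dir y / D.dir x) * hu'
  · push_cast
    linear_combination e4 - e1 + (arg (D.dir y / D.dir x) - ι * Real.pi) * hu'

/-- The Gauss diagram of a diagram of a classical link is planar. -/
theorem isPlanar (D : LinkDiagram α X) : IsPlanar D.gaussDiagram.feet
    (fun a => (D.gaussDiagram.sign a : ℤ)) D.gaussDiagram.next Set.univ Finset.univ := by
  refine ⟨fun x => by simp, fun a _ c => Set.mem_univ _, fun u hu => ?_⟩
  obtain ⟨τ, hτ⟩ := D.exists_isParam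
  have hcross : ∀ a, u (D.edge (a, false)) + u (D.edge (a, true)) =
      u (D.next (D.edge (a, false))) + u (D.next (D.edge (a, true))) := fun a =>
    hu.cross a (Finset.mem_univ a)
  have hpass : ∀ x, (∀ a c, D.edge (a, c) ≠ x) → u (D.next x) = u x := fun x hx =>
    hu.pass x (Set.mem_univ x) fun a _ c => hx a c
  obtain ⟨k, hk⟩ := hτ.exists_winding hcross hpass
  have hv := hτ.winding_vertex hk
  have hc := fun a => hτ.winding_crossing hk a rfl rfl (hcross a) (D.sign_eq a)
  -- The winding sum of an arc is read off on the half-edge just before its terminal point; passing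
  -- the vertex relates it to the half-edge behind the preceding crossing.
  refine ⟨fun x => k (x, false), fun a _ => ?_, fun a _ => ?_, fun a _ => ?_, fun x _ hx => ?_⟩
  · exact (hv _).trans (hc a).1
  · exact (hc a).2.1
  · exact (hv _).trans (hc a).2.2
  · exact (hv x).trans (hτ.winding_pass hk (fun a c => hx a (Finset.mem_univ a) c)
      (hpass x fun a c => hx a (Finset.mem_univ a) c))

end LinkDiagram

/-! ### A curve with one crossing -/

/-- A closed curve with one crossing, in the form of a bowtie -/
noncomputable def bowtie : LinkDiagram (Fin 1) (Fin 4) where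
  next := Equiv.addRight 1
  vertex := ![(0, 0), (2, 2), (2, 0), (0, 2)]
  edge p := if p.2 then 2 else 0
  edge_injective := by decide
  crossing _ := ⟨1 / 2, by norm_num, 1 / 2, by norm_num, by
    ext
    · simp [AffineMap.lineMap_apply]
      norm_num
    · simp [AffineMap.lineMap_apply]⟩
  transverse _ := by simp [planeDet]
  simple := by
    rintro x y s ⟨s0, s1⟩ t ⟨t0, t1⟩ h
    have e1 := congrArg Prod.fst h
    have e2 := congrArg Prod.snd h
    clear h
    fin_cases x <;> fin_cases y <;>
      simp [AffineMap.lineMap_apply] at e1 e2 ⊢ <;> linarith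

namespace bowtie

open GaussDiagram

/-- The passage along the boundary of the surface of the bowtie -/
noncomputable abbrev tracePerm : Equiv.Perm (Fin 4) :=
  bowtie.gaussDiagram.next * _root_.hop bowtie.gaussDiagram.feet Finset.univ

theorem tracePerm_foot (c : Bool) :
    tracePerm (bowtie.edge (0, c)) = bowtie.edge (0, !c) + 1 :=
  congrArg (· + 1) (hop_foot bowtie.gaussDiagram.feet (Finset.mem_univ 0) c)

theorem tracePerm_foot_succ (c : Bool) :
    tracePerm (bowtie.edge (0, !c) + 1) = bowtie.edge (0, c) := by
  have h : _root_.hop bowtie.gaussDiagram.feet Finset.univ (bowtie.edge (0, !c) + 1) =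
      bowtie.edge (0, !c) + 1 := hop_of_forall_ne _ fun a _ d => by
    change (if d then 2 else 0 : Fin 4) ≠ (if !c then 2 else 0) + 1
    revert c d; decide
  change _root_.hop bowtie.gaussDiagram.feet Finset.univ (bowtie.edge (0, !c) + 1) + 1 = _
  rw [h]
  clear h
  change (if !c then 2 else 0 : Fin 4) + 1 + 1 = (if c then 2 else 0)
  revert c; decide

/-- Smoothing the only crossing leaves two cycles with two arcs each. -/
theorem eq_or_eq_of_sameCycle {c : Bool} {x : Fin 4}
    (h : tracePerm.SameCycle (bowtie.edge (0, c)) x) :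
    x = bowtie.edge (0, c) ∨ x = bowtie.edge (0, !c) + 1 := by
  obtain ⟨n, rfl⟩ := Equiv.Perm.sameCycle_iff_exists_nat.1 h
  clear h
  induction n with
  | zero => exact Or.inl rfl
  | succ n ih =>
    rw [pow_succ', Equiv.Perm.mul_apply]
    rcases ih with ih | ih <;> rw [ih]
    · exact Or.inr (tracePerm_foot c)
    · exact Or.inl (tracePerm_foot_succ c)

theorem not_sameCycle (c : Bool) :
    ¬ tracePerm.SameCycle (bowtie.edge (0, c)) (bowtie.edge (0, !c)) := fun h => by
  have e := eq_or_eq_of_sameCycle h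
  change (if !c then 2 else 0 : Fin 4) = (if c then 2 else 0) ∨
    (if !c then 2 else 0 : Fin 4) = (if !c then 2 else 0) + 1 at e
  clear h
  revert c; decide

theorem isCyclePair (c : Bool) :
    IsCyclePair tracePerm (bowtie.edge (0, c)) (bowtie.edge (0, !c)) := by
  have h : ∀ d, tracePerm.SameCycle (bowtie.edge (0, d)) (bowtie.edge (0, !d) + 1) := fun d =>
    ⟨1, by rw [zpow_one, tracePerm_foot]⟩
  refine ⟨not_sameCycle c, fun x => ?_⟩
  have hx : x = bowtie.edge (0, c) ∨ x = bowtie.edge (0, !c) + 1 ∨ x = bowtie.edge (0, !c) ∨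
      x = bowtie.edge (0, !!c) + 1 := by
    change x = (if c then 2 else 0) ∨ x = (if !c then 2 else 0) + 1 ∨ x = (if !c then 2 else 0) ∨
      x = (if !!c then 2 else 0) + 1
    revert c x; decide
  rcases hx with rfl | rfl | rfl | rfl
  · exact Or.inl (Equiv.Perm.SameCycle.refl _ _)
  · exact Or.inl (h c)
  · exact Or.inr (Equiv.Perm.SameCycle.refl _ _)
  · exact Or.inr (h !c)

/-- The only state with one arrow is the full one, and a base point just before an end of the arrow
makes this end the first to be approached. -/
theorem isMonotoneTwo_iff {S : Finset (Fin 1)} {c d : Bool} :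
    (bowtie.gaussDiagram.restrict S).IsMonotoneTwo (bowtie.edge (0, d)) c 1
      bowtie.numComponents ↔ S = Finset.univ ∧ c = d := by
  rw [isMonotoneTwo_restrict bowtie.gaussDiagram (m := bowtie.numComponents) rfl, ← Finset.card_eq_iff_eq_univ, Fintype.card_fin]
  refine and_congr_right fun hS => ?_
  obtain rfl : S = Finset.univ := by
    rwa [← Finset.card_eq_iff_eq_univ, Fintype.card_fin]
  constructor
  · rintro ⟨y, -, -, h⟩
    by_contra hne
    obtain rfl : d = !c := by cases c <;> cases d <;> simp_all
    rcases h 0 (Finset.mem_univ 0) with ⟨k, -, h⟩ | ⟨-, h, -⟩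
    · exact h 0 (Nat.zero_le k) rfl
    · exact h (Equiv.Perm.SameCycle.refl _ _)
  · rintro rfl
    refine ⟨bowtie.edge (0, !c), ⟨0, Finset.mem_univ 0, c, ⟨Equiv.Perm.SameCycle.refl _ _,
      not_sameCycle c⟩, rfl, fun a _ _ _ h => absurd (Subsingleton.elim a 0) h⟩, isCyclePair c,
      fun a _ => Or.inl ?_⟩
    obtain rfl := Subsingleton.elim a 0
    refine ⟨0, rfl, fun j hj => ?_⟩
    obtain rfl := Nat.le_zero.1 hj
    exact bowtie.edge_injective.ne (by simp)

open Classical in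
theorem sum_isMonotoneTwo (c d : Bool) :
    ∑ S : Finset (Fin 1) with (bowtie.gaussDiagram.restrict S).IsMonotoneTwo (bowtie.edge (0, d)) c
      1 bowtie.numComponents, ∏ a ∈ S, (bowtie.gaussDiagram.sign a : ℤ) =
      if c = d then (bowtie.gaussDiagram.sign 0 : ℤ) else 0 := by
  simp only [isMonotoneTwo_iff]
  split_ifs with h
  · simp [h, Finset.filter_eq']
  · simp [h]

theorem ascTwo_eq (d : Bool) :
    bowtie.gaussDiagram.ascTwo (bowtie.edge (0, d)) 1 bowtie.numComponents =
      if true = d then (bowtie.gaussDiagram.sign 0 : ℤ) else 0 :=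
  sum_isMonotoneTwo true d

theorem descTwo_eq (d : Bool) :
    bowtie.gaussDiagram.descTwo (bowtie.edge (0, d)) 1 bowtie.numComponents =
      if false = d then (bowtie.gaussDiagram.sign 0 : ℤ) else 0 :=
  sum_isMonotoneTwo false d

end bowtie

/-! ### The theorem -/

theorem mainTheorem7 :
    (∀ (α X : Type*) [Fintype α] [Fintype X] [DecidableEq α] [DecidableEq X]
        (D : LinkDiagram α X) (m : ℕ), D.numComponents = m →
        ∀ (n : ℕ) (b b' : X), D.gaussDiagram.AD b n m = D.gaussDiagram.AD b' n m) ∧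
      ∃ (k l : ℕ) (D : LinkDiagram (Fin k) (Fin l)) (n : ℕ) (b b' : Fin l),
        D.gaussDiagram.ascTwo b n D.numComponents ≠ D.gaussDiagram.ascTwo b' n D.numComponents ∧
        D.gaussDiagram.descTwo b n D.numComponents ≠
          D.gaussDiagram.descTwo b' n D.numComponents := by
  refine ⟨fun α X _ _ _ _ D m hm n b b' => D.gaussDiagram.AD_eq D.isPlanar hm b b',
    1, 4, bowtie, 1, bowtie.edge (0, true), bowtie.edge (0, false), ?_, ?_⟩
  · rw [bowtie.ascTwo_eq, bowtie.ascTwo_eq]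
    simp
  · rw [bowtie.descTwo_eq, bowtie.descTwo_eq]
    simpa using (Units.ne_zero (bowtie.gaussDiagram.sign 0)).symm
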